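/- All graphs are finite and simple. For a graph $G$ let $C(G)$ be the set of induced cycles of $G$ (induced subgraphs that are cycles, of length at least $3$). A \emph{solid graph} is a graph of one of the following four types. (1) A \emph{pyramid}: a cycle together with one further vertex that is joined to at least three vertices of the cycle. (2) A \emph{trihedron}: the union of three paths of length at least $2$ with the same two distinct ends, such that no interior vertex of one of the paths lies on another one. (3) A \emph{stamp}: the union of a triangle and three paths of length at least $1$ that start at the three different vertices of the triangle, end at the same vertex $x$, and are pairwise disjoint apart from $x$. (4) A \emph{prism}: the union of two vertex-disjoint triangles with vertices $x_1,x_2,x_3$ and $y_1,y_2,y_3$, and of three pairwise vertex-disjoint paths, the $i$-th one from $x_i$ to $y_i$. Let $S(G)$ be the set of solids in $G$, that is, of induced subgraphs of $G$ that are isomorphic to a solid graph. Let $G$ be a connected graph drawn in the plane (vertices are distinct points, edges are simple arcs that meet each other and the vertices only at common end vertices). Then the number $F$ of regions, i.e. of connected components of the complement of the drawing in the plane (the unbounded one included), is finite, and $$|S(G)|-|C(G)|+F\ \ge\ 1 .$$ Moreover, if $|S(G)|-|C(G)|+F=1$, then $\chi(G)\le 4$. -/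

import Mathlib

namespace GraphSolids

/-- `H` is (isomorphic to) a cycle, of some length at least three. -/
def IsCycleGraph {W : Type*} (H : SimpleGraph W) : Prop :=
  ∃ n : ℕ, 3 ≤ n ∧ Nonempty (H ≃g SimpleGraph.cycleGraph n)

/-- A pyramid: a cycle together with one further vertex `w` (the apex) that is joined to at least
three vertices of the cycle. -/
def IsPyramid {W : Type*} (H : SimpleGraph W) : Prop :=
  ∃ w : W, IsCycleGraph (H.induce {w}ᶜ) ∧ 3 ≤ (H.neighborSet w).encard

/-- A trihedron: the union of three paths with the same two distinct ends `a` and `b`, each with at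
least one interior vertex, such that no interior vertex of a path lies on another of the paths. -/
def IsTrihedron {W : Type*} (H : SimpleGraph W) : Prop :=
  ∃ (a b : W) (P : Fin 3 → H.Walk a b),
    a ≠ b ∧
    (∀ i, (P i).IsPath ∧ 2 ≤ (P i).length) ∧
    (∀ i j, i ≠ j → ∀ v, v ∈ (P i).support → v ∈ (P j).support → v = a ∨ v = b) ∧
    ⨆ i, (P i).toSubgraph = ⊤

/-- The subgraph of `H` with vertices `x 0`, `x 1`, `x 2` and all edges of `H` between them; a
triangle as soon as these vertices are pairwise adjacent. -/
def triangle {W : Type*} (H : SimpleGraph W) (x : Fin 3 → W) : H.Subgraph :=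
  (⊤ : H.Subgraph).induce (Set.range x)

/-- A stamp: the union of a triangle and three paths of length at least one, which start at the
three different vertices of the triangle, end at the same vertex `y`, and are disjoint apart from
`y`. -/
def IsStamp {W : Type*} (H : SimpleGraph W) : Prop :=
  ∃ (x : Fin 3 → W) (y : W) (P : ∀ i, H.Walk (x i) y),
    (∀ i j, i ≠ j → H.Adj (x i) (x j)) ∧
    (∀ i, (P i).IsPath ∧ 1 ≤ (P i).length) ∧
    (∀ i j, i ≠ j → ∀ v, v ∈ (P i).support → v ∈ (P j).support → v = y) ∧
    triangle H x ⊔ ⨆ i, (P i).toSubgraph = ⊤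

/-- A prism: the union of two vertex-disjoint triangles `x` and `y` and three vertex-disjoint paths,
the `i`-th one from `x i` to `y i`. -/
def IsPrism {W : Type*} (H : SimpleGraph W) : Prop :=
  ∃ (x y : Fin 3 → W) (P : ∀ i, H.Walk (x i) (y i)),
    (∀ i j, i ≠ j → H.Adj (x i) (x j)) ∧
    (∀ i j, i ≠ j → H.Adj (y i) (y j)) ∧
    (∀ i j, x i ≠ y j) ∧
    (∀ i, (P i).IsPath) ∧
    (∀ i j, i ≠ j → ∀ v, v ∈ (P i).support → v ∉ (P j).support) ∧
    triangle H x ⊔ triangle H y ⊔ ⨆ i, (P i).toSubgraph = ⊤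

/-- The solid graphs. -/
def IsSolidGraph {W : Type*} (H : SimpleGraph W) : Prop :=
  IsPyramid H ∨ IsTrihedron H ∨ IsStamp H ∨ IsPrism H

/-- `C(G)`: the set of all induced cycles in `G`. -/
def inducedCycles {V : Type*} (G : SimpleGraph V) : Set G.Subgraph :=
  {H | H.IsInduced ∧ IsCycleGraph H.coe}

/-- `S(G)`: the set of all solids in `G`, the induced subgraphs that are solid graphs. -/
def solids {V : Type*} (G : SimpleGraph V) : Set G.Subgraph :=
  {H | H.IsInduced ∧ IsSolidGraph H.coe}

/-- A drawing of `G` in the plane (the plane being `ℂ` with its usual topology): distinct vertices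
are distinct points, the edge `uv` is a simple arc between the points `u` and `v` that contains no
other vertex, and two different edges have no point in common except for vertices. -/
structure PlaneDrawing {V : Type*} (G : SimpleGraph V) where
  /-- The point that represents a vertex. -/
  point : V → ℂ
  /-- The set of points of an edge, its ends included. -/
  arc : G.edgeSet → Set ℂ
  point_injective : Function.Injective point
  arc_isArc : ∀ (u v : V) (h : G.Adj u v), ∃ γ : Path (point u) (point v),
    Function.Injective γ ∧ Set.range γ = arc ⟨s(u, v), h⟩
  mem_of_point_mem_arc : ∀ (e : G.edgeSet) (w : V), point w ∈ arc e → w ∈ (e : Sym2 V)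
  arc_inter_arc : ∀ e f : G.edgeSet, e ≠ f → arc e ∩ arc f ⊆ Set.range point

/-- The set of all points of the drawing. -/
def PlaneDrawing.carrier {V : Type*} {G : SimpleGraph V} (D : PlaneDrawing G) : Set ℂ :=
  Set.range D.point ∪ ⋃ e, D.arc e

/-- The regions of the drawing: the connected components of the complement of the drawing in the
plane, the unbounded one included. -/
def PlaneDrawing.regions {V : Type*} {G : SimpleGraph V} (D : PlaneDrawing G) : Set (Set ℂ) :=
  (fun z => connectedComponentIn D.carrierᶜ z) '' D.carrierᶜ

end GraphSolids

namespace GraphSolids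
open Complex Set Topology

/-! ### Continuous logarithms and winding numbers in the plane -/

/-- A null-homotopic map to `ℂ \ {0}` has a continuous logarithm. -/
theorem exists_continuous_log_of_homotopy {X : Type*} [TopologicalSpace X]
    (H : C(unitInterval × X, ℂ))
    (hne : ∀ p, H p ≠ 0) (h0 : ∀ x, H (0, x) = 1) :
    ∃ l : C(X, ℂ), ∀ x, exp (l x) = H (1, x) := by
  let H' : C(unitInterval × X, {z : ℂ // z ≠ 0}) := ⟨fun p => ⟨H p, hne p⟩, by fun_prop⟩
  have hH0 : ∀ x, H' (0, x) = (fun z : ℂ ↦ (⟨_, z.exp_ne_zero⟩ : {z : ℂ // z ≠ 0}))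
      ((ContinuousMap.const X (0 : ℂ)) x) := fun x => by
    apply Subtype.ext; simp [H', h0]
  let L := isCoveringMap_exp.liftHomotopy H' (ContinuousMap.const X (0 : ℂ)) hH0
  refine ⟨⟨fun x => L (1, x), by fun_prop⟩, fun x => ?_⟩
  have := congrFun (isCoveringMap_exp.liftHomotopy_lifts H' (ContinuousMap.const X (0 : ℂ)) hH0)
    (1, x)
  exact congrArg Subtype.val this

/-- If `p` and `q` are joined in `A`, then `(z - p) / (z - q)` has a logarithm off `A`. -/
theorem exists_log_of_joinedIn {A : Set ℂ} {p q : ℂ} (h : JoinedIn A p q) :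
    ∃ l : ℂ → ℂ, ContinuousOn l Aᶜ ∧ ∀ z ∉ A, exp (l z) = (z - p) / (z - q) := by
  classical
  obtain ⟨α, hα⟩ := h
  have hq : q ∈ A := by simpa using hα 1
  have hz : ∀ (z : (Aᶜ : Set ℂ)) (a : ℂ), a ∈ A → (z : ℂ) - a ≠ 0 := fun z a ha h0 =>
    z.2 (by rw [sub_eq_zero.1 h0]; exact ha)
  have hd : ∀ z : unitInterval × (Aᶜ : Set ℂ), (z.2 : ℂ) - q ≠ 0 := fun z => hz _ _ hq
  -- The path is run backwards: the moving zero starts at `q`, where the quotient is 1, and ends at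
  -- `p`.
  let H : C(unitInterval × (Aᶜ : Set ℂ), ℂ) := ⟨fun z => ((z.2 : ℂ) - α (unitInterval.symm z.1)) / ((z.2 : ℂ) - q), by
    have h1 : Continuous fun z : unitInterval × (Aᶜ : Set ℂ) => (z.2 : ℂ) - α (unitInterval.symm z.1) := by fun_prop
    have h2 : Continuous fun z : unitInterval × (Aᶜ : Set ℂ) => (z.2 : ℂ) - q := by fun_prop
    exact h1.div h2 hd⟩
  obtain ⟨l, hl⟩ := exists_continuous_log_of_homotopy H
    (fun z => div_ne_zero (hz _ _ (hα _)) (hd z)) (fun z => by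
      have := hz z q hq
      simp [H, this])
  refine ⟨fun z => if h : z ∈ (Aᶜ : Set ℂ) then l ⟨z, h⟩ else 0, ?_, fun z h => ?_⟩
  · rw [continuousOn_iff_continuous_domRestrict]
    refine l.continuous.congr fun z => ?_
    simp only [domRestrict_apply, z.2, dif_pos]
  · have h' : z ∈ (Aᶜ : Set ℂ) := h
    simp only [dif_pos h', hl]
    simp [H]

/-- A continuous logarithm of the constant `1` is constant on preconnected sets. -/
theorem eq_of_exp_eq_one {X : Type*} [TopologicalSpace X] {S : Set X} (hS : IsPreconnected S)
    {f : X → ℂ} (hf : ContinuousOn f S) (h1 : ∀ z ∈ S, exp (f z) = 1) {x y : X} (hx : x ∈ S)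
    (hy : y ∈ S) : f x = f y := by
  have hm : ∀ z ∈ S, ∃ n : ℤ, f z = n * (2 * Real.pi * I) := fun z hz =>
    Complex.exp_eq_one_iff.1 (h1 z hz)
  have key := hS.image (fun z => (f z).im / (2 * Real.pi))
    ((Complex.continuous_im.comp_continuousOn hf).div_const _)
  have him : ∀ z ∈ S, ∀ n : ℤ, f z = n * (2 * Real.pi * I) → (f z).im / (2 * Real.pi) = n := by
    intro z _ n hn
    have hpi := Real.pi_ne_zero
    rw [hn]
    simp
  obtain ⟨n, hn⟩ := hm x hx
  obtain ⟨m, hm'⟩ := hm y hy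
  suffices n = m by rw [hn, hm', this]
  by_contra hne
  have aux : ∀ n m : ℤ, ∀ x ∈ S, ∀ y ∈ S, f x = n * (2 * Real.pi * I) →
      f y = m * (2 * Real.pi * I) → n < m → False := by
    intro n m x hx y hy hn hm' hlt
    have hlt' : (n : ℝ) + 1 ≤ m := by exact_mod_cast hlt
    have hmem := key.ordConnected.out (mem_image_of_mem _ hx) (mem_image_of_mem _ hy)
    -- The values of `im f / 2π` are integers and their set is order-connected, so two different
    -- ones would force a half-integer.
    have : (n : ℝ) + 1 / 2 ∈ (fun z => (f z).im / (2 * Real.pi)) '' S := by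
      apply hmem
      rw [him x hx n hn, him y hy m hm']
      constructor <;> linarith
    obtain ⟨z, hz, hzeq⟩ := this
    obtain ⟨k, hk⟩ := hm z hz
    have := him z hz k hk
    simp only at hzeq
    rw [this] at hzeq
    have h2 : (2 * k : ℝ) = 2 * n + 1 := by linarith
    have h3 : 2 * k = 2 * n + 1 := by exact_mod_cast h2
    omega
  rcases lt_or_gt_of_ne hne with h | h
  · exact aux n m x hx y hy hn hm' h
  · exact aux m n y hy x hx hm' hn h

/-- On the circle `L` and `n (log ρ + iθ)` are logarithms of the same function, so they differ by a
constant. Comparing θ = 0 with θ = 2π leaves 2πin = 0. -/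
theorem eq_zero_of_log_on_sphere {p : ℂ} {ρ : ℝ} (hρ : 0 < ρ) {n : ℤ} {L : ℂ → ℂ}
    (hL : ContinuousOn L (Metric.sphere p ρ))
    (h : ∀ z ∈ Metric.sphere p ρ, exp (L z) = (z - p) ^ n) : n = 0 := by
  have hmem : ∀ θ : ℝ, circleMap p ρ θ ∈ Metric.sphere p ρ :=
    fun θ => circleMap_mem_sphere p hρ.le θ
  have hc : ContinuousOn (fun θ : ℝ => L (circleMap p ρ θ) - n * (Real.log ρ + θ * I)) univ := by
    refine ContinuousOn.sub (hL.comp (continuous_circleMap p ρ).continuousOn fun θ _ => hmem θ) ?_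
    fun_prop
  have key := eq_of_exp_eq_one (x := (0 : ℝ)) (y := 2 * Real.pi) isPreconnected_univ hc
    (fun θ _ => by
      have hρ' : (ρ : ℂ) ≠ 0 := by exact_mod_cast hρ.ne'
      rw [exp_sub, h _ (hmem θ), exp_int_mul, exp_add, ← ofReal_exp, Real.exp_log hρ]
      simp only [circleMap, add_sub_cancel_left]
      exact div_self (zpow_ne_zero _ (mul_ne_zero hρ' (exp_ne_zero _)))) (mem_univ _) (mem_univ _)
  have hper : circleMap p ρ (2 * Real.pi) = circleMap p ρ 0 := by
    simpa using periodic_circleMap p ρ 0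
  simp only [hper] at key
  have h2 : (n : ℂ) * (2 * Real.pi * I) = 0 := by
    have : (n : ℂ) * (Real.log ρ + (0 : ℝ) * I) = n * (Real.log ρ + (2 * Real.pi : ℝ) * I) := by
      linear_combination -key
    push_cast at this
    linear_combination -this
  have hpi : (2 * Real.pi * I : ℂ) ≠ 0 := two_pi_I_ne_zero
  simpa [hpi] using h2

end GraphSolids

/-! ### Winding functions of fundamental cycles -/

namespace GraphSolids
open Complex Set Topology

/-- Two logarithms of `(z - p) / (z - q)` off sets that only meet in `p` and `q` near `p` cannot
differ by a constant near `p`. -/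
theorem not_const_of_logs {B A₁ A₂ : Set ℂ} {p q : ℂ} (hB : IsOpen B) (hp : p ∈ B) (hpq : p ≠ q)
    (h₁ : IsClosed A₁) (h₂ : IsClosed A₂) (hA : B ∩ A₁ ∩ A₂ ⊆ {p, q}) {l₁ l₂ : ℂ → ℂ}
    (c₁ : ContinuousOn l₁ A₁ᶜ) (e₁ : ∀ z ∉ A₁, exp (l₁ z) = (z - p) / (z - q))
    (c₂ : ContinuousOn l₂ A₂ᶜ) (e₂ : ∀ z ∉ A₂, exp (l₂ z) = (z - p) / (z - q)) (k : ℂ)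
    (hk : ∀ z ∈ B, z ∉ A₁ → z ∉ A₂ → l₁ z - l₂ z = k) (hpA : p ∈ A₁) (hqA : q ∈ A₁)
    (hpA' : p ∈ A₂) (hqA' : q ∈ A₂) : False := by
  classical
  -- A difference of two logarithms of one function exponentiates to 1. If no point of `B` avoids
  -- both sets, the condition is empty and 0 will do.
  obtain ⟨k, hk, hk1⟩ : ∃ k : ℂ, (∀ z ∈ B, z ∉ A₁ → z ∉ A₂ → l₁ z - l₂ z = k) ∧ exp k = 1 := by
    by_cases h : ∃ z ∈ B, z ∉ A₁ ∧ z ∉ A₂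
    · obtain ⟨z, hz, hz1, hz2⟩ := h
      refine ⟨k, hk, ?_⟩
      rw [← hk z hz hz1 hz2, exp_sub, e₁ z hz1, e₂ z hz2]
      refine div_self (div_ne_zero ?_ ?_) <;> rw [sub_ne_zero] <;> rintro rfl <;> contradiction
    · push Not at h
      exact ⟨0, fun z hz hz1 hz2 => absurd (h z hz hz1) hz2, exp_zero⟩
  -- Inside `B` the two sets meet at most in `p` and `q`, so `l₁` and the shifted `l₂` glue to one
  -- logarithm of the quotient on `B` without these points.
  let L : ℂ → ℂ := fun z => if z ∉ A₁ then l₁ z else l₂ z + k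
  have hL2 : ∀ z ∈ B, z ∉ A₂ → L z = l₂ z + k := by
    intro z hz hz2
    by_cases hz1 : z ∈ A₁
    · simp [L, hz1]
    · simp only [L, hz1, not_false_eq_true, if_true]
      linear_combination hk z hz hz1 hz2
  have hLc : ∀ z ∈ B, z ≠ p → z ≠ q → ContinuousAt L z := by
    intro z hz hzp hzq
    by_cases hz1 : z ∈ A₁
    · have hz2 : z ∉ A₂ := fun h => by
        rcases hA ⟨⟨hz, hz1⟩, h⟩ with h | h <;> contradiction
      have hn : B ∩ A₂ᶜ ∈ 𝓝 z := (hB.inter h₂.isOpen_compl).mem_nhds ⟨hz, hz2⟩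
      have : ContinuousAt (fun z => l₂ z + k) z :=
        (c₂.continuousAt (h₂.isOpen_compl.mem_nhds hz2)).add continuousAt_const
      refine this.congr ?_
      filter_upwards [hn] with w hw
      exact (hL2 w hw.1 hw.2).symm
    · refine (c₁.continuousAt (h₁.isOpen_compl.mem_nhds hz1)).congr ?_
      filter_upwards [h₁.isOpen_compl.mem_nhds hz1] with w hw
      have hw' : w ∉ A₁ := hw
      simp [L, hw']
  have hLe : ∀ z ∈ B, z ≠ p → z ≠ q → exp (L z) = (z - p) / (z - q) := by
    intro z hz hzp hzq
    by_cases hz1 : z ∈ A₁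
    · have hz2 : z ∉ A₂ := fun h => by
        rcases hA ⟨⟨hz, hz1⟩, h⟩ with h | h <;> contradiction
      rw [hL2 z hz hz2, exp_add, hk1, mul_one, e₂ z hz2]
    · simp [L, hz1, e₁ z hz1]
  obtain ⟨ε, hε, hεB⟩ := Metric.isOpen_iff.1 hB p hp
  have hd : 0 < dist p q := dist_pos.2 hpq
  obtain ⟨ρ, hρ, hρε, hρd⟩ : ∃ ρ : ℝ, 0 < ρ ∧ ρ < ε ∧ ρ < dist p q :=
    ⟨min ε (dist p q) / 2, by positivity, by
      have := min_le_left ε (dist p q); have : 0 < min ε (dist p q) := by positivity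
      linarith, by
      have := min_le_right ε (dist p q); have : 0 < min ε (dist p q) := by positivity
      linarith⟩
  have hsp : ∀ z ∈ Metric.sphere p ρ, z ∈ B ∧ z ≠ p ∧ z ≠ q := by
    intro z hz
    have hz' : dist z p = ρ := hz
    refine ⟨hεB (by rw [Metric.mem_ball, hz']; exact hρε), ?_, ?_⟩
    · rintro rfl; rw [dist_self] at hz'; linarith
    · rintro rfl; rw [dist_comm] at hz'; linarith
  have hpq' : p - q ≠ 0 := sub_ne_zero.2 hpq
  have hslit : ∀ z ∈ Metric.sphere p ρ, 1 + (z - p) / (p - q) ∈ slitPlane := by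
    intro z hz
    have hz' : dist z p = ρ := hz
    apply mem_slitPlane_of_norm_lt_one
    rw [norm_div, ← dist_eq_norm, ← dist_eq_norm, hz', div_lt_one hd]
    exact hρd
  -- On a circle about `p` of radius below `dist p q` the factor `z - q` has a logarithm. Adding it
  -- to `L` would give a logarithm of `z - p`, which winds once.
  have := eq_zero_of_log_on_sphere (p := p) (n := 1) hρ
    (L := fun z => L z + (log (p - q) + log (1 + (z - p) / (p - q)))) ?_ ?_
  · exact one_ne_zero this
  · refine ContinuousOn.add (fun z hz => ?_) (ContinuousOn.add continuousOn_const ?_)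
    · exact (hLc z (hsp z hz).1 (hsp z hz).2.1 (hsp z hz).2.2).continuousWithinAt
    · exact ContinuousOn.clog (by fun_prop) hslit
  · intro z hz
    obtain ⟨hzB, hzp, hzq⟩ := hsp z hz
    have hzq' : z - q ≠ 0 := sub_ne_zero.2 hzq
    rw [exp_add, hLe z hzB hzp hzq, exp_add, exp_log hpq',
      exp_log (slitPlane_ne_zero (hslit z hz)), zpow_one]
    field_simp
    ring

namespace PlaneDrawing
variable {V : Type*} {G : SimpleGraph V} (D : PlaneDrawing G)

theorem exists_param (e : G.edgeSet) : ∃ (u v : V) (g : ℝ → ℂ), e.1 = s(u, v) ∧ G.Adj u v ∧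
    Continuous g ∧ InjOn g (Icc 0 1) ∧ g 0 = D.point u ∧ g 1 = D.point v ∧
    g '' Icc 0 1 = D.arc e := by
  obtain ⟨e, he⟩ := e
  induction e with
  | _ u v =>
    obtain ⟨γ, hγ, hr⟩ := D.arc_isArc u v he
    refine ⟨u, v, γ.extend, rfl, he, γ.continuous_extend, ?_, γ.extend_zero, γ.extend_one, ?_⟩
    · intro a ha b hb hab
      rw [γ.extend_apply ha, γ.extend_apply hb] at hab
      exact congrArg Subtype.val (hγ hab)
    · rw [← hr]
      ext z
      constructor
      · rintro ⟨a, ha, rfl⟩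
        exact ⟨⟨a, ha⟩, (γ.extend_apply ha).symm⟩
      · rintro ⟨a, rfl⟩
        exact ⟨a, a.2, γ.extend_apply a.2⟩

theorem isCompact_arc (e : G.edgeSet) : IsCompact (D.arc e) := by
  obtain ⟨u, v, g, -, -, hg, -, -, -, h⟩ := D.exists_param e
  rw [← h]
  exact isCompact_Icc.image hg

/-- The part of the drawing that belongs to a spanning subgraph. -/
def part (T : SimpleGraph V) : Set ℂ :=
  range D.point ∪ ⋃ e : G.edgeSet, ⋃ _ : e.1 ∈ T.edgeSet, D.arc e

theorem arc_subset_part {T : SimpleGraph V} (e : G.edgeSet) (he : e.1 ∈ T.edgeSet) :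
    D.arc e ⊆ D.part T :=
  fun _ hz => Or.inr (mem_iUnion₂.2 ⟨e, he, hz⟩)

theorem isCompact_part [Finite V] (T : SimpleGraph V) : IsCompact (D.part T) := by
  refine (finite_range _).isCompact.union (isCompact_iUnion fun e => ?_)
  exact (isCompact_iUnion fun _ => D.isCompact_arc e)

theorem isCompact_carrier [Finite V] : IsCompact D.carrier :=
  (finite_range _).isCompact.union (isCompact_iUnion fun e => D.isCompact_arc e)

theorem joinedIn_image {g : ℝ → ℂ} (hg : Continuous g) {a b c d : ℝ} (hc : c ∈ Icc a b)
    (hd : d ∈ Icc a b) : JoinedIn (g '' Icc a b) (g c) (g d) := by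
  have h : IsPathConnected (Icc a b) := (convex_Icc a b).isPathConnected ⟨c, hc⟩
  exact (h.image hg).joinedIn _ (mem_image_of_mem _ hc) _ (mem_image_of_mem _ hd)

theorem joinedIn_part {T : SimpleGraph V} (hT : T ≤ G) {u v : V} (h : T.Reachable u v) :
    JoinedIn (D.part T) (D.point u) (D.point v) := by
  obtain ⟨w⟩ := h
  induction w with
  | nil => exact JoinedIn.refl (Or.inl ⟨_, rfl⟩)
  | @cons u w v h _ ih =>
    refine JoinedIn.trans ?_ ih
    have hs := D.arc_subset_part (T := T) ⟨s(u, w), hT h⟩ h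
    obtain ⟨γ, -, hr⟩ := D.arc_isArc u w (hT h)
    exact ⟨γ, fun t => hs (hr ▸ mem_range_self t)⟩

/-- An edge outside a connected spanning subgraph gives a winding number function that is locally
constant off a fundamental cycle and jumps at the edge. -/
theorem exists_winding [Finite V] {T : SimpleGraph V} (hT : T ≤ G) (hconn : T.Connected)
    (e : G.edgeSet) (he : e.1 ∉ T.edgeSet) :
    ∃ (B : Set ℂ) (n : ℂ → ℂ), IsPreconnected B ∧ (∀ f ≠ e, Disjoint B (D.arc f)) ∧
      Disjoint B (range D.point) ∧ ContinuousOn n (D.arc e ∪ D.part T)ᶜ ∧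
      (∀ z ∉ D.arc e ∪ D.part T, exp (n z) = 1) ∧ ∀ k, ∃ z ∈ B, z ∉ D.arc e ∧ n z ≠ k := by
  obtain ⟨u, v, g, heq, huv, hg, hinj, hg0, hg1, hg01⟩ := D.exists_param e
  -- `R` is everything except the open arc of `e`; it is closed, so a ball about an inner point of
  -- the arc avoids it.
  set R : Set ℂ := range D.point ∪ ⋃ f : G.edgeSet, ⋃ _ : f ≠ e, D.arc f with hR
  have hRc : IsClosed R := ((finite_range _).isCompact.union (isCompact_iUnion fun f =>
    isCompact_iUnion fun _ => D.isCompact_arc f)).isClosed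
  have hmid : (1 / 2 : ℝ) ∈ Icc (0 : ℝ) 1 := by constructor <;> norm_num
  have hgp : g (1 / 2) ∉ range D.point := by
    rintro ⟨w, hw⟩
    have hwe := D.mem_of_point_mem_arc e w (by rw [hw, ← hg01]; exact mem_image_of_mem _ hmid)
    rw [heq, Sym2.mem_iff] at hwe
    rcases hwe with rfl | rfl
    · rw [← hg0] at hw
      have := hinj (by simp) hmid hw
      norm_num at this
    · rw [← hg1] at hw
      have := hinj (by simp) hmid hw
      norm_num at this
  have hgR : g (1 / 2) ∉ R := by
    rintro (h | h)
    · exact hgp h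
    · obtain ⟨f, hf, hz⟩ := mem_iUnion₂.1 h
      exact hgp (D.arc_inter_arc f e hf ⟨hz, by rw [← hg01]; exact mem_image_of_mem _ hmid⟩)
  obtain ⟨ε, hε, hεR⟩ := Metric.isOpen_iff.1 hRc.isOpen_compl _ hgR
  obtain ⟨δ, hδ, hδB⟩ := Metric.continuous_iff.1 hg (1 / 2) ε hε
  obtain ⟨η, hη, hηδ, hη4⟩ : ∃ η : ℝ, 0 < η ∧ η < δ ∧ η < 1 / 2 :=
    ⟨min (δ / 2) (1 / 4), by positivity, by
      have := min_le_left (δ / 2) (1 / 4); linarith, by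
      have := min_le_right (δ / 2) (1 / 4); linarith⟩
  set s : ℝ := 1 / 2 - η with hs
  set t : ℝ := 1 / 2 + η with ht
  have hgB : ∀ x ∈ Icc s t, g x ∈ Metric.ball (g (1 / 2)) ε := by
    intro x hx
    apply hδB
    rw [Real.dist_eq, abs_lt]
    constructor <;> [have := hx.1; have := hx.2] <;> linarith
  have hBR : ∀ z ∈ Metric.ball (g (1 / 2)) ε, z ∉ R := fun z hz => hεR hz
  have hBp : ∀ z ∈ Metric.ball (g (1 / 2)) ε, z ∉ D.part T := by
    rintro z hz (h | h)
    · exact hBR z hz (Or.inl h)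
    · obtain ⟨f, hf, hzf⟩ := mem_iUnion₂.1 h
      exact hBR z hz (Or.inr (mem_iUnion₂.2 ⟨f, by rintro rfl; exact he hf, hzf⟩))
  have hs0 : 0 < s := by linarith
  have hst : s < t := by linarith
  have ht1 : t < 1 := by linarith
  have h01 : ∀ x ∈ Icc s t, x ∈ Icc (0 : ℝ) 1 := fun x hx => ⟨by linarith [hx.1], by linarith [hx.2]⟩
  -- `A₁` is a middle piece of the edge inside the ball, `A₂` the remainder of the edge with the
  -- drawing of `T`. Each joins `g s` to `g t`, so each yields a logarithm of the same quotient;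
  -- their difference is 2πi times an integer-valued winding function.
  set A₁ : Set ℂ := g '' Icc s t with hA₁
  set A₂ : Set ℂ := (g '' Icc 0 s ∪ g '' Icc t 1) ∪ D.part T with hA₂
  have hsub : A₁ ∪ A₂ ⊆ D.arc e ∪ D.part T := by
    rw [← hg01]
    rintro z (⟨x, hx, rfl⟩ | (⟨x, hx, rfl⟩ | ⟨x, hx, rfl⟩) | h)
    · exact Or.inl (mem_image_of_mem _ (h01 x hx))
    · exact Or.inl (mem_image_of_mem _ ⟨hx.1, by linarith [hx.2]⟩)
    · exact Or.inl (mem_image_of_mem _ ⟨by linarith [hx.1], hx.2⟩)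
    · exact Or.inr h
  have hcover : ∀ z, z ∈ D.arc e → z ∈ A₁ ∪ A₂ := by
    rw [← hg01]
    rintro _ ⟨x, hx, rfl⟩
    rcases le_total x s with h | h
    · exact Or.inr (Or.inl (Or.inl (mem_image_of_mem _ ⟨hx.1, h⟩)))
    rcases le_total x t with h' | h'
    · exact Or.inl (mem_image_of_mem _ ⟨h, h'⟩)
    · exact Or.inr (Or.inl (Or.inr (mem_image_of_mem _ ⟨h', hx.2⟩)))
  have hj₁ : JoinedIn A₁ (g s) (g t) := joinedIn_image hg ⟨le_rfl, hst.le⟩ ⟨hst.le, le_rfl⟩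
  have hj₂ : JoinedIn A₂ (g s) (g t) := by
    have h1 : JoinedIn A₂ (g s) (g 0) :=
      (joinedIn_image hg (a := 0) (b := s) ⟨hs0.le, le_rfl⟩ ⟨le_rfl, hs0.le⟩).mono
        fun z hz => Or.inl (Or.inl hz)
    have h2 : JoinedIn A₂ (g 0) (g 1) := by
      rw [hg0, hg1]
      exact (D.joinedIn_part hT (hconn.preconnected u v)).mono fun z hz => Or.inr hz
    have h3 : JoinedIn A₂ (g 1) (g t) :=
      (joinedIn_image hg (a := t) (b := 1) ⟨ht1.le, le_rfl⟩ ⟨le_rfl, ht1.le⟩).mono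
        fun z hz => Or.inl (Or.inr hz)
    exact (h1.trans h2).trans h3
  obtain ⟨l₁, c₁, e₁⟩ := exists_log_of_joinedIn hj₁
  obtain ⟨l₂, c₂, e₂⟩ := exists_log_of_joinedIn hj₂
  have hA₁c : IsClosed A₁ := (isCompact_Icc.image hg).isClosed
  have hA₂c : IsClosed A₂ := (((isCompact_Icc.image hg).union (isCompact_Icc.image hg)).union
    (D.isCompact_part T)).isClosed
  have hsI : s ∈ Icc s t := ⟨le_rfl, hst.le⟩
  have htI : t ∈ Icc s t := ⟨hst.le, le_rfl⟩
  refine ⟨Metric.ball (g (1 / 2)) ε, fun z => l₁ z - l₂ z,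
    (convex_ball _ _).isPreconnected, fun f hf => ?_, ?_, ?_, ?_, ?_⟩
  · exact disjoint_left.2 fun z hz hzf => hBR z hz (Or.inr (mem_iUnion₂.2 ⟨f, hf, hzf⟩))
  · exact disjoint_left.2 fun z hz hzf => hBR z hz (Or.inl hzf)
  · refine (c₁.mono ?_).sub (c₂.mono ?_)
    · exact compl_subset_compl.2 fun z hz => hsub (Or.inl hz)
    · exact compl_subset_compl.2 fun z hz => hsub (Or.inr hz)
  · intro z hz
    have hz1 : z ∉ A₁ := fun h => hz (hsub (Or.inl h))
    have hz2 : z ∉ A₂ := fun h => hz (hsub (Or.inr h))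
    rw [exp_sub, e₁ z hz1, e₂ z hz2]
    refine div_self (div_ne_zero ?_ ?_) <;> rw [sub_ne_zero] <;> rintro rfl
    · exact hz1 (mem_image_of_mem _ hsI)
    · exact hz1 (mem_image_of_mem _ htI)
  · intro k
    by_contra hcon
    push Not at hcon
    refine not_const_of_logs (Metric.isOpen_ball (x := g (1 / 2)) (ε := ε)) (hgB s hsI) ?_ hA₁c
      hA₂c ?_ c₁ e₁ c₂ e₂ k ?_ (mem_image_of_mem _ hsI) (mem_image_of_mem _ htI)
      (Or.inl (Or.inl (mem_image_of_mem _ ⟨hs0.le, le_rfl⟩)))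
      (Or.inl (Or.inr (mem_image_of_mem _ ⟨le_rfl, ht1.le⟩)))
    · intro h
      have := hinj (h01 s hsI) (h01 t htI) h
      linarith
    · rintro z ⟨⟨hz, ⟨x, hx, rfl⟩⟩, (⟨y, hy, hxy⟩ | ⟨y, hy, hxy⟩) | h⟩
      · have := hinj ⟨hy.1, by linarith [hy.2]⟩ (h01 x hx) hxy
        have : x = s := le_antisymm (this ▸ hy.2) hx.1
        exact Or.inl (by rw [this])
      · have := hinj ⟨by linarith [hy.1], hy.2⟩ (h01 x hx) hxy
        have : x = t := le_antisymm hx.2 (this ▸ hy.1)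
        exact Or.inr (by rw [this, mem_singleton_iff])
      · exact absurd h (hBp _ hz)
    · intro z hz hz1 hz2
      exact hcon z hz fun h => (hcover z h).elim hz1 hz2

end PlaneDrawing
end GraphSolids

/-! ### Half of Euler's formula: there are many regions -/

namespace GraphSolids
open Complex Set Topology
namespace PlaneDrawing
variable {V : Type*} {G : SimpleGraph V} (D : PlaneDrawing G)

theorem arc_subset_carrier (e : G.edgeSet) : D.arc e ⊆ D.carrier :=
  fun _ hz => Or.inr (mem_iUnion.2 ⟨e, hz⟩)

theorem part_subset_carrier (T : SimpleGraph V) : D.part T ⊆ D.carrier := by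
  rintro z (h | h)
  · exact Or.inl h
  · obtain ⟨e, -, hz⟩ := mem_iUnion₂.1 h
    exact D.arc_subset_carrier e hz

theorem exists_not_mem_carrier [Finite V] : ∃ z, z ∉ D.carrier := by
  by_contra h
  push Not at h
  exact noncompact_univ ℂ (eq_univ_of_forall h ▸ D.isCompact_carrier)

/-- The part of Euler's formula that says that there are many regions. -/
theorem card_edges_add_two_le [Finite V] (hG : G.Connected) (hfin : D.regions.Finite) :
    G.edgeSet.ncard + 2 ≤ Nat.card V + D.regions.ncard := by
  classical
  have := Fintype.ofFinite V
  obtain ⟨T, hT, hTree⟩ := hG.exists_isTree_le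
  let E := {e : G.edgeSet // e.1 ∉ T.edgeSet}
  have hw := fun e : E => D.exists_winding hT hTree.1 e.1 e.2
  choose B n hB hBf hBp hnc hne hnk using hw
  have : Fintype D.regions := hfin.fintype
  have hrep : ∀ W : D.regions, ∃ z, z ∉ D.carrier ∧ connectedComponentIn D.carrierᶜ z = W :=
    fun W => W.2
  choose r hr hrW using hrep
  have hsub : ∀ e : E, D.arc e.1 ∪ D.part T ⊆ D.carrier := fun e =>
    union_subset (D.arc_subset_carrier _) (D.part_subset_carrier T)
  have hconst : ∀ (e : E) (z : ℂ) (hz : z ∉ D.carrier),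
      n e z = n e (r ⟨_, mem_image_of_mem _ hz⟩) := by
    intro e z hz
    have hc : connectedComponentIn D.carrierᶜ z ⊆ (D.arc e.1 ∪ D.part T)ᶜ :=
      (connectedComponentIn_subset _ _).trans (compl_subset_compl.2 (hsub e))
    refine eq_of_exp_eq_one isPreconnected_connectedComponentIn ((hnc e).mono hc)
      (fun w hw => hne e w (hc hw)) (mem_connectedComponentIn hz) ?_
    have h := mem_connectedComponentIn (F := D.carrierᶜ) (hr ⟨_, mem_image_of_mem _ hz⟩)
    rwa [hrW] at h
  -- Constants (index `none`) and winding functions, evaluated at representatives of the regions.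
  -- The source has dimension |E| - |V| + 2, so injectivity is the claim.
  let Φ : (Option E → ℂ) →ₗ[ℂ] (D.regions → ℂ) :=
    { toFun := fun c W => c none + ∑ e, c (some e) * n e (r W)
      map_add' := fun c d => by
        ext W
        simp only [Pi.add_apply, add_mul, Finset.sum_add_distrib]
        ring
      map_smul' := fun a c => by
        ext W
        simp only [Pi.smul_apply, smul_eq_mul, RingHom.id_apply, mul_add, Finset.mul_sum, mul_assoc] }
  have hinj : Function.Injective Φ := by
    rw [← LinearMap.ker_eq_bot, LinearMap.ker_eq_bot']
    intro c hc
    have h0 : ∀ z, z ∉ D.carrier → c none + ∑ e, c (some e) * n e z = 0 := by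
      intro z hz
      have := congrFun hc ⟨_, mem_image_of_mem _ hz⟩
      simp only [Φ, LinearMap.coe_mk, AddHom.coe_mk, Pi.zero_apply] at this
      rw [← this]
      congr 1
      exact Finset.sum_congr rfl fun e _ => by rw [← hconst e z hz]
    have hBc : ∀ (e : E) z, z ∈ B e → z ∉ D.arc e.1 → z ∉ D.carrier := by
      rintro e z hz hze (h | h)
      · exact disjoint_left.1 (hBp e) hz h
      · obtain ⟨f, hf⟩ := mem_iUnion.1 h
        by_cases hfe : f = e.1
        · exact hze (hfe ▸ hf)
        · exact disjoint_left.1 (hBf e f hfe) hz hf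
    -- On `B e` every winding function except that of `e` is constant, while that of `e` takes two
    -- values off the drawing.
    have hsome : ∀ e : E, c (some e) = 0 := by
      intro e
      by_contra hne0
      obtain ⟨b, hb, hbe, -⟩ := hnk e 0
      obtain ⟨z, hz, hze, hzk⟩ := hnk e (n e b)
      apply hzk
      have hother : ∀ f : E, f ≠ e → n f z = n f b := by
        intro f hf
        have hd : B e ⊆ (D.arc f.1 ∪ D.part T)ᶜ := by
          rintro w hw (h | h | h)
          · exact disjoint_left.1 (hBf e f.1 fun h' => hf (Subtype.ext h')) hw h
          · exact disjoint_left.1 (hBp e) hw h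
          · obtain ⟨a, ha, hwa⟩ := mem_iUnion₂.1 h
            exact disjoint_left.1 (hBf e a fun h' => e.2 (h' ▸ ha)) hw hwa
        exact eq_of_exp_eq_one (hB e) ((hnc f).mono hd) (fun w hw => hne f w (hd hw)) hz hb
      have h1 := h0 z (hBc e z hz hze)
      have h2 := h0 b (hBc e b hb hbe)
      have h3 : ∑ f, c (some f) * n f z - ∑ f, c (some f) * n f b
          = c (some e) * (n e z - n e b) := by
        rw [← Finset.sum_sub_distrib, Finset.sum_eq_single e]
        · ring
        · intro f _ hf
          rw [hother f hf, sub_self]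
        · intro h; exact absurd (Finset.mem_univ e) h
      have h4 : c (some e) * (n e z - n e b) = 0 := by
        rw [← h3]; linear_combination h1 - h2
      exact sub_eq_zero.1 ((mul_eq_zero.1 h4).resolve_left hne0)
    ext o
    cases o with
    | some e => exact hsome e
    | none =>
      obtain ⟨z, hz⟩ := D.exists_not_mem_carrier
      have := h0 z hz
      simpa [hsome] using this
  have hcard := LinearMap.finrank_le_finrank_of_injective hinj
  rw [Module.finrank_fintype_fun_eq_card, Module.finrank_fintype_fun_eq_card, Fintype.card_option,
    ← Nat.card_eq_fintype_card (α := D.regions), Nat.card_coe_set_eq,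
    ← Nat.card_eq_fintype_card (α := E)] at hcard
  have hE : Nat.card E = (G.edgeSet \ T.edgeSet).ncard := by
    rw [← Nat.card_coe_set_eq]
    exact Nat.card_congr (Equiv.subtypeSubtypeEquivSubtypeInter (· ∈ G.edgeSet) (· ∉ T.edgeSet))
  have hTc : T.edgeSet.ncard + 1 = Nat.card V := by
    rw [Nat.card_eq_fintype_card, ← hTree.card_edgeFinset, ← SimpleGraph.coe_edgeFinset,
      ncard_coe_finset]
  have hTG : T.edgeSet ⊆ G.edgeSet := SimpleGraph.edgeSet_mono hT
  have := ncard_sdiff_add_ncard_of_subset hTG (toFinite _)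
  omega

end PlaneDrawing
end GraphSolids

/-! ### Finiteness of the set of regions -/

namespace GraphSolids
open Complex Set Topology

/-- Scaling the plane to the origin is a homotopy from a constant to `h`. -/
theorem exists_log_of_ne_zero {h : ℂ → ℂ} (hc : Continuous h) (h0 : ∀ z, h z ≠ 0) :
    ∃ L : ℂ → ℂ, Continuous L ∧ ∀ z, exp (L z) = h z := by
  let H : C(unitInterval × ℂ, ℂ) := ⟨fun p => h ((p.1 : ℝ) * p.2) / h 0, by fun_prop⟩
  obtain ⟨l, hl⟩ := exists_continuous_log_of_homotopy H
    (fun p => div_ne_zero (h0 _) (h0 _)) (fun z => by simp [H, h0])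
  refine ⟨fun z => l z + log (h 0), by fun_prop, fun z => ?_⟩
  rw [exp_add, hl, exp_log (h0 0)]
  simp [H, h0]

/-- Components of the open set `Kᶜ` are open. A frontier point off `K` would have a component that
meets the given one, hence equals it, although an open set misses its frontier. -/
theorem frontier_connectedComponentIn_subset {K : Set ℂ} (hK : IsClosed K) (a : ℂ) :
    frontier (connectedComponentIn Kᶜ a) ⊆ K := by
  intro z hz
  by_contra hzK
  have hopen : IsOpen (connectedComponentIn Kᶜ z) := hK.isOpen_compl.connectedComponentIn
  obtain ⟨w, hw1, hw2⟩ := mem_closure_iff.1 hz.1 _ hopen (mem_connectedComponentIn hzK)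
  have h1 := connectedComponentIn_eq hw1
  have h2 := connectedComponentIn_eq hw2
  have hmem : z ∈ connectedComponentIn Kᶜ a := by
    rw [h2, ← h1]; exact mem_connectedComponentIn hzK
  have ho : IsOpen (connectedComponentIn Kᶜ a) := hK.isOpen_compl.connectedComponentIn
  rw [ho.frontier_eq] at hz
  exact hz.2 hmem

/-- The functions `z - a i` with `a i` in different bounded components of the complement of `K` are
multiplicatively independent modulo exponentials on `K`. -/
theorem exponent_eq_zero {K : Set ℂ} (hK : IsCompact K) {ι : Type*} [Fintype ι] (a : ι → ℂ)
    (ha : ∀ i, a i ∉ K)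
    (hd : ∀ i j, i ≠ j → connectedComponentIn Kᶜ (a i) ≠ connectedComponentIn Kᶜ (a j))
    (n : ι → ℤ) {g : ℂ → ℂ} (hg : Continuous g) (h : ∀ z ∈ K, exp (g z) = ∏ i, (z - a i) ^ n i)
    (i : ι) (hb : Bornology.IsBounded (connectedComponentIn Kᶜ (a i))) : n i = 0 := by
  classical
  set U := connectedComponentIn Kᶜ (a i) with hU
  have hUo : IsOpen U := hK.isClosed.isOpen_compl.connectedComponentIn
  have haU : a i ∈ U := mem_connectedComponentIn (ha i)
  have hfr : frontier U ⊆ K := frontier_connectedComponentIn_subset hK.isClosed _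
  have hcl : ∀ z ∈ closure U, ∀ j, j ≠ i → z - a j ≠ 0 := by
    intro z hz j hj h0
    rw [sub_eq_zero] at h0
    subst h0
    have hopen : IsOpen (connectedComponentIn Kᶜ (a j)) :=
      hK.isClosed.isOpen_compl.connectedComponentIn
    obtain ⟨w, hw1, hw2⟩ := mem_closure_iff.1 hz _ hopen (mem_connectedComponentIn (ha j))
    exact hd j i hj ((connectedComponentIn_eq hw1).trans (connectedComponentIn_eq hw2).symm)
  have hout : ∀ z, z ∉ U → z - a i ≠ 0 := fun z hz h0 => hz (by rwa [sub_eq_zero.1 h0])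
  -- By the relation on `K` both formulas agree on the frontier of `U`, so `f` is continuous and
  -- zero-free on the whole plane and has a logarithm. On a circle about `a i` enclosing `U` this is
  -- a logarithm of `(z - a i) ^ n i`.
  let f : ℂ → ℂ := fun z =>
    if z ∈ U then exp (g z) * ∏ j ∈ Finset.univ.erase i, (z - a j) ^ (-n j) else (z - a i) ^ n i
  have hf : Continuous f := by
    refine continuous_if ?_ ?_ ?_
    · intro z hz
      have hzc : z ∈ closure U := hz.1
      rw [h z (hfr hz), ← Finset.mul_prod_erase Finset.univ _ (Finset.mem_univ i), mul_assoc,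
        ← Finset.prod_mul_distrib, Finset.prod_eq_one, mul_one]
      intro j hj
      rw [zpow_neg]
      exact mul_inv_cancel₀ (zpow_ne_zero _ (hcl z hzc j (Finset.ne_of_mem_erase hj)))
    · refine ContinuousOn.mul (by fun_prop) ?_
      refine continuousOn_finsetProd _ fun j hj => ?_
      exact ContinuousOn.zpow₀ (by fun_prop) _ fun z hz =>
        Or.inl (hcl z hz j (Finset.ne_of_mem_erase hj))
    · refine ContinuousOn.zpow₀ (by fun_prop) _ fun z hz => Or.inl (hout z ?_)
      have : closure {z | z ∉ U} = Uᶜ := hUo.isClosed_compl.closure_eq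
      rw [this] at hz
      exact hz
  have hf0 : ∀ z, f z ≠ 0 := by
    intro z
    by_cases hz : z ∈ U
    · simp only [f, hz, if_true]
      refine mul_ne_zero (exp_ne_zero _) (Finset.prod_ne_zero_iff.2 fun j hj => ?_)
      exact zpow_ne_zero _ (hcl z (subset_closure hz) j (Finset.ne_of_mem_erase hj))
    · simp only [f, hz, if_false]
      exact zpow_ne_zero _ (hout z hz)
  obtain ⟨L, hL, hLf⟩ := exists_log_of_ne_zero hf hf0
  obtain ⟨R, hR⟩ := hb.subset_ball (a i)
  have hRpos : 0 < R := by
    have := hR haU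
    rwa [Metric.mem_ball, dist_self] at this
  refine eq_zero_of_log_on_sphere (p := a i) hRpos hL.continuousOn fun z hz => ?_
  have hzU : z ∉ U := fun hzU => by
    have h1 := hR hzU
    rw [Metric.mem_ball] at h1
    exact absurd hz h1.ne
  rw [hLf]
  simp [f, hzU]

theorem isPreconnected_norm_gt (R : ℝ) : IsPreconnected {z : ℂ | R < ‖z‖} := by
  have h : IsPreconnected ((fun p : ℝ × ℝ => circleMap 0 p.1 p.2) '' (Ioi R ×ˢ univ)) := by
    refine (isPreconnected_Ioi.prod isPreconnected_univ).image _ (Continuous.continuousOn ?_)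
    simp only [circleMap]
    fun_prop
  convert h using 1
  ext z
  constructor
  · intro hz
    exact ⟨(‖z‖, arg z), ⟨hz, mem_univ _⟩, by simp [circleMap]⟩
  · rintro ⟨⟨r, θ⟩, ⟨hr, -⟩, rfl⟩
    have hr' : R < r := hr
    simp only [mem_ofPred_eq, norm_circleMap_zero]
    exact hr'.trans_le (le_abs_self r)

namespace PlaneDrawing
variable {V : Type*} {G : SimpleGraph V} (D : PlaneDrawing G)

/-- The integer `d` is the defect of the continuous logarithm along the arc against the principal
one at its end. It is the obstruction to gluing logarithms along the drawing. -/
theorem exists_lift {g : ℝ → ℂ} (hg : Continuous g) {a : ℂ} (ha : ∀ t ∈ Icc (0 : ℝ) 1, g t ≠ a) :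
    ∃ (w : C(unitInterval, ℂ)) (d : ℤ), (∀ t, exp (w t) = g t - a) ∧ w 0 = log (g 0 - a) ∧
      w 1 = log (g 1 - a) + d * (2 * Real.pi * I) := by
  have ha' : ∀ t ∈ Icc (0 : ℝ) 1, g t - a ≠ 0 := fun t ht => sub_ne_zero.2 (ha t ht)
  have h0 : g 0 - a ≠ 0 := ha' 0 (by simp)
  have h1 : g 1 - a ≠ 0 := ha' 1 (by simp)
  let H : C(unitInterval × unitInterval, ℂ) := ⟨fun p => (g (p.1 * p.2) - a) / (g 0 - a), by fun_prop⟩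
  obtain ⟨l, hl⟩ := exists_continuous_log_of_homotopy H
    (fun p => div_ne_zero (ha' _ (p.1 * p.2).2) h0) (fun z => by simp [H, h0])
  have hl0 : exp (l 0) = 1 := by rw [hl]; simp [H, h0]
  have hw : ∀ t, exp (l t - l 0 + log (g 0 - a)) = g t - a := by
    intro t
    rw [exp_add, exp_sub, hl0, div_one, hl, exp_log h0]
    simp [H, h0]
  have hw1 : exp (l 1 - l 0 + log (g 0 - a)) = exp (log (g 1 - a)) := by
    rw [hw, exp_log h1]; rfl
  obtain ⟨d, hd⟩ := exp_eq_exp_iff_exists_int.1 hw1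
  exact ⟨⟨fun t => l t - l 0 + log (g 0 - a), by fun_prop⟩, d, hw, by simp, hd⟩

/-- Each point `a i` gives an integer vector of defects indexed by the edges. With more points than
edges these vectors are dependent; the combination of logarithms with the coefficients `n` has no
defects, hence glues along the drawing and extends to the plane by Tietze's theorem. -/
theorem exists_relation [Finite V] {ι : Type*} [Fintype ι] (a : ι → ℂ) (ha : ∀ i, a i ∉ D.carrier)
    (hι : Nat.card G.edgeSet < Fintype.card ι) :
    ∃ (n : ι → ℤ) (g : ℂ → ℂ), (∃ i, n i ≠ 0) ∧ Continuous g ∧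
      ∀ z ∈ D.carrier, exp (g z) = ∏ i, (z - a i) ^ n i := by
  classical
  have := Fintype.ofFinite V
  choose u v γ heq huv hγ hinj hγ0 hγ1 hγI using D.exists_param
  have hav : ∀ e i, ∀ t ∈ Icc (0 : ℝ) 1, γ e t ≠ a i := by
    intro e i t ht h
    exact ha i (D.arc_subset_carrier e (hγI e ▸ h ▸ mem_image_of_mem _ ht))
  choose w d hw hw0 hw1 using fun e i => exists_lift (hγ e) (hav e i)
  have hdep : ¬ LinearIndependent ℤ (fun i => (fun e => d e i : G.edgeSet → ℤ)) := by
    intro hli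
    have := hli.fintype_card_le_finrank
    rw [Module.finrank_fintype_fun_eq_card, ← Nat.card_eq_fintype_card (α := G.edgeSet)] at this
    omega
  obtain ⟨n, hn, hn0⟩ := Fintype.not_linearIndependent_iff.1 hdep
  have hn' : ∀ e, ∑ i, n i * d e i = 0 := fun e => by
    have := congrFun hn e
    simpa [Finset.sum_apply] using this
  let Λ : V → ℂ := fun x => ∑ i, n i * log (D.point x - a i)
  let W : G.edgeSet → unitInterval → ℂ := fun e t => ∑ i, n i * w e i t
  have hW0 : ∀ e, W e 0 = Λ (u e) := fun e => by simp [W, Λ, hw0, hγ0]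
  have hW1 : ∀ e, W e 1 = Λ (v e) := fun e => by
    have : ∑ i, (n i : ℂ) * (d e i * (2 * Real.pi * I)) = 0 := by
      simp only [← mul_assoc, ← Finset.sum_mul]
      have h := hn' e
      have h' : ∑ i, (n i : ℂ) * d e i = 0 := by exact_mod_cast h
      simp [h']
    simp [W, Λ, hw1, hγ1, mul_add, Finset.sum_add_distrib, this]
  let _ : TopologicalSpace V := ⊥
  have : DiscreteTopology V := ⟨rfl⟩
  -- The drawing is a quotient of the disjoint union of parametrised edges and vertices, so
  -- continuity of the glued logarithm can be tested there.
  let X := (Σ _ : G.edgeSet, unitInterval) ⊕ V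
  let val : X → ℂ := Sum.elim (fun p => W p.1 p.2) Λ
  let pos : X → ℂ := Sum.elim (fun p => γ p.1 p.2) D.point
  have hval : Continuous val := by
    refine continuous_sumElim.2 ⟨continuous_sigma fun e => ?_, continuous_of_discreteTopology⟩
    simp only [W]
    fun_prop
  have hpos : Continuous pos := by
    refine continuous_sumElim.2 ⟨continuous_sigma fun e => ?_, continuous_of_discreteTopology⟩
    exact (hγ e).comp continuous_subtype_val
  have hmem : ∀ x, pos x ∈ D.carrier := by
    rintro (⟨e, t⟩ | x)
    · exact D.arc_subset_carrier e (hγI e ▸ mem_image_of_mem _ t.2)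
    · exact Or.inl ⟨x, rfl⟩
  have hvert : ∀ x y, pos x = D.point y → val x = Λ y := by
    rintro (⟨e, t⟩ | x) y h
    · have h' : γ e t = D.point y := h
      have hy := D.mem_of_point_mem_arc e y (by rw [← h', ← hγI e]; exact mem_image_of_mem _ t.2)
      rw [heq e, Sym2.mem_iff] at hy
      rcases hy with rfl | rfl
      · rw [← hγ0] at h'
        have : t = 0 := Subtype.ext (hinj e t.2 (by simp) h')
        subst this
        exact hW0 e
      · rw [← hγ1] at h'
        have : t = 1 := Subtype.ext (hinj e t.2 (by simp) h')
        subst this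
        exact hW1 e
    · rw [D.point_injective h]
      rfl
  have hcons : ∀ x y, pos x = pos y → val x = val y := by
    intro x y hxy
    by_cases hx : pos x ∈ range D.point
    · obtain ⟨z, hz⟩ := hx
      rw [hvert x z hz.symm, hvert y z (hxy ▸ hz.symm)]
    · rcases x with ⟨e, t⟩ | x
      · rcases y with ⟨f, s⟩ | y
        · have hxy' : γ e t = γ f s := hxy
          have hef : e = f := by
            by_contra hef
            exact hx (D.arc_inter_arc e f hef ⟨hγI e ▸ mem_image_of_mem _ t.2,
              hγI f ▸ (by rw [show pos (Sum.inl ⟨e, t⟩) = γ f s from hxy']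
                          exact mem_image_of_mem _ s.2)⟩)
          subst hef
          have : t = s := Subtype.ext (hinj e t.2 s.2 hxy')
          rw [this]
        · exact absurd ⟨y, hxy.symm⟩ hx
      · exact absurd ⟨x, rfl⟩ hx
  let f : X → D.carrier := fun x => ⟨pos x, hmem x⟩
  have hf : Continuous f := hpos.subtype_mk _
  have hsurj : Function.Surjective f := by
    rintro ⟨z, ⟨x, rfl⟩ | hz⟩
    · exact ⟨Sum.inr x, rfl⟩
    · obtain ⟨e, he⟩ := mem_iUnion.1 hz
      rw [← hγI e] at he
      obtain ⟨t, ht, rfl⟩ := he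
      exact ⟨Sum.inl ⟨e, t, ht⟩, rfl⟩
  have hq : IsQuotientMap f := hf.isClosedMap.isQuotientMap hf hsurj
  let g₀ : D.carrier → ℂ := val ∘ Function.surjInv hsurj
  have hg₀ : ∀ x, g₀ (f x) = val x := fun x =>
    hcons _ _ (congrArg Subtype.val (Function.surjInv_eq hsurj (f x)))
  have hg₀c : Continuous g₀ := by
    rw [hq.continuous_iff]
    exact hval.congr fun x => (hg₀ x).symm
  obtain ⟨g, hg⟩ := ContinuousMap.exists_restrict_eq D.isCompact_carrier.isClosed ⟨g₀, hg₀c⟩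
  refine ⟨n, g, hn0, g.continuous, fun z hz => ?_⟩
  obtain ⟨x, hx⟩ := hsurj ⟨z, hz⟩
  have hgz : g z = val x := by
    rw [← hg₀, hx]
    exact DFunLike.congr_fun hg ⟨z, hz⟩
  have hxz : pos x = z := congrArg Subtype.val hx
  rw [hgz]
  rcases x with ⟨e, t⟩ | x
  · have hxz' : γ e t = z := hxz
    simp only [val, W, Sum.elim_inl, exp_sum, exp_int_mul, hw, hxz']
  · have hxz' : D.point x = z := hxz
    simp only [val, Λ, Sum.elim_inr, exp_sum, exp_int_mul]
    refine Finset.prod_congr rfl fun i _ => ?_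
    rw [exp_log, hxz']
    exact sub_ne_zero.2 fun h => ha i (h ▸ Or.inl ⟨x, rfl⟩)

theorem finite_regions [Finite V] : D.regions.Finite := by
  classical
  have hbdd : {W ∈ D.regions | Bornology.IsBounded W}.Finite := by
    by_contra hinf
    -- One more bounded region than edges already gives a nontrivial relation, all of whose
    -- exponents vanish.
    obtain ⟨t, ht, hcard⟩ := Set.Infinite.exists_subset_card_eq hinf (Nat.card G.edgeSet + 1)
    have hrep : ∀ W : t, ∃ z, z ∉ D.carrier ∧ connectedComponentIn D.carrierᶜ z = W :=
      fun W => (ht W.2).1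
    choose a ha haW using hrep
    obtain ⟨n, g, ⟨i, hi⟩, hg, hgn⟩ := D.exists_relation a ha (by simp [hcard])
    refine hi (exponent_eq_zero D.isCompact_carrier a ha (fun i j hij h => hij ?_) n hg hgn i ?_)
    · rw [haW, haW] at h
      exact Subtype.ext h
    · rw [haW]
      exact (ht i.2).2
  obtain ⟨R, hR⟩ := D.isCompact_carrier.isBounded.subset_closedBall 0
  set R' := max R 0
  have hE : {z : ℂ | R' < ‖z‖} ⊆ D.carrierᶜ := by
    intro z hz hzK
    have h1 := hR hzK
    rw [mem_closedBall_zero_iff] at h1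
    exact absurd (lt_of_le_of_lt (le_max_left R 0) hz) (not_lt.2 h1)
  have h1 : ((R' + 1 : ℝ) : ℂ) ∈ {z : ℂ | R' < ‖z‖} := by
    have : 0 ≤ R' := le_max_right _ _
    rw [mem_ofPred_eq, norm_real, Real.norm_of_nonneg (by linarith)]
    linarith
  refine (hbdd.union (finite_singleton (connectedComponentIn D.carrierᶜ (R' + 1 : ℝ)))).subset ?_
  intro W hW
  by_cases hb : Bornology.IsBounded W
  · exact Or.inl ⟨hW, hb⟩
  · right
    obtain ⟨z, hz, hzR⟩ : ∃ z ∈ W, R' < ‖z‖ := by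
      by_contra hcon
      push Not at hcon
      exact hb (Metric.isBounded_closedBall.subset fun z hz =>
        mem_closedBall_zero_iff.2 (hcon z hz))
    obtain ⟨y, hy, rfl⟩ := hW
    -- The outside of a large disc is connected and misses the drawing, so all unbounded regions
    -- coincide.
    have h2 := (isPreconnected_norm_gt R').subset_connectedComponentIn h1 hE
    rw [mem_singleton_iff, connectedComponentIn_eq (h2 hzR)]
    exact connectedComponentIn_eq hz

end PlaneDrawing
end GraphSolids

/-! ### Connected vertex sets and induced paths -/

namespace GraphSolids
open Set
section Connectivity
variable {V : Type*} {G : SimpleGraph V}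

/-- `T` is a union of connected components of the graph induced on `A`. -/
def IsClosedIn (G : SimpleGraph V) (A T : Set V) : Prop :=
  T ⊆ A ∧ ∀ a ∈ T, ∀ b ∈ A, G.Adj a b → b ∈ T

/-- `A` induces a connected nonempty subgraph. -/
def Conn (G : SimpleGraph V) (A : Set V) : Prop :=
  A.Nonempty ∧ ∀ T, IsClosedIn G A T → T.Nonempty → T = A

theorem conn_singleton (a : V) : Conn G {a} :=
  ⟨singleton_nonempty a, fun _ hT hne => (subset_singleton_iff_eq.1 hT.1).resolve_left hne.ne_empty⟩

/-- Two sets intersect or are joined by an edge. -/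
def Touch (G : SimpleGraph V) (A B : Set V) : Prop :=
  ∃ a ∈ A, ∃ b ∈ B, a = b ∨ G.Adj a b

theorem Touch.symm {A B : Set V} (h : Touch G A B) : Touch G B A := by
  obtain ⟨a, ha, b, hb, h⟩ := h
  exact ⟨b, hb, a, ha, h.imp Eq.symm fun h => h.symm⟩

theorem Touch.mono {A B A' B' : Set V} (h : Touch G A B) (hA : A ⊆ A') (hB : B ⊆ B') :
    Touch G A' B' := by
  obtain ⟨a, ha, b, hb, h⟩ := h
  exact ⟨a, hA ha, b, hB hb, h⟩

theorem IsClosedIn.inter {A T B : Set V} (h : IsClosedIn G A T) (hB : B ⊆ A) :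
    IsClosedIn G B (T ∩ B) :=
  ⟨inter_subset_right, fun a ha b hb hab => ⟨h.2 a ha.1 b (hB hb) hab, hb⟩⟩

theorem IsClosedIn.diff {A T : Set V} (h : IsClosedIn G A T) : IsClosedIn G A (A \ T) :=
  ⟨sdiff_subset, fun a ha b hb hab => ⟨hb, fun hbT => ha.2 (h.2 b hbT a ha.1 hab.symm)⟩⟩

theorem Conn.subset_of_closed {A B T : Set V} (hB : Conn G B) (hBA : B ⊆ A)
    (hT : IsClosedIn G A T) (h : (T ∩ B).Nonempty) : B ⊆ T := by
  have := hB.2 _ (hT.inter hBA) h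
  exact fun b hb => (this.symm ▸ hb : b ∈ T ∩ B).1

theorem Conn.union {A B : Set V} (hA : Conn G A) (hB : Conn G B) (h : Touch G A B) :
    Conn G (A ∪ B) := by
  refine ⟨hA.1.mono subset_union_left, fun T hT hne => ?_⟩
  obtain ⟨a, ha, b, hb, hab⟩ := h
  have hiff : a ∈ T ↔ b ∈ T := by
    rcases hab with rfl | hab
    · rfl
    · exact ⟨fun h => hT.2 a h b (Or.inr hb) hab, fun h => hT.2 b h a (Or.inl ha) hab.symm⟩
  have hAT : a ∈ T → A ⊆ T := fun h => hA.subset_of_closed subset_union_left hT ⟨a, h, ha⟩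
  have hBT : b ∈ T → B ⊆ T := fun h => hB.subset_of_closed subset_union_right hT ⟨b, h, hb⟩
  refine hT.1.antisymm ?_
  obtain ⟨z, hz⟩ := hne
  have haT : a ∈ T := by
    rcases hT.1 hz with hzA | hzB
    · exact hA.subset_of_closed subset_union_left hT ⟨z, hz, hzA⟩ ha
    · exact hiff.2 (hB.subset_of_closed subset_union_right hT ⟨z, hz, hzB⟩ hb)
  exact union_subset (hAT haT) (hBT (hiff.1 haT))

theorem Conn.insert_adj {A : Set V} (hA : Conn G A) {w a : V} (ha : a ∈ A) (h : G.Adj w a) :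
    Conn G (insert w A) := by
  rw [insert_eq]
  exact (conn_singleton w).union hA ⟨w, rfl, a, ha, Or.inr h⟩

/-- A proper nonempty subset of a connected set has an edge that leaves it. -/
theorem Conn.exists_adj {A T : Set V} (hA : Conn G A) (hT : T ⊆ A) (hne : T.Nonempty)
    (hneA : T ≠ A) : ∃ a ∈ T, ∃ b ∈ A, b ∉ T ∧ G.Adj a b := by
  by_contra h
  push Not at h
  exact hneA (hA.2 T ⟨hT, fun a ha b hb hab => by_contra fun hbT => h a ha b hb hbT hab⟩ hne)

/-- The vertex sets of the components of the graph induced on `U`. -/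
def comps (G : SimpleGraph V) (U : Set V) : Set (Set V) :=
  {K | Conn G K ∧ IsClosedIn G U K}

/-- The intersection `K` of all closed sets through `u` is connected: of a closed part of `K` and
its complement in `K`, the one that contains `u` must be all of `K`. -/
theorem exists_mem_comps {U : Set V} {u : V} (hu : u ∈ U) : ∃ K ∈ comps G U, u ∈ K := by
  set K : Set V := ⋂₀ {T | IsClosedIn G U T ∧ u ∈ T} with hK
  have huK : u ∈ K := mem_sInter.2 fun T hT => hT.2
  have hmin : ∀ T, IsClosedIn G U T → u ∈ T → K ⊆ T := fun T h1 h2 => sInter_subset_of_mem ⟨h1, h2⟩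
  have hcl : IsClosedIn G U K := by
    refine ⟨hmin U ⟨subset_rfl, fun _ _ b hb _ => hb⟩ hu, fun a ha b hb hab => ?_⟩
    exact mem_sInter.2 fun T hT => hT.1.2 a (mem_sInter.1 ha T hT) b hb hab
  refine ⟨K, ⟨⟨⟨u, huK⟩, fun T hT hne => ?_⟩, hcl⟩, huK⟩
  have hlift : ∀ T, IsClosedIn G K T → IsClosedIn G U T := fun T hT =>
    ⟨hT.1.trans hcl.1, fun a ha b hb hab => hT.2 a ha b (hcl.2 a (hT.1 ha) b hb hab) hab⟩
  by_cases huT : u ∈ T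
  · exact hT.1.antisymm (hmin T (hlift T hT) huT)
  · obtain ⟨t, ht⟩ := hne
    exact absurd ht (hmin _ (hlift _ hT.diff) ⟨huK, huT⟩ (hT.1 ht)).2

theorem comps_eq_of_mem {U K K' : Set V} (hK : K ∈ comps G U) (hK' : K' ∈ comps G U) {a : V}
    (ha : a ∈ K) (ha' : a ∈ K') : K = K' :=
  (hK.1.subset_of_closed hK.2.1 hK'.2 ⟨a, ha', ha⟩).antisymm
    (hK'.1.subset_of_closed hK'.2.1 hK.2 ⟨a, ha, ha'⟩)

theorem Conn.subset_comps {U A K : Set V} (hA : Conn G A) (hAU : A ⊆ U) (hK : K ∈ comps G U) {a : V}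
    (ha : a ∈ A) (haK : a ∈ K) : A ⊆ K :=
  hA.subset_of_closed hAU hK.2 ⟨a, haK, ha⟩

theorem conn_of_induce {A : Set V} (h : (G.induce A).Connected) : Conn G A := by
  obtain ⟨⟨a, ha⟩⟩ := h.nonempty
  refine ⟨⟨a, ha⟩, fun T hT hne => hT.1.antisymm fun b hb => ?_⟩
  obtain ⟨t, ht⟩ := hne
  obtain ⟨w⟩ := h.preconnected ⟨t, hT.1 ht⟩ ⟨b, hb⟩
  have : ∀ (x y : A), (G.induce A).Walk x y → x.1 ∈ T → y.1 ∈ T := by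
    intro x y w
    induction w with
    | nil => exact id
    | @cons x y z h _ ih => exact fun hx => ih (hT.2 x.1 hx y.1 y.2 h)
  exact this _ _ w ht

theorem conn_univ (h : G.Connected) : Conn G univ := by
  obtain ⟨a⟩ := h.nonempty
  refine ⟨⟨a, mem_univ a⟩, fun T hT hne => eq_univ_of_forall fun b => ?_⟩
  obtain ⟨t, ht⟩ := hne
  obtain ⟨w⟩ := h.preconnected t b
  have : ∀ x y, G.Walk x y → x ∈ T → y ∈ T := by
    intro x y w
    induction w with
    | nil => exact id
    | @cons x y z h _ ih => exact fun hx => ih (hT.2 x hx y (mem_univ _) h)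
  exact this _ _ w ht

/-- `IndPath G a b Q`: the set `Q` induces a path with ends `a` and `b`. -/
inductive IndPath (G : SimpleGraph V) : V → V → Set V → Prop
  | single (a : V) : IndPath G a a {a}
  | cons {a b c : V} {Q : Set V} (hab : G.Adj a b) (h : IndPath G b c Q) (ha : a ∉ Q)
      (hu : ∀ z ∈ Q, G.Adj a z → z = b) : IndPath G a c (insert a Q)

namespace IndPath

theorem left_mem {a b : V} {Q : Set V} (h : IndPath G a b Q) : a ∈ Q := by
  cases h with
  | single => rfl
  | cons => exact mem_insert _ _

theorem right_mem {a b : V} {Q : Set V} (h : IndPath G a b Q) : b ∈ Q := by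
  induction h with
  | single => rfl
  | cons _ _ _ _ ih => exact mem_insert_of_mem _ ih

theorem conn {a b : V} {Q : Set V} (h : IndPath G a b Q) : Conn G Q := by
  induction h with
  | single => exact conn_singleton _
  | cons hab h _ _ ih => exact ih.insert_adj h.left_mem hab

theorem head {a b : V} {Q : Set V} (h : IndPath G a b Q) : (a = b ∧ Q = {a}) ∨
    (a ≠ b ∧ ∃ c, G.Adj a c ∧ IndPath G c b (Q \ {a}) ∧ ∀ z ∈ Q, G.Adj a z → z = c) := by
  cases h with
  | single => exact Or.inl ⟨rfl, rfl⟩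
  | @cons _ c _ Q hac h ha hu =>
    refine Or.inr ⟨fun hab => ha (hab ▸ h.right_mem), c, hac, ?_, fun z hz haz => ?_⟩
    · rwa [insert_sdiff_of_mem _ (mem_singleton a), sdiff_singleton_eq_self ha]
    · rcases hz with rfl | hz
      · exact absurd haz G.irrefl
      · exact hu z hz haz

theorem eq_singleton {a : V} {Q : Set V} (h : IndPath G a a Q) : Q = {a} := by
  rcases h.head with h | h
  · exact h.2
  · exact absurd rfl h.1

theorem append {a b c d : V} {Q Q' : Set V} (h : IndPath G a b Q) (h' : IndPath G c d Q')
    (hbc : G.Adj b c) (hdis : ∀ x ∈ Q, x ∉ Q')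
    (hadj : ∀ x ∈ Q, ∀ y ∈ Q', G.Adj x y → x = b ∧ y = c) : IndPath G a d (Q ∪ Q') := by
  induction h with
  | single a =>
    rw [← insert_eq]
    exact cons hbc h' (hdis a rfl) fun z hz haz => (hadj a rfl z hz haz).2
  | @cons a b' b Q hab h ha hu ih =>
    rw [insert_union]
    refine cons hab (ih hbc (fun x hx => hdis x (Or.inr hx))
      fun x hx => hadj x (Or.inr hx)) ?_ ?_
    · rintro (h1 | h1)
      · exact ha h1
      · exact hdis a (Or.inl rfl) h1
    · rintro z (hz | hz) haz
      · exact hu z hz haz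
      · exact absurd ((hadj a (Or.inl rfl) z hz haz).1 ▸ h.right_mem) ha

theorem symm {a b : V} {Q : Set V} (h : IndPath G a b Q) : IndPath G b a Q := by
  induction h with
  | single a => exact single a
  | @cons a b' b Q hab h ha hu ih =>
    rw [insert_eq, union_comm]
    refine ih.append (single a) hab.symm ?_ ?_
    · rintro x hx rfl
      exact ha hx
    · rintro x hx _ rfl hxy
      exact ⟨hu x hx hxy.symm, rfl⟩

/-- A vertex `w` next to an induced path can be joined to the end of the path. -/
theorem exists_extend {a b : V} {Q : Set V} (h : IndPath G a b Q) (w : V)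
    (hw : ∃ z ∈ Q, w = z ∨ G.Adj w z) : ∃ Q' ⊆ insert w Q, IndPath G w b Q' := by
  induction h with
  | single a =>
    obtain ⟨z, rfl, rfl | hz⟩ := hw
    · exact ⟨_, subset_insert _ _, single w⟩
    · by_cases hwz : w = z
      · exact ⟨{w}, by simp, hwz ▸ single w⟩
      · exact ⟨_, subset_rfl, cons hz (single z) hwz fun y hy _ => hy⟩
  | @cons a c b Q hac h ha hu ih =>
    -- Looking into the tail first attaches `w` at the last vertex that it equals or sees, which
    -- keeps the path induced.
    by_cases hQ : ∃ z ∈ Q, w = z ∨ G.Adj w z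
    · obtain ⟨Q', hQ', hP⟩ := ih hQ
      exact ⟨Q', hQ'.trans (insert_subset_insert (subset_insert _ _)), hP⟩
    · push Not at hQ
      obtain ⟨z, rfl | hz, hwz⟩ := hw
      · by_cases hwz' : w = z
        · subst hwz'
          exact ⟨_, subset_insert _ _, cons hac h ha hu⟩
        · refine ⟨_, subset_rfl, cons (hwz.resolve_left hwz') (cons hac h ha hu) ?_ ?_⟩
          · rintro (h1 | h1)
            · exact hwz' h1
            · exact (hQ w h1).1 rfl
          · rintro y (rfl | hy) hwy
            · rfl
            · exact absurd hwy (hQ y hy).2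
      · exact absurd hwz (not_or.2 (hQ z hz))

theorem exists_suffix {a b : V} {Q : Set V} (h : IndPath G a b Q) {z : V} (hz : z ∈ Q) :
    ∃ Q' ⊆ Q, IndPath G z b Q' ∧ (a ∈ Q' → z = a) := by
  induction h with
  | single a =>
    obtain rfl : z = a := hz
    exact ⟨_, subset_rfl, single _, fun _ => rfl⟩
  | @cons a c b Q hac h ha hu ih =>
    rcases hz with rfl | hz
    · exact ⟨_, subset_rfl, cons hac h ha hu, fun _ => rfl⟩
    · obtain ⟨Q', hQ', hP, -⟩ := ih hz
      exact ⟨Q', hQ'.trans (subset_insert _ _), hP, fun h => absurd (hQ' h) ha⟩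

/-- The part of an induced path up to its first vertex in `S`. -/
theorem exists_prefix {a b : V} {Q S : Set V} (h : IndPath G a b Q) (hS : (Q ∩ S).Nonempty) :
    ∃ z, ∃ Q' ⊆ Q, IndPath G a z Q' ∧ Q' ∩ S = {z} := by
  induction h with
  | single a =>
    obtain ⟨z, rfl, hz⟩ := hS
    exact ⟨_, _, subset_rfl, single _, by simpa using hz⟩
  | @cons a c b Q hac h ha hu ih =>
    by_cases haS : a ∈ S
    · exact ⟨a, {a}, by simp, single a, by simpa using haS⟩
    · obtain ⟨y, rfl | hy, hyS⟩ := hS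
      · exact absurd hyS haS
      · obtain ⟨z, Q', hQ', hP, hQS⟩ := ih ⟨y, hy, hyS⟩
        refine ⟨z, insert a Q', insert_subset_insert hQ', cons hac hP (fun h => ha (hQ' h))
          (fun w hw => hu w (hQ' hw)), ?_⟩
        rw [insert_inter_of_notMem haS, hQS]

/-- An induced path can be numbered. -/
theorem exists_numbering {a b : V} {Q : Set V} (h : IndPath G a b Q) :
    ∃ (n : ℕ) (f : ℕ → V), InjOn f (Iic n) ∧ f '' Iic n = Q ∧ f 0 = a ∧ f n = b ∧
      ∀ i ≤ n, ∀ j ≤ n, G.Adj (f i) (f j) ↔ i + 1 = j ∨ j + 1 = i := by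
  induction h with
  | single a =>
    refine ⟨0, fun _ => a, ?_, ?_, rfl, rfl, ?_⟩
    · intro i hi j hj _
      simp only [mem_Iic, Nat.le_zero] at hi hj
      rw [hi, hj]
    · ext z; simp [eq_comm]
    · intro i hi j hj
      simp
      omega
  | @cons a c b Q hac h ha hu ih =>
    obtain ⟨n, f, hinj, him, h0, hn, hadj⟩ := ih
    have hmem : ∀ i ≤ n, f i ∈ Q := fun i hi => him ▸ mem_image_of_mem f hi
    have hai : ∀ i ≤ n, G.Adj a (f i) ↔ i = 0 := fun i hi =>
      ⟨fun h' => hinj hi (Nat.zero_le n) ((hu _ (hmem i hi) h').trans h0.symm),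
        fun h' => by rw [h', h0]; exact hac⟩
    refine ⟨n + 1, fun i => Nat.casesOn i a f, ?_, ?_, rfl, hn, ?_⟩
    · rintro (_ | i) hi (_ | j) hj hij
      · rfl
      · exact absurd (hmem j (Nat.le_of_succ_le_succ hj)) (by rw [← show a = f j from hij]; exact ha)
      · exact absurd (hmem i (Nat.le_of_succ_le_succ hi)) (by rw [show f i = a from hij]; exact ha)
      · exact congrArg _ (hinj (Nat.le_of_succ_le_succ hi) (Nat.le_of_succ_le_succ hj) hij)
    · ext z
      constructor
      · rintro ⟨(_ | i), hi, rfl⟩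
        · exact mem_insert _ _
        · exact mem_insert_of_mem _ (hmem i (Nat.le_of_succ_le_succ hi))
      · rintro (rfl | hz)
        · exact ⟨0, Nat.zero_le _, rfl⟩
        · rw [← him] at hz
          obtain ⟨i, hi, rfl⟩ := hz
          exact ⟨i + 1, Nat.succ_le_succ hi, rfl⟩
    · rintro (_ | i) hi (_ | j) hj
      · simp
      · exact (hai j (Nat.le_of_succ_le_succ hj)).trans (by omega)
      · exact (G.adj_comm _ _).trans ((hai i (Nat.le_of_succ_le_succ hi)).trans (by omega))
      · exact (hadj i (Nat.le_of_succ_le_succ hi) j (Nat.le_of_succ_le_succ hj)).trans (by omega)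

end IndPath

theorem Conn.exists_indPath {D : Set V} (hD : Conn G D) {a b : V} (ha : a ∈ D) (hb : b ∈ D) :
    ∃ Q ⊆ D, IndPath G a b Q := by
  have : {z ∈ D | ∃ Q ⊆ D, IndPath G z b Q} = D := by
    refine hD.2 _ ⟨fun _ hz => hz.1, ?_⟩ ⟨b, hb, {b}, by simpa using hb, .single b⟩
    rintro z ⟨hz, Q, hQ, hP⟩ w hw hzw
    obtain ⟨Q', hQ', hP'⟩ := hP.exists_extend w ⟨z, hP.left_mem, Or.inr hzw.symm⟩
    exact ⟨hw, Q', hQ'.trans (insert_subset hw hQ), hP'⟩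
  exact (this.symm ▸ ha : a ∈ {z ∈ D | ∃ Q ⊆ D, IndPath G z b Q}).2

/-- A minimal connected set that meets both `P` and `P'`. -/
def MinConn (G : SimpleGraph V) (P P' Q : Set V) : Prop :=
  Conn G Q ∧ (Q ∩ P).Nonempty ∧ (Q ∩ P').Nonempty ∧
    ∀ Q' ⊆ Q, Conn G Q' → (Q' ∩ P).Nonempty → (Q' ∩ P').Nonempty → Q' = Q

theorem MinConn.swap {P P' Q : Set V} (h : MinConn G P P' Q) : MinConn G P' P Q :=
  ⟨h.1, h.2.2.1, h.2.1, fun Q' hQ' hc h1 h2 => h.2.2.2 Q' hQ' hc h2 h1⟩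

theorem Conn.exists_minConn [Finite V] {P P' E : Set V} (hE : Conn G E) (hP : (E ∩ P).Nonempty)
    (hP' : (E ∩ P').Nonempty) : ∃ Q ⊆ E, MinConn G P P' Q := by
  obtain ⟨Q, hQE, hQ⟩ := (Set.toFinite {Q : Set V | Conn G Q ∧ (Q ∩ P).Nonempty ∧
    (Q ∩ P').Nonempty}).exists_le_minimal (a := E) ⟨hE, hP, hP'⟩
  exact ⟨Q, hQE, hQ.1.1, hQ.1.2.1, hQ.1.2.2, fun Q' hQ' h1 h2 h3 =>
    hQ'.antisymm (hQ.2 ⟨h1, h2, h3⟩ hQ')⟩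

/-- An induced path inside `Q` between two contacts is all of `Q` by minimality, and a further
contact would permit a proper subpath. -/
theorem MinConn.exists_indPath {P P' Q : Set V} (h : MinConn G P P' Q) :
    ∃ p q, IndPath G p q Q ∧ Q ∩ P = {p} ∧ Q ∩ P' = {q} := by
  obtain ⟨hc, ⟨p, hpQ, hp⟩, ⟨q, hqQ, hq⟩, hmin⟩ := h
  obtain ⟨Q', hQ', hP⟩ := hc.exists_indPath hpQ hqQ
  have := hmin Q' hQ' hP.conn ⟨p, hP.left_mem, hp⟩ ⟨q, hP.right_mem, hq⟩
  subst this
  refine ⟨p, q, hP, ?_, ?_⟩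
  · refine subset_antisymm ?_ (by simpa using ⟨hpQ, hp⟩)
    rintro z ⟨hzQ, hz⟩
    obtain ⟨Q2, hQ2, hP2, h2⟩ := hP.exists_suffix hzQ
    have := hmin Q2 hQ2 hP2.conn ⟨z, hP2.left_mem, hz⟩ ⟨q, hP2.right_mem, hq⟩
    exact h2 (this ▸ hpQ)
  · refine subset_antisymm ?_ (by simpa using ⟨hqQ, hq⟩)
    rintro z ⟨hzQ, hz⟩
    obtain ⟨Q2, hQ2, hP2, h2⟩ := hP.symm.exists_suffix hzQ
    have := hmin Q2 hQ2 hP2.conn ⟨p, hP2.right_mem, hp⟩ ⟨z, hP2.left_mem, hz⟩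
    exact h2 (this ▸ hqQ)

/-- A connected proper subset of a finite connected set misses a vertex that does not disconnect. -/
theorem Conn.exists_not_cut [Finite V] {D Q : Set V} (hD : Conn G D) (hQ : Conn G Q) (hQD : Q ⊂ D) :
    ∃ d ∈ D, d ∉ Q ∧ Conn G (D \ {d}) := by
  -- A maximal proper connected set containing `Q` becomes all of `D` when one neighbouring vertex
  -- is added; this vertex can be removed.
  obtain ⟨E, hQE, hE⟩ := (Set.toFinite {E : Set V | Conn G E ∧ E ⊂ D}).exists_le_maximal (a := Q)
    ⟨hQ, hQD⟩
  obtain ⟨a, ha, b, hb, hbE, hab⟩ := hD.exists_adj hE.1.2.subset hE.1.1.1 hE.1.2.ne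
  have hins : Conn G (insert b E) := hE.1.1.insert_adj ha hab.symm
  have heq : insert b E = D := by
    by_contra hne
    have hss : insert b E ⊂ D := (insert_subset hb hE.1.2.subset).ssubset_of_ne hne
    exact hbE (hE.2 ⟨hins, hss⟩ (subset_insert _ _) (mem_insert _ _))
  refine ⟨b, hb, fun h => hbE (hQE h), ?_⟩
  rw [← heq, insert_sdiff_of_mem _ (mem_singleton b), sdiff_singleton_eq_self hbE]
  exact hE.1.1

end Connectivity
end GraphSolids

/-! ### Induced cycles and connectors -/

namespace GraphSolids
open Set
section Cycles
variable {V : Type*} {G : SimpleGraph V}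

theorem IsCycleGraph.of_iso {W W' : Type*} {H : SimpleGraph W} {H' : SimpleGraph W'}
    (h : IsCycleGraph H) (e : H' ≃g H) : IsCycleGraph H' := by
  obtain ⟨n, hn, ⟨f⟩⟩ := h
  exact ⟨n, hn, ⟨e.trans f⟩⟩

theorem val_sub_eq_one_iff {n : ℕ} (i j : Fin (n + 3)) :
    (i - j).val = 1 ↔ i.val = j.val + 1 ∨ (i.val = 0 ∧ j.val = n + 2) := by
  have hi := i.2
  have hj := j.2
  rw [Fin.val_sub]
  rcases le_or_gt j.val i.val with h | h
  · rw [show n + 3 - j.val + i.val = (n + 3) + (i.val - j.val) by omega, Nat.add_mod_left,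
      Nat.mod_eq_of_lt (by omega)]
    omega
  · rw [Nat.mod_eq_of_lt (by omega)]
    omega

theorem IndPath.isCycleGraph {p q v : V} {Q : Set V} (h : IndPath G p q Q) (hpq : p ≠ q)
    (hv : v ∉ Q) (hadj : ∀ z ∈ Q, G.Adj v z ↔ z = p ∨ z = q) :
    IsCycleGraph (G.induce (insert v Q)) := by
  obtain ⟨m, f, hinj, him, h0, hn, hf⟩ := h.exists_numbering
  obtain ⟨n, rfl⟩ : ∃ n, m = n + 1 := Nat.exists_eq_succ_of_ne_zero fun h => hpq (by
    rw [← h0, ← hn, h])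
  have hmem : ∀ i ≤ n + 1, f i ∈ Q := fun i hi => him ▸ mem_image_of_mem f hi
  have hvf : ∀ i ≤ n + 1, G.Adj v (f i) ↔ i = 0 ∨ i = n + 1 := by
    intro i hi
    rw [hadj _ (hmem i hi), ← h0, ← hn]
    exact or_congr (hinj.eq_iff hi (Nat.zero_le _)) (hinj.eq_iff hi (le_refl (n + 1)))
  have hfv : ∀ i ≤ n + 1, f i ≠ v := fun i hi h => hv (h ▸ hmem i hi)
  -- The path occupies the indices up to `n + 1`; the closing vertex `v` gets the last index `n +
  -- 2`.
  let e : Fin (n + 3) → (insert v Q : Set V) := fun k =>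
    if hk : k.val ≤ n + 1 then ⟨f k, Or.inr (hmem k hk)⟩ else ⟨v, Or.inl rfl⟩
  have he1 : ∀ k : Fin (n + 3), k.val ≤ n + 1 → (e k).1 = f k := fun k hk => by simp [e, hk]
  have he2 : ∀ k : Fin (n + 3), ¬ k.val ≤ n + 1 → (e k).1 = v := fun k hk => by simp [e, hk]
  have hbij : Function.Bijective e := by
    constructor
    · intro i j hij
      have hij' := congrArg Subtype.val hij
      have := i.2
      have := j.2
      by_cases hi : i.val ≤ n + 1 <;> by_cases hj : j.val ≤ n + 1
      · rw [he1 i hi, he1 j hj] at hij'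
        exact Fin.ext (hinj hi hj hij')
      · rw [he1 i hi, he2 j hj] at hij'
        exact absurd hij' (hfv _ hi)
      · rw [he2 i hi, he1 j hj] at hij'
        exact absurd hij'.symm (hfv _ hj)
      · exact Fin.ext (by omega)
    · rintro ⟨z, rfl | hz⟩
      · exact ⟨⟨n + 2, by omega⟩, Subtype.ext (he2 _ (by simp))⟩
      · rw [← him] at hz
        obtain ⟨i, hi, rfl⟩ := hz
        have hi' : i ≤ n + 1 := hi
        exact ⟨⟨i, by omega⟩, Subtype.ext (he1 _ hi')⟩
  refine ⟨n + 3, by omega, ⟨RelIso.symm ⟨Equiv.ofBijective e hbij, ?_⟩⟩⟩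
  intro i j
  have := i.2
  have := j.2
  simp only [Equiv.ofBijective_apply, SimpleGraph.comap_adj, Function.Embedding.subtype_apply]
  rw [SimpleGraph.cycleGraph_adj', val_sub_eq_one_iff, val_sub_eq_one_iff]
  by_cases hi : i.val ≤ n + 1 <;> by_cases hj : j.val ≤ n + 1
  · rw [he1 i hi, he1 j hj, hf _ hi _ hj]
    omega
  · rw [he1 i hi, he2 j hj, G.adj_comm, hvf _ hi]
    omega
  · rw [he2 i hi, he1 j hj, hvf _ hj]
    omega
  · rw [he2 i hi, he2 j hj]
    simp only [SimpleGraph.irrefl, false_iff]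
    omega

theorem IsCycleGraph.conn {A : Set V} (h : IsCycleGraph (G.induce A)) : Conn G A := by
  obtain ⟨n, hn, ⟨e⟩⟩ := h
  obtain ⟨m, rfl⟩ : ∃ m, n = m + 1 := ⟨n - 1, by omega⟩
  exact conn_of_induce (e.connected_iff.2 SimpleGraph.cycleGraph_connected)

theorem IsCycleGraph.two_neighbors {A : Set V} (h : IsCycleGraph (G.induce A)) {a : V}
    (ha : a ∈ A) : ∃ b ∈ A, ∃ c ∈ A, b ≠ c ∧ ∀ z ∈ A, G.Adj a z ↔ z = b ∨ z = c := by
  obtain ⟨n, hn, ⟨e⟩⟩ := h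
  obtain ⟨m, rfl⟩ : ∃ m, n = m + 3 := ⟨n - 3, by omega⟩
  have hcard := SimpleGraph.cycleGraph_degree_three_le (v := e ⟨a, ha⟩)
  rw [← SimpleGraph.card_neighborFinset_eq_degree, Finset.card_eq_two] at hcard
  obtain ⟨b, c, hbc, hset⟩ := hcard
  refine ⟨e.symm b, (e.symm b).2, e.symm c, (e.symm c).2, fun h => hbc ?_, fun z hz => ?_⟩
  · exact e.symm.injective (Subtype.ext h)
  · have h1 : G.Adj a z ↔ (G.induce A).Adj ⟨a, ha⟩ ⟨z, hz⟩ := by simp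
    have h2 : ∀ d, e ⟨z, hz⟩ = d ↔ z = (e.symm d).1 := fun d =>
      ⟨fun h => by rw [← h]; simp, fun h => by
        rw [show (⟨z, hz⟩ : A) = e.symm d from Subtype.ext h]; simp⟩
    rw [h1, ← e.map_adj_iff, ← SimpleGraph.mem_neighborFinset, hset, Finset.mem_insert,
      Finset.mem_singleton, h2, h2]

/-- The set `Q` completes the edge `vx` to an induced cycle. -/
def IsConnector (G : SimpleGraph V) (v x : V) (Q : Set V) : Prop :=
  MinConn G (G.neighborSet v) (G.neighborSet x) Q ∧ v ∉ Q ∧ x ∉ Q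

theorem IsConnector.swap {v x : V} {Q : Set V} (h : IsConnector G v x Q) : IsConnector G x v Q :=
  ⟨h.1.swap, h.2.2, h.2.1⟩

theorem isConnector_swap {v x : V} : IsConnector G v x = IsConnector G x v :=
  funext fun _ => propext ⟨IsConnector.swap, IsConnector.swap⟩

theorem IsConnector.exists_indPath {v x : V} {Q : Set V} (h : IsConnector G v x Q) :
    ∃ p q, IndPath G p q Q ∧ (∀ z ∈ Q, G.Adj v z ↔ z = p) ∧ (∀ z ∈ Q, G.Adj x z ↔ z = q) := by
  obtain ⟨p, q, hP, hp, hq⟩ := h.1.exists_indPath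
  refine ⟨p, q, hP, fun z hz => ?_, fun z hz => ?_⟩
  · have := Set.ext_iff.1 hp z
    simpa [hz] using this
  · have := Set.ext_iff.1 hq z
    simpa [hz] using this

theorem IsConnector.isCycleGraph {v x : V} {Q : Set V} (h : IsConnector G v x Q)
    (hvx : G.Adj v x) : IsCycleGraph (G.induce (insert v (insert x Q))) := by
  obtain ⟨p, q, hP, hp, hq⟩ := h.exists_indPath
  refine IndPath.isCycleGraph (p := x) (q := p) ?_ ?_ ?_ ?_
  · exact .cons ((hq q hP.right_mem).2 rfl) hP.symm h.2.2 fun z hz => (hq z hz).1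
  · rintro rfl
    exact h.2.2 hP.left_mem
  · rintro (rfl | h1)
    · exact G.irrefl hvx
    · exact h.2.1 h1
  · rintro z (rfl | hz)
    · simp [hvx]
    · rw [hp z hz]
      exact ⟨Or.inr, fun h1 => h1.resolve_left (fun h2 => h.2.2 (h2 ▸ hz))⟩

theorem exists_connector_subset [Finite V] {v x : V} {E : Set V} (hE : Conn G E) (hv : v ∉ E)
    (hx : x ∉ E) (h1 : (E ∩ G.neighborSet v).Nonempty) (h2 : (E ∩ G.neighborSet x).Nonempty) :
    ∃ Q ⊆ E, IsConnector G v x Q := by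
  obtain ⟨Q, hQ, h⟩ := hE.exists_minConn h1 h2
  exact ⟨Q, hQ, h, fun h => hv (hQ h), fun h => hx (hQ h)⟩

/-- Removing an edge with its ends from an induced cycle leaves a connector. -/
theorem IsCycleGraph.isConnector [Finite V] {A : Set V} (h : IsCycleGraph (G.induce A)) {v x : V}
    (hv : v ∈ A) (hx : x ∈ A) (hvx : G.Adj v x) : IsConnector G v x (A \ {v, x}) := by
  classical
  have hother : ∀ v x, v ∈ A → x ∈ A → G.Adj v x → ∃ p ∈ A, p ≠ x ∧ p ≠ v ∧
      ∀ z ∈ A, G.Adj v z ↔ z = x ∨ z = p := by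
    intro v x hv hx hvx
    obtain ⟨b, hb, c, hc, hbc, hz⟩ := h.two_neighbors hv
    rcases (hz x hx).1 hvx with rfl | rfl
    · exact ⟨c, hc, hbc.symm, ((hz c hc).2 (Or.inr rfl)).ne', hz⟩
    · exact ⟨b, hb, hbc, ((hz b hb).2 (Or.inl rfl)).ne', fun z h => (hz z h).trans or_comm⟩
  obtain ⟨p, hpA, hpx, hpv, hp⟩ := hother v x hv hx hvx
  obtain ⟨q, hqA, hqv, hqx, hq⟩ := hother x v hx hv hvx.symm
  have hpQ : p ∈ A \ {v, x} := ⟨hpA, by simp [hpx, hpv]⟩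
  obtain ⟨K, hK, hpK⟩ := exists_mem_comps (G := G) hpQ
  have hKQ : K ⊆ A \ {v, x} := hK.2.1
  have hvK : v ∉ K := fun h => (hKQ h).2 (by simp)
  have hxK : x ∉ K := fun h => (hKQ h).2 (by simp)
  have hqK : q ∈ K := by
    -- Otherwise, in the component `K` of `p`, the vertex `p` has degree 1 and every other vertex
    -- keeps both of its cycle neighbours, contrary to the handshake lemma.
    by_contra hqK
    have := Fintype.ofFinite K
    have hclosed : ∀ z ∈ K, ∀ b ∈ A, G.Adj z b → b ≠ v → b ∈ K := by
      intro z hz b hb hzb hbv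
      refine hK.2.2 z hz b ⟨hb, ?_⟩ hzb
      rintro (rfl | rfl)
      · exact hbv rfl
      · rcases (hq z (hKQ hz).1).1 hzb.symm with rfl | rfl
        · exact hvK hz
        · exact hqK hz
    have hdeg : ∀ z : K, ∀ S : Finset K, (∀ b : K, G.Adj z b ↔ b ∈ S) →
        (G.induce K).degree z = S.card := by
      intro z S hS
      rw [← SimpleGraph.card_neighborFinset_eq_degree]
      congr 1
      ext b
      rw [SimpleGraph.mem_neighborFinset, ← hS b]
      simp
    have hodd : Odd ((G.induce K).degree ⟨p, hpK⟩) := by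
      obtain ⟨b, hb, hbv, hbp, hz⟩ := hother p v hpA hv ((hp p hpA).2 (Or.inr rfl)).symm
      have hbK : b ∈ K := hclosed p hpK b hb ((hz b hb).2 (Or.inr rfl)) hbv
      rw [hdeg ⟨p, hpK⟩ {⟨b, hbK⟩}]
      · simp
      · intro c
        rw [hz c (hKQ c.2).1, Finset.mem_singleton, Subtype.ext_iff]
        exact ⟨fun h => h.resolve_left fun h => hvK (h ▸ c.2), Or.inr⟩
    obtain ⟨w, hwp, hw⟩ := (G.induce K).exists_ne_odd_degree_of_exists_odd_degree _ hodd
    obtain ⟨b, hb, c, hc, hbc, hz⟩ := h.two_neighbors (hKQ w.2).1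
    have hwv : ¬ G.Adj w v := by
      intro h1
      rcases (hp w (hKQ w.2).1).1 h1.symm with h2 | h2
      · exact hxK (h2 ▸ w.2)
      · exact hwp (Subtype.ext h2)
    have hb' := (hz b hb).2 (Or.inl rfl)
    have hc' := (hz c hc).2 (Or.inr rfl)
    have hbK : b ∈ K := hclosed w w.2 b hb hb' (fun h => hwv (h ▸ hb'))
    have hcK : c ∈ K := hclosed w w.2 c hc hc' (fun h => hwv (h ▸ hc'))
    rw [hdeg w {⟨b, hbK⟩, ⟨c, hcK⟩}] at hw
    · rw [Finset.card_pair (by simpa using hbc)] at hw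
      exact absurd hw (by decide)
    · intro d
      rw [hz d (hKQ d.2).1, Finset.mem_insert, Finset.mem_singleton, Subtype.ext_iff,
        Subtype.ext_iff]
  have hpv' : G.Adj v p := (hp p hpA).2 (Or.inr rfl)
  have hqx' : G.Adj x q := (hq q hqA).2 (Or.inr rfl)
  obtain ⟨Q, hQK, hQ⟩ := exists_connector_subset hK.1 hvK hxK ⟨p, hpK, hpv'⟩ ⟨q, hqK, hqx'⟩
  have hcyc := hQ.isCycleGraph hvx
  have hsub : insert v (insert x Q) ⊆ A :=
    insert_subset hv (insert_subset hx fun z hz => (hKQ (hQK hz)).1)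
  -- The induced cycle found inside `A` already uses both `A`-neighbours of each of its vertices, so
  -- it is closed in the connected set `A`.
  have heq : insert v (insert x Q) = A := by
    refine h.conn.2 _ ⟨hsub, fun a ha b hb hab => ?_⟩ ⟨v, Or.inl rfl⟩
    obtain ⟨c, hc, d, hd, hcd, hz⟩ := hcyc.two_neighbors ha
    obtain ⟨c', hc', d', hd', -, hz'⟩ := h.two_neighbors (hsub ha)
    have h1 := (hz' c (hsub hc)).1 ((hz c hc).2 (Or.inl rfl))
    have h2 := (hz' d (hsub hd)).1 ((hz d hd).2 (Or.inr rfl))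
    have h3 := (hz' b hb).1 hab
    have : b = c ∨ b = d := by grind
    rcases this with rfl | rfl <;> assumption
  have : A \ {v, x} = Q := by
    rw [← heq]
    ext z
    have : z ∈ Q → z ≠ v ∧ z ≠ x := fun hz =>
      ⟨fun h => hQ.2.1 (h ▸ hz), fun h => hQ.2.2 (h ▸ hz)⟩
    simp only [mem_sdiff, mem_insert_iff, mem_singleton_iff]
    tauto
  rw [this]
  exact hQ

end Cycles
end GraphSolids

/-! ### Recognising solids from systems of induced paths -/

namespace GraphSolids
open Set
section Builders
variable {V : Type*} {G : SimpleGraph V}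

theorem IndPath.exists_walk {a b : V} {Q A : Set V} (h : IndPath G a b Q) (hQ : Q ⊆ A) :
    ∃ w : (G.induce A).Walk ⟨a, hQ h.left_mem⟩ ⟨b, hQ h.right_mem⟩, w.IsPath ∧
      (∀ z, z ∈ w.support ↔ z.1 ∈ Q) ∧
      ∀ y z : A, y.1 ∈ Q → z.1 ∈ Q → G.Adj y z → w.toSubgraph.Adj y z := by
  induction h with
  | single a =>
    refine ⟨.nil, by simp, fun z => by simp [Subtype.ext_iff], ?_⟩
    rintro ⟨y, hyA⟩ ⟨z, hzA⟩ rfl rfl hyz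
    exact absurd hyz G.irrefl
  | @cons a c b Q hac h ha hu ih =>
    obtain ⟨w, hw, hs, he⟩ := ih ((subset_insert _ _).trans hQ)
    have haA : a ∈ A := hQ (mem_insert _ _)
    have hcA : c ∈ A := hQ (Or.inr h.left_mem)
    have hadj : (G.induce A).Adj ⟨a, haA⟩ ⟨c, hcA⟩ := by simpa using hac
    refine ⟨.cons hadj w, ?_, fun z => ?_, fun y z hy hz hyz => ?_⟩
    · rw [SimpleGraph.Walk.cons_isPath_iff]
      exact ⟨hw, fun h1 => ha ((hs _).1 h1)⟩
    · rw [SimpleGraph.Walk.support_cons, List.mem_cons, hs, mem_insert_iff, Subtype.ext_iff]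
    · simp only [SimpleGraph.Walk.toSubgraph, SimpleGraph.Subgraph.sup_adj,
        SimpleGraph.subgraphOfAdj_adj]
      have hirr : ∀ y : V, ¬ G.Adj y y := fun _ => G.irrefl
      rcases hy with hy | hy <;> rcases hz with hz | hz
      · rw [hy, hz] at hyz
        exact absurd hyz G.irrefl
      · left
        have hzc : z.1 = c := hu _ hz (hy ▸ hyz)
        rw [show y = ⟨a, haA⟩ from Subtype.ext hy, show z = ⟨c, hcA⟩ from Subtype.ext hzc]
      · left
        have hyc : y.1 = c := hu _ hy (hz ▸ hyz.symm)
        rw [show z = ⟨a, haA⟩ from Subtype.ext hz, show y = ⟨c, hcA⟩ from Subtype.ext hyc]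
        exact Sym2.eq_swap
      · exact Or.inr (he y z hy hz hyz)

theorem isPyramid_of_hole {C : Set V} {w : V} (hC : IsCycleGraph (G.induce C)) (hw : w ∉ C)
    {a b c : V} (ha : a ∈ C) (hb : b ∈ C) (hc : c ∈ C) (hab : a ≠ b) (hac : a ≠ c) (hbc : b ≠ c)
    (hwa : G.Adj w a) (hwb : G.Adj w b) (hwc : G.Adj w c) :
    IsPyramid (G.induce (insert w C)) := by
  refine ⟨⟨w, Or.inl rfl⟩, hC.of_iso ?_, ?_⟩
  · have hmem : ∀ z : (insert w C : Set V), z ∈ ({⟨w, Or.inl rfl⟩}ᶜ : Set _) ↔ z.1 ∈ C := by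
      rintro ⟨z, hz⟩
      simp only [mem_compl_iff, mem_singleton_iff, Subtype.ext_iff]
      rcases hz with rfl | hz
      · simp [hw]
      · simp only [hz, iff_true]
        rintro rfl
        exact hw hz
    refine ⟨⟨fun z => ⟨z.1.1, (hmem z.1).1 z.2⟩,
      fun z => ⟨⟨z.1, Or.inr z.2⟩, (hmem _).2 z.2⟩, fun _ => rfl, fun _ => rfl⟩, ?_⟩
    intro y z
    simp
  · have hsub : ({⟨a, Or.inr ha⟩, ⟨b, Or.inr hb⟩, ⟨c, Or.inr hc⟩} : Set (insert w C : Set V)) ⊆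
        (G.induce (insert w C)).neighborSet ⟨w, Or.inl rfl⟩ := by
      rintro z (rfl | rfl | rfl) <;> simpa
    refine le_trans ?_ (encard_le_encard hsub)
    rw [encard_insert_of_notMem (by simp [Subtype.ext_iff, hab, hac]),
      encard_pair (fun h => hbc (congrArg Subtype.val h))]
    norm_num

section Paths
variable {P : Fin 3 → Set V}

/-- The edge condition permits edges between different paths that lie on a common path, as happens
at the shared ends. Nonadjacency of the ends makes every path have length at least two. -/
theorem isTrihedron_of_paths {a b : V} (hab : a ≠ b) (hnab : ¬ G.Adj a b)
    (hP : ∀ i, IndPath G a b (P i)) (hdis : ∀ i j, i ≠ j → ∀ z ∈ P i, z ∈ P j → z = a ∨ z = b)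
    (hE : ∀ i j, i ≠ j → ∀ y ∈ P i, ∀ z ∈ P j, G.Adj y z → ∃ k, y ∈ P k ∧ z ∈ P k) :
    IsTrihedron (G.induce (⋃ i, P i)) := by
  choose w hw hs he using fun i => (hP i).exists_walk (subset_iUnion P i)
  have ham : a ∈ ⋃ i, P i := mem_iUnion.2 ⟨0, (hP 0).left_mem⟩
  have hbm : b ∈ ⋃ i, P i := mem_iUnion.2 ⟨0, (hP 0).right_mem⟩
  refine ⟨⟨a, ham⟩, ⟨b, hbm⟩, w, fun h => hab (congrArg Subtype.val h), fun i => ⟨hw i, ?_⟩, ?_, ?_⟩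
  · by_contra hlt
    obtain h | h : (w i).length = 0 ∨ (w i).length = 1 := by omega
    · exact hab (congrArg Subtype.val (SimpleGraph.Walk.eq_of_length_eq_zero h))
    · exact hnab (by simpa using SimpleGraph.Walk.adj_of_length_eq_one h)
  · intro i j hij z hz hz'
    rw [hs] at hz hz'
    exact (hdis i j hij z hz hz').imp Subtype.ext Subtype.ext
  · rw [eq_top_iff]
    constructor
    · intro z _
      obtain ⟨i, hi⟩ := mem_iUnion.1 z.2
      rw [SimpleGraph.Subgraph.verts_iSup]
      exact mem_iUnion.2 ⟨i, by rw [SimpleGraph.Walk.mem_verts_toSubgraph, hs]; exact hi⟩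
    · intro y z hyz
      have hyz' : G.Adj y z := by simpa using hyz
      rw [SimpleGraph.Subgraph.iSup_adj]
      obtain ⟨i, hi⟩ := mem_iUnion.1 y.2
      obtain ⟨j, hj⟩ := mem_iUnion.1 z.2
      by_cases hij : i = j
      · exact ⟨i, he i y z hi (hij ▸ hj) hyz'⟩
      · obtain ⟨k, hk, hk'⟩ := hE i j hij y hi z hj hyz'
        exact ⟨k, he k y z hk hk' hyz'⟩

theorem isStamp_of_paths {t : Fin 3 → V} {b : V} (ht : ∀ i j, i ≠ j → G.Adj (t i) (t j))
    (htb : ∀ i, t i ≠ b) (hP : ∀ i, IndPath G (t i) b (P i))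
    (hdis : ∀ i j, i ≠ j → ∀ z ∈ P i, z ∈ P j → z = b)
    (hE : ∀ i j, i ≠ j → ∀ y ∈ P i, ∀ z ∈ P j, G.Adj y z →
      (∃ k, y ∈ P k ∧ z ∈ P k) ∨ (y = t i ∧ z = t j)) :
    IsStamp (G.induce (⋃ i, P i)) := by
  have htm : ∀ i, t i ∈ ⋃ i, P i := fun i => mem_iUnion.2 ⟨i, (hP i).left_mem⟩
  have hbm : b ∈ ⋃ i, P i := mem_iUnion.2 ⟨0, (hP 0).right_mem⟩
  choose w hw hs he using fun i => (hP i).exists_walk (subset_iUnion P i)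
  refine ⟨fun i => ⟨t i, htm i⟩, ⟨b, hbm⟩, w, fun i j hij => by simpa using ht i j hij,
    fun i => ⟨hw i, ?_⟩, ?_, ?_⟩
  · by_contra hlt
    have h : (w i).length = 0 := by omega
    exact htb i (congrArg Subtype.val (SimpleGraph.Walk.eq_of_length_eq_zero h))
  · intro i j hij z hz hz'
    rw [hs] at hz hz'
    exact Subtype.ext (hdis i j hij z hz hz')
  · rw [eq_top_iff]
    constructor
    · intro z _
      obtain ⟨i, hi⟩ := mem_iUnion.1 z.2
      rw [SimpleGraph.Subgraph.verts_sup, SimpleGraph.Subgraph.verts_iSup]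
      exact Or.inr (mem_iUnion.2 ⟨i, by rw [SimpleGraph.Walk.mem_verts_toSubgraph, hs]; exact hi⟩)
    · intro y z hyz
      have hyz' : G.Adj y z := by simpa using hyz
      rw [SimpleGraph.Subgraph.sup_adj, SimpleGraph.Subgraph.iSup_adj]
      obtain ⟨i, hi⟩ := mem_iUnion.1 y.2
      obtain ⟨j, hj⟩ := mem_iUnion.1 z.2
      by_cases hij : i = j
      · exact Or.inr ⟨i, he i y z hi (hij ▸ hj) hyz'⟩
      · obtain ⟨k, hk, hk'⟩ | ⟨hy, hz⟩ := hE i j hij y hi z hj hyz'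
        · exact Or.inr ⟨k, he k y z hk hk' hyz'⟩
        · exact Or.inl ⟨⟨i, Subtype.ext hy.symm⟩, ⟨j, Subtype.ext hz.symm⟩, hyz⟩

theorem isPrism_of_paths {s t : Fin 3 → V} (hs : ∀ i j, i ≠ j → G.Adj (s i) (s j))
    (ht : ∀ i j, i ≠ j → G.Adj (t i) (t j)) (hst : ∀ i, s i ≠ t i)
    (hP : ∀ i, IndPath G (s i) (t i) (P i)) (hdis : ∀ i j, i ≠ j → ∀ z ∈ P i, z ∉ P j)
    (hE : ∀ i j, i ≠ j → ∀ y ∈ P i, ∀ z ∈ P j, G.Adj y z →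
      (y = s i ∧ z = s j) ∨ (y = t i ∧ z = t j)) :
    IsPrism (G.induce (⋃ i, P i)) := by
  have hsm : ∀ i, s i ∈ ⋃ i, P i := fun i => mem_iUnion.2 ⟨i, (hP i).left_mem⟩
  have htm : ∀ i, t i ∈ ⋃ i, P i := fun i => mem_iUnion.2 ⟨i, (hP i).right_mem⟩
  choose w hw hsup he using fun i => (hP i).exists_walk (subset_iUnion P i)
  refine ⟨fun i => ⟨s i, hsm i⟩, fun i => ⟨t i, htm i⟩, w, fun i j hij => by simpa using hs i j hij,
    fun i j hij => by simpa using ht i j hij, fun i j h => ?_, hw, ?_, ?_⟩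
  · have h' : s i = t j := congrArg Subtype.val h
    by_cases hij : i = j
    · exact hst i (hij ▸ h')
    · exact hdis i j hij _ (hP i).left_mem (h' ▸ (hP j).right_mem)
  · intro i j hij z hz hz'
    rw [hsup] at hz hz'
    exact hdis i j hij z hz hz'
  · rw [eq_top_iff]
    constructor
    · intro z _
      obtain ⟨i, hi⟩ := mem_iUnion.1 z.2
      rw [SimpleGraph.Subgraph.verts_sup, SimpleGraph.Subgraph.verts_iSup]
      exact Or.inr (mem_iUnion.2 ⟨i, by rw [SimpleGraph.Walk.mem_verts_toSubgraph, hsup]; exact hi⟩)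
    · intro y z hyz
      have hyz' : G.Adj y z := by simpa using hyz
      rw [SimpleGraph.Subgraph.sup_adj, SimpleGraph.Subgraph.iSup_adj,
        SimpleGraph.Subgraph.sup_adj]
      obtain ⟨i, hi⟩ := mem_iUnion.1 y.2
      obtain ⟨j, hj⟩ := mem_iUnion.1 z.2
      by_cases hij : i = j
      · exact Or.inr ⟨i, he i y z hi (hij ▸ hj) hyz'⟩
      · obtain ⟨hy, hz⟩ | ⟨hy, hz⟩ := hE i j hij y hi z hj hyz'
        · exact Or.inl (Or.inl ⟨⟨i, Subtype.ext hy.symm⟩, ⟨j, Subtype.ext hz.symm⟩, hyz⟩)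
        · exact Or.inl (Or.inr ⟨⟨i, Subtype.ext hy.symm⟩, ⟨j, Subtype.ext hz.symm⟩, hyz⟩)

end Paths
end Builders
end GraphSolids

/-! ### Linked connectors -/

namespace GraphSolids
open Set
section Linked
variable {V : Type*} {G : SimpleGraph V} {v x : V}

/-- Connectors in `D` are linked if they are joined by a chain of connectors such that any two
consecutive ones lie in a common proper connected subset of `D`. -/
def Linked (G : SimpleGraph V) (v x : V) (D : Set V) : Set V → Set V → Prop :=
  Relation.EqvGen fun Q Q' => IsConnector G v x Q ∧ IsConnector G v x Q' ∧
    ∃ E, E ⊂ D ∧ Conn G E ∧ Q ⊆ E ∧ Q' ⊆ E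

theorem Linked.symm {D Q Q' : Set V} (h : Linked G v x D Q Q') : Linked G v x D Q' Q :=
  Relation.EqvGen.symm _ _ h

theorem Linked.swap {D Q Q' : Set V} (h : Linked G v x D Q Q') : Linked G x v D Q Q' := by
  unfold Linked at *
  rwa [isConnector_swap]

theorem linked_of_subset {D E Q Q' : Set V} (hQ : IsConnector G v x Q)
    (hQ' : IsConnector G v x Q') (hED : E ⊂ D) (hE : Conn G E) (h : Q ⊆ E) (h' : Q' ⊆ E) :
    Linked G v x D Q Q' :=
  Relation.EqvGen.rel _ _ ⟨hQ, hQ', E, hED, hE, h, h'⟩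

/-- `E₃` contains a connector. It shares `E₁` with `Q₁` and `E₂` with `Q₂`, so it is an intermediate
member of a chain. -/
theorem linked_of_inter [Finite V] {D E₁ E₂ E₃ Q₁ Q₂ : Set V} (hQ₁ : IsConnector G v x Q₁)
    (hQ₂ : IsConnector G v x Q₂) (hv : v ∉ D) (hx : x ∉ D) (h₁ : E₁ ⊂ D) (h₂ : E₂ ⊂ D)
    (c₁ : Conn G E₁) (c₂ : Conn G E₂) (c₃ : Conn G E₃) (s₁ : Q₁ ⊆ E₁) (s₂ : Q₂ ⊆ E₂)
    (s₃ : E₃ ⊆ E₁) (s₄ : E₃ ⊆ E₂) (a₁ : (E₃ ∩ G.neighborSet v).Nonempty)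
    (a₂ : (E₃ ∩ G.neighborSet x).Nonempty) : Linked G v x D Q₁ Q₂ := by
  obtain ⟨Q, hQ, h⟩ := exists_connector_subset c₃ (fun h => hv (h₁.subset (s₃ h)))
    (fun h => hx (h₁.subset (s₃ h))) a₁ a₂
  exact Relation.EqvGen.trans _ _ _ (linked_of_subset hQ₁ h h₁ c₁ s₁ (hQ.trans s₃))
    (linked_of_subset h hQ₂ h₂ c₂ (hQ.trans s₄) s₂)

theorem fin_three_others : ∀ i : Fin 3, ∃ j k : Fin 3, j ≠ i ∧ k ≠ i ∧ j ≠ k ∧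
    ∀ l, l = i ∨ l = j ∨ l = k := by
  decide

theorem fin_three_meet {A B : Fin 3 → Prop} (hA : ∀ i, ∃ j, j ≠ i ∧ A j)
    (hB : ∀ i, ∃ j, j ≠ i ∧ B j) : ∃ i, A i ∧ B i := by
  have key : ∀ j j' k k' : Fin 3, j' ≠ j → k' ≠ k → j = k ∨ j = k' ∨ j' = k ∨ j' = k' := by decide
  obtain ⟨j, -, hj⟩ := hA 0
  obtain ⟨j', hjj, hj'⟩ := hA j
  obtain ⟨k, -, hk⟩ := hB 0
  obtain ⟨k', hkk, hk'⟩ := hB k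
  rcases key j j' k k' hjj hkk with rfl | rfl | rfl | rfl
  exacts [⟨_, hj, hk⟩, ⟨_, hj, hk'⟩, ⟨_, hj', hk⟩, ⟨_, hj', hk'⟩]

/-- Among any three connectors in a connected set, two are linked. -/
theorem exists_linked_of_three [Finite V] {D : Set V} (hD : Conn G D) (hv : v ∉ D) (hx : x ∉ D)
    (Q : Fin 3 → Set V) (hQ : ∀ i, IsConnector G v x (Q i)) (hQD : ∀ i, Q i ⊆ D) :
    ∃ i j, i ≠ j ∧ Linked G v x D (Q i) (Q j) := by
  by_contra hcon
  push Not at hcon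
  have hss : ∀ i, Q i ⊂ D := by
    intro i
    refine (hQD i).ssubset_of_ne fun h => ?_
    obtain ⟨j, hj⟩ : ∃ j, j ≠ i := exists_ne i
    have : Q j = Q i := (hQ i).1.2.2.2 (Q j) (h ▸ hQD j) (hQ j).1.1 (hQ j).1.2.1 (hQ j).1.2.2.1
    exact hcon j i hj (this ▸ Relation.EqvGen.refl _)
  choose d hdD hdQ hd using fun i => hD.exists_not_cut (hQ i).1.1 (hss i)
  -- A connected set attached to both `v` and `x` that avoids `d i` and `d j` lies in both `D \ {d
  -- i}` and `D \ {d j}`, and so would link `Q i` with `Q j`.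
  have hkey : ∀ i j, i ≠ j → ∀ E ⊆ D, Conn G E → (E ∩ G.neighborSet v).Nonempty →
      (E ∩ G.neighborSet x).Nonempty → d i ∉ E → d j ∉ E → False := by
    intro i j hij E hED hE h1 h2 hi hj
    have hsub : ∀ (k : Fin 3) (S : Set V), S ⊆ D → d k ∉ S → S ⊆ D \ {d k} :=
      fun k S hS hk z hz => ⟨hS hz, fun h => hk (h ▸ hz)⟩
    have hpr : ∀ k : Fin 3, D \ {d k} ⊂ D := fun k =>
      sdiff_subset.ssubset_of_ne fun h => (h.symm ▸ hdD k : d k ∈ D \ {d k}).2 rfl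
    exact hcon i j hij (linked_of_inter (hQ i) (hQ j) hv hx (hpr i) (hpr j) (hd i) (hd j) hE
      (hsub i _ (hQD i) (hdQ i)) (hsub j _ (hQD j) (hdQ j)) (hsub i _ hED hi) (hsub j _ hED hj) h1 h2)
  have hmem : ∀ i j, i ≠ j → d j ∈ Q i := by
    intro i j hij
    by_contra h
    exact hkey i j hij (Q i) (hQD i) (hQ i).1.1 (hQ i).1.2.1 (hQ i).1.2.2.1 (hdQ i) h
  have hdne : ∀ i j, i ≠ j → d i ≠ d j := fun i j hij h =>
    hdQ j (h ▸ hmem j i hij.symm)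
  -- `Side N i`: the vertex `d i` can be joined to `N` without the other two. No `i` has this for
  -- both neighbourhoods. Yet `Q i` contains exactly the other two vertices, and the first one met
  -- from its end in `N` has a side; so each neighbourhood serves at least two of the three indices,
  -- and the two pairs overlap.
  let Side : Set V → Fin 3 → Prop := fun N i => ∃ Y ⊆ D, Conn G Y ∧ d i ∈ Y ∧ (∀ j, j ≠ i → d j ∉ Y) ∧
    (Y ∩ N).Nonempty
  have hnot : ∀ i, ¬ (Side (G.neighborSet v) i ∧ Side (G.neighborSet x) i) := by
    rintro i ⟨⟨Y, hY, hYc, hiY, hjY, y, hy⟩, ⟨Z, hZ, hZc, hiZ, hjZ, z, hz⟩⟩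
    obtain ⟨j, k, hji, hki, hjk, -⟩ := fin_three_others i
    refine hkey j k hjk (Y ∪ Z) (union_subset hY hZ) (hYc.union hZc ⟨_, hiY, _, hiZ, Or.inl rfl⟩)
      ⟨y, Or.inl hy.1, hy.2⟩ ⟨z, Or.inr hz.1, hz.2⟩ ?_ ?_
    · exact fun h => h.elim (hjY j hji) (hjZ j hji)
    · exact fun h => h.elim (hjY k hki) (hjZ k hki)
  have hside : ∀ N p q i, IndPath G p q (Q i) → p ∈ N → ∃ j, j ≠ i ∧ Side N j := by
    intro N p q i hP hpN
    obtain ⟨j, k, hji, hki, hjk, hall⟩ := fin_three_others i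
    obtain ⟨z, Y, hY, hPY, hz⟩ := hP.exists_prefix (S := {d j, d k})
      ⟨d j, hmem i j hji.symm, Or.inl rfl⟩
    have hzm : z ∈ Y ∩ {d j, d k} := hz ▸ rfl
    have hdi : d i ∉ Y := fun h => hdQ i (hY h)
    have huniq : ∀ l, (l = j ∨ l = k) → d l ∈ Y → d l = z := by
      intro l hl h
      have : d l ∈ Y ∩ {d j, d k} := ⟨h, by rcases hl with rfl | rfl <;> simp⟩
      rwa [hz] at this
    have hfin : ∀ l, (l = j ∨ l = k) → z = d l → Side N l := by
      intro l hl hzl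
      refine ⟨Y, hY.trans (hQD i), hPY.conn, hzl ▸ hPY.right_mem, fun m hm hmY => ?_,
        p, hPY.left_mem, hpN⟩
      rcases hall m with rfl | hm'
      · exact hdi hmY
      · exact hdne m l hm ((huniq m hm' hmY).trans hzl)
    rcases hzm.2 with h | h
    · exact ⟨j, hji, hfin j (Or.inl rfl) h⟩
    · exact ⟨k, hki, hfin k (Or.inr rfl) h⟩
  have hV : ∀ i, ∃ j, j ≠ i ∧ Side (G.neighborSet v) j := fun i => by
    obtain ⟨p, q, hP, hp, -⟩ := (hQ i).exists_indPath
    exact hside _ p q i hP ((hp p hP.left_mem).2 rfl)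
  have hX : ∀ i, ∃ j, j ≠ i ∧ Side (G.neighborSet x) j := fun i => by
    obtain ⟨p, q, hP, -, hq⟩ := (hQ i).exists_indPath
    exact hside _ q p i hP.symm ((hq q hP.right_mem).2 rfl)
  obtain ⟨i, hi⟩ := fin_three_meet hV hX
  exact hnot i hi

/-- An induced path splits at its first vertex in `S`. -/
theorem IndPath.exists_split {a b : V} {Q S : Set V} (h : IndPath G a b Q)
    (hS : (Q ∩ S).Nonempty) : ∃ z Q₁ Q₂, IndPath G a z Q₁ ∧ IndPath G z b Q₂ ∧ Q₁ ∪ Q₂ = Q ∧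
      Q₁ ∩ S = {z} ∧ (∀ y ∈ Q₁, y ∈ Q₂ → y = z) ∧
      ∀ y ∈ Q₁, ∀ y' ∈ Q₂, G.Adj y y' → y = z ∨ y' = z := by
  induction h with
  | single a =>
    obtain ⟨z, hz, hzS⟩ := hS
    obtain rfl : z = a := hz
    exact ⟨_, _, _, single _, single _, union_self _, by simpa using hzS, fun y hy _ => hy,
      fun y hy _ _ _ => Or.inl hy⟩
  | @cons a c b Q hac h ha hu ih =>
    by_cases haS : a ∈ S
    · exact ⟨_, _, _, single a, cons hac h ha hu, by simp, by simpa using haS, fun y hy _ => hy,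
        fun y hy _ _ _ => Or.inl hy⟩
    · obtain ⟨y, hy, hyS⟩ := hS
      have hyQ : y ∈ Q := hy.resolve_left fun h => haS (h ▸ hyS)
      obtain ⟨z, Q₁, Q₂, h1, h2, hun, hS, hint, hadj⟩ := ih ⟨y, hyQ, hyS⟩
      have hs1 : Q₁ ⊆ Q := hun ▸ subset_union_left
      have hs2 : Q₂ ⊆ Q := hun ▸ subset_union_right
      refine ⟨z, insert a Q₁, Q₂, cons hac h1 (fun h => ha (hs1 h)) fun y hy => hu y (hs1 hy), h2,
        by rw [insert_union, hun], by rw [insert_inter_of_notMem haS, hS], ?_, ?_⟩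
      · rintro y (rfl | hy) hy'
        · exact absurd (hs2 hy') ha
        · exact hint y hy hy'
      · rintro y (rfl | hy) y' hy' hyy'
        · have := hu y' (hs2 hy') hyy'
          subst this
          exact Or.inr (hint _ h1.left_mem hy')
        · exact hadj y hy y' hy' hyy'

theorem forall_ne_fin_three {R : Fin 3 → Fin 3 → Prop} (hR : ∀ i j, R i j → R j i) (h01 : R 0 1)
    (h02 : R 0 2) (h12 : R 1 2) : ∀ i j, i ≠ j → R i j := by
  intro i j hij
  fin_cases i <;> fin_cases j <;> first | exact absurd rfl hij | assumption | (apply hR; assumption)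

theorem iUnion_fin_three (P : Fin 3 → Set V) : ⋃ i, P i = P 0 ∪ (P 1 ∪ P 2) := by
  ext z
  simp only [mem_iUnion, Fin.exists_fin_succ, mem_union]
  simp

end Linked
end GraphSolids

/-! ### Unlinked connectors that touch -/

namespace GraphSolids
open Set
section Three
variable {V : Type*} {G : SimpleGraph V} {P₀ P₁ P₂ : Set V}

theorem isTrihedron_of_three {a b : V} (hab : a ≠ b) (hnab : ¬ G.Adj a b) (h₀ : IndPath G a b P₀)
    (h₁ : IndPath G a b P₁) (h₂ : IndPath G a b P₂)
    (r₀₁ : ∀ y ∈ P₀, ∀ z ∈ P₁, (y = z → y = a ∨ y = b) ∧ (G.Adj y z → y ∈ P₁ ∨ z ∈ P₀))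
    (r₀₂ : ∀ y ∈ P₀, ∀ z ∈ P₂, (y = z → y = a ∨ y = b) ∧ (G.Adj y z → y ∈ P₂ ∨ z ∈ P₀))
    (r₁₂ : ∀ y ∈ P₁, ∀ z ∈ P₂, (y = z → y = a ∨ y = b) ∧ (G.Adj y z → y ∈ P₂ ∨ z ∈ P₁)) :
    IsTrihedron (G.induce (P₀ ∪ (P₁ ∪ P₂))) := by
  have hr := forall_ne_fin_three (R := fun i j => ∀ y ∈ ![P₀, P₁, P₂] i, ∀ z ∈ ![P₀, P₁, P₂] j,
    (y = z → y = a ∨ y = b) ∧ (G.Adj y z → y ∈ ![P₀, P₁, P₂] j ∨ z ∈ ![P₀, P₁, P₂] i))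
    (fun i j h y hy z hz => ⟨fun hyz => hyz ▸ (h z hz y hy).1 hyz.symm,
      fun hyz => ((h z hz y hy).2 hyz.symm).symm⟩) r₀₁ r₀₂ r₁₂
  have := isTrihedron_of_paths (P := ![P₀, P₁, P₂]) hab hnab
    (fun i => by fin_cases i <;> assumption)
    (fun i j hij z hz hz' => (hr i j hij z hz z hz').1 rfl)
    (fun i j hij y hy z hz hyz => ((hr i j hij y hy z hz).2 hyz).elim (fun h => ⟨j, h, hz⟩)
      fun h => ⟨i, hy, h⟩)
  rwa [iUnion_fin_three] at this

theorem isStamp_of_three {t₀ t₁ t₂ b : V} (h₀ : IndPath G t₀ b P₀) (h₁ : IndPath G t₁ b P₁)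
    (h₂ : IndPath G t₂ b P₂) (n₀ : t₀ ≠ b) (n₁ : t₁ ≠ b) (n₂ : t₂ ≠ b) (t₀₁ : G.Adj t₀ t₁)
    (t₀₂ : G.Adj t₀ t₂) (t₁₂ : G.Adj t₁ t₂)
    (r₀₁ : ∀ y ∈ P₀, ∀ z ∈ P₁, (y = z → y = b) ∧
      (G.Adj y z → (y ∈ P₁ ∨ z ∈ P₀) ∨ (y = t₀ ∧ z = t₁)))
    (r₀₂ : ∀ y ∈ P₀, ∀ z ∈ P₂, (y = z → y = b) ∧
      (G.Adj y z → (y ∈ P₂ ∨ z ∈ P₀) ∨ (y = t₀ ∧ z = t₂)))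
    (r₁₂ : ∀ y ∈ P₁, ∀ z ∈ P₂, (y = z → y = b) ∧
      (G.Adj y z → (y ∈ P₂ ∨ z ∈ P₁) ∨ (y = t₁ ∧ z = t₂))) :
    IsStamp (G.induce (P₀ ∪ (P₁ ∪ P₂))) := by
  have ht := forall_ne_fin_three (R := fun i j => G.Adj (![t₀, t₁, t₂] i) (![t₀, t₁, t₂] j))
    (fun i j h => h.symm) t₀₁ t₀₂ t₁₂
  have hr := forall_ne_fin_three (R := fun i j => ∀ y ∈ ![P₀, P₁, P₂] i, ∀ z ∈ ![P₀, P₁, P₂] j,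
    (y = z → y = b) ∧ (G.Adj y z → (y ∈ ![P₀, P₁, P₂] j ∨ z ∈ ![P₀, P₁, P₂] i) ∨
      (y = ![t₀, t₁, t₂] i ∧ z = ![t₀, t₁, t₂] j)))
    (fun i j h y hy z hz => ⟨fun hyz => hyz ▸ (h z hz y hy).1 hyz.symm,
      fun hyz => ((h z hz y hy).2 hyz.symm).imp Or.symm And.symm⟩) r₀₁ r₀₂ r₁₂
  have := isStamp_of_paths (P := ![P₀, P₁, P₂]) (t := ![t₀, t₁, t₂]) (b := b) ht
    (fun i => by fin_cases i <;> assumption) (fun i => by fin_cases i <;> assumption)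
    (fun i j hij z hz hz' => (hr i j hij z hz z hz').1 rfl)
    (fun i j hij y hy z hz hyz => ((hr i j hij y hy z hz).2 hyz).imp_left fun h =>
      h.elim (fun h => ⟨j, h, hz⟩) fun h => ⟨i, hy, h⟩)
  rwa [iUnion_fin_three] at this

theorem isPrism_of_three {s₀ s₁ s₂ t₀ t₁ t₂ : V} (h₀ : IndPath G s₀ t₀ P₀)
    (h₁ : IndPath G s₁ t₁ P₁) (h₂ : IndPath G s₂ t₂ P₂) (n₀ : s₀ ≠ t₀) (n₁ : s₁ ≠ t₁)
    (n₂ : s₂ ≠ t₂) (s₀₁ : G.Adj s₀ s₁) (s₀₂ : G.Adj s₀ s₂) (s₁₂ : G.Adj s₁ s₂) (t₀₁ : G.Adj t₀ t₁)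
    (t₀₂ : G.Adj t₀ t₂) (t₁₂ : G.Adj t₁ t₂)
    (r₀₁ : ∀ y ∈ P₀, ∀ z ∈ P₁, y ≠ z ∧ (G.Adj y z → (y = s₀ ∧ z = s₁) ∨ (y = t₀ ∧ z = t₁)))
    (r₀₂ : ∀ y ∈ P₀, ∀ z ∈ P₂, y ≠ z ∧ (G.Adj y z → (y = s₀ ∧ z = s₂) ∨ (y = t₀ ∧ z = t₂)))
    (r₁₂ : ∀ y ∈ P₁, ∀ z ∈ P₂, y ≠ z ∧ (G.Adj y z → (y = s₁ ∧ z = s₂) ∨ (y = t₁ ∧ z = t₂))) :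
    IsPrism (G.induce (P₀ ∪ (P₁ ∪ P₂))) := by
  have hs := forall_ne_fin_three (R := fun i j => G.Adj (![s₀, s₁, s₂] i) (![s₀, s₁, s₂] j))
    (fun i j h => h.symm) s₀₁ s₀₂ s₁₂
  have ht := forall_ne_fin_three (R := fun i j => G.Adj (![t₀, t₁, t₂] i) (![t₀, t₁, t₂] j))
    (fun i j h => h.symm) t₀₁ t₀₂ t₁₂
  have hr := forall_ne_fin_three (R := fun i j => ∀ y ∈ ![P₀, P₁, P₂] i, ∀ z ∈ ![P₀, P₁, P₂] j,
    y ≠ z ∧ (G.Adj y z → (y = ![s₀, s₁, s₂] i ∧ z = ![s₀, s₁, s₂] j) ∨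
      (y = ![t₀, t₁, t₂] i ∧ z = ![t₀, t₁, t₂] j)))
    (fun i j h y hy z hz => ⟨(h z hz y hy).1.symm,
      fun hyz => ((h z hz y hy).2 hyz.symm).imp And.symm And.symm⟩) r₀₁ r₀₂ r₁₂
  have := isPrism_of_paths (P := ![P₀, P₁, P₂]) hs ht
    (fun i => by fin_cases i <;> assumption) (fun i => by fin_cases i <;> assumption)
    (fun i j hij z hz hz' => (hr i j hij z hz z hz').1 rfl)
    (fun i j hij y hy z hz hyz => (hr i j hij y hy z hz).2 hyz)
  rwa [iUnion_fin_three] at this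

/-- Opening the cycle at `u` leaves an induced path formed by the rest of `E` and the reverse of
`A`, and `u` sees just its two ends. -/
theorem IndPath.hole {u w p q : V} {E A : Set V} (hE : IndPath G u w E) (hA : IndPath G p q A)
    (huw : u ≠ w) (hd : ∀ z ∈ A, z ∉ E)
    (hadj : ∀ y ∈ E, ∀ z ∈ A, G.Adj y z ↔ (y = u ∧ z = p) ∨ (y = w ∧ z = q)) :
    IsCycleGraph (G.induce (E ∪ A)) := by
  obtain ⟨-, c, huc, hP, hc⟩ := hE.head.resolve_left fun h => huw h.1
  have h1 : IndPath G c p (E \ {u} ∪ A) := by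
    refine hP.append hA.symm ((hadj w hE.right_mem q hA.right_mem).2 (Or.inr ⟨rfl, rfl⟩)) ?_ ?_
    · exact fun z hz hzA => hd z hzA hz.1
    · intro y hy z hz hyz
      exact ((hadj y hy.1 z hz).1 hyz).resolve_left fun h => hy.2 h.1
  have h2 := h1.isCycleGraph (v := u) (fun h => hd p hA.left_mem (h ▸ hP.left_mem.1)) ?_ ?_
  · rwa [← insert_union, insert_sdiff_singleton, insert_eq_of_mem hE.left_mem] at h2
  · rintro (h | h)
    · exact h.2 rfl
    · exact hd u h hE.left_mem
  · rintro z (hz | hz)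
    · refine ⟨fun h => Or.inl (hc z hz.1 h), ?_⟩
      rintro (rfl | rfl)
      · exact huc
      · exact absurd hz.1 (hd _ hA.left_mem)
    · rw [hadj u hE.left_mem z hz]
      refine ⟨fun h => h.elim (fun h => Or.inr h.2) fun h => absurd h.1 huw, ?_⟩
      rintro (rfl | rfl)
      · exact absurd hP.left_mem.1 (hd _ hz)
      · exact Or.inl ⟨rfl, rfl⟩

end Three

section Parallel
variable {V : Type*} {G : SimpleGraph V} {v x : V}

/-- Two induced paths `A` and `B` with the same attachments `u` and `w` to an induced path `E` that
contains the edge `vx`. -/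
structure Parallel (G : SimpleGraph V) (v x : V) (E A B : Set V) (u w p q p' q' : V) : Prop where
  hE : IndPath G u w E
  huw : u ≠ w
  hv : v ∈ E
  hx : x ∈ E
  hA : IndPath G p q A
  hB : IndPath G p' q' B
  uA : ∀ z ∈ A, G.Adj u z ↔ z = p
  wA : ∀ z ∈ A, G.Adj w z ↔ z = q
  uB : ∀ z ∈ B, G.Adj u z ↔ z = p'
  wB : ∀ z ∈ B, G.Adj w z ↔ z = q'
  dA : ∀ z ∈ A, z ∉ E
  dB : ∀ z ∈ B, z ∉ E
  aA : ∀ y ∈ E, ∀ z ∈ A, G.Adj y z → y = u ∨ y = w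
  aB : ∀ y ∈ E, ∀ z ∈ B, G.Adj y z → y = u ∨ y = w
  ne : A ≠ B
  -- Whatever joins `u` to `w` off `E` contains, together with the rest of `E`, a connector of `vx`.
  ext : ∀ Y, Conn G Y → (∀ z ∈ Y, z ∉ E) → (∃ y ∈ Y, G.Adj u y) → (∃ y ∈ Y, G.Adj w y) →
    Conn G (E \ {v, x} ∪ Y) ∧ ((E \ {v, x} ∪ Y) ∩ G.neighborSet v).Nonempty ∧
      ((E \ {v, x} ∪ Y) ∩ G.neighborSet x).Nonempty
  -- At the start `u` and `w` are the adjacent vertices `v` and `x`, and touching is assumed; once a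
  -- common end has been moved into `E`, the new ends are nonadjacent.
  touch : Touch G A B ∨ ¬ G.Adj u w

namespace Parallel
variable {E A B : Set V} {u w p q p' q' : V}

theorem swap (h : Parallel G v x E A B u w p q p' q') : Parallel G v x E A B w u q p q' p' where
  hE := h.hE.symm
  huw := h.huw.symm
  hv := h.hv
  hx := h.hx
  hA := h.hA.symm
  hB := h.hB.symm
  uA := h.wA
  wA := h.uA
  uB := h.wB
  wB := h.uB
  dA := h.dA
  dB := h.dB
  aA := fun y hy z hz hyz => (h.aA y hy z hz hyz).symm
  aB := fun y hy z hz hyz => (h.aB y hy z hz hyz).symm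
  ne := h.ne
  ext := fun Y h1 h2 h3 h4 => h.ext Y h1 h2 h4 h3
  touch := h.touch.imp_right fun h h' => h h'.symm

theorem flip (h : Parallel G v x E A B u w p q p' q') : Parallel G v x E B A u w p' q' p q where
  hE := h.hE
  huw := h.huw
  hv := h.hv
  hx := h.hx
  hA := h.hB
  hB := h.hA
  uA := h.uB
  wA := h.wB
  uB := h.uA
  wB := h.wA
  dA := h.dB
  dB := h.dA
  aA := h.aB
  aB := h.aA
  ne := h.ne.symm
  ext := h.ext
  touch := h.touch.imp_left Touch.symm

theorem adj_iff (h : Parallel G v x E A B u w p q p' q') : ∀ y ∈ E, ∀ z ∈ A,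
    G.Adj y z ↔ (y = u ∧ z = p) ∨ (y = w ∧ z = q) := by
  intro y hy z hz
  constructor
  · intro hyz
    rcases h.aA y hy z hz hyz with rfl | rfl
    · exact Or.inl ⟨rfl, (h.uA z hz).1 hyz⟩
    · exact Or.inr ⟨rfl, (h.wA z hz).1 hyz⟩
  · rintro (⟨rfl, h'⟩ | ⟨rfl, h'⟩)
    · exact (h.uA z hz).2 h'
    · exact (h.wA z hz).2 h'

theorem not_mem_of_ne (h : Parallel G v x E A B u w p q p' q') (hp : p ≠ p') : p' ∉ A :=
  fun hm => hp ((h.uA p' hm).1 ((h.uB p' h.hB.left_mem).2 rfl)).symm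

/-- If `A` were the single vertex `p`, this vertex would be both ends of `B` too, and `A = B`. -/
theorem ne_of_left_eq (h : Parallel G v x E A B u w p q p' q') (hp : p = p') : p ≠ q := by
  intro hpq
  have hA := h.hA
  rw [← hpq] at hA
  have hB := h.hB
  have hpB : p ∈ B := hp ▸ hB.left_mem
  have hwp : G.Adj w p := (h.wA p h.hA.left_mem).2 hpq
  have : p = q' := (h.wB p hpB).1 hwp
  rw [← this, ← hp] at hB
  exact h.ne (hA.eq_singleton.trans hB.eq_singleton.symm)

theorem path_of_not_adj (h : Parallel G v x E A B u w p q p' q') (hn : ¬ G.Adj u w) :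
    IndPath G u w (insert u (insert w A)) := by
  have h1 : IndPath G w p (insert w A) :=
    .cons ((h.wA q h.hA.right_mem).2 rfl) h.hA.symm (fun hw => h.dA w hw h.hE.right_mem)
      fun z hz => (h.wA z hz).1
  refine .cons ((h.uA p h.hA.left_mem).2 rfl) h1.symm ?_ ?_
  · rintro (hu | hu)
    · exact h.huw hu
    · exact h.dA u hu h.hE.left_mem
  · rintro z (rfl | hz) huz
    · exact absurd huz hn
    · exact (h.uA z hz).1 huz

/-- The three paths from `u` to `w` are `E` and the extensions of `A` and `B` by `u` and `w`. -/
theorem isTrihedron (h : Parallel G v x E A B u w p q p' q') (hn : ¬ Touch G A B) :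
    IsTrihedron (G.induce (E ∪ (A ∪ B))) := by
  have huw : ¬ G.Adj u w := h.touch.resolve_left hn
  have hEu := h.hE.left_mem
  have hEw := h.hE.right_mem
  have key := isTrihedron_of_three h.huw huw h.hE (h.path_of_not_adj huw)
    (h.flip.path_of_not_adj huw) ?_ ?_ ?_
  · have hset : E ∪ (A ∪ B) = E ∪ (insert u (insert w A) ∪ insert u (insert w B)) := by
      ext z
      simp only [mem_union, mem_insert_iff]
      grind
    rwa [hset]
  · rintro y hy z (rfl | rfl | hz)
    · exact ⟨Or.inl, fun _ => Or.inr hEu⟩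
    · exact ⟨Or.inr, fun _ => Or.inr hEw⟩
    · exact ⟨fun e => absurd (e ▸ hy) (h.dA z hz), fun hyz => Or.inl <|
        (h.aA y hy z hz hyz).elim Or.inl fun e => Or.inr (Or.inl e)⟩
  · rintro y hy z (rfl | rfl | hz)
    · exact ⟨Or.inl, fun _ => Or.inr hEu⟩
    · exact ⟨Or.inr, fun _ => Or.inr hEw⟩
    · exact ⟨fun e => absurd (e ▸ hy) (h.dB z hz), fun hyz => Or.inl <|
        (h.aB y hy z hz hyz).elim Or.inl fun e => Or.inr (Or.inl e)⟩
  · rintro y (rfl | rfl | hy)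
    · exact fun z _ => ⟨fun _ => Or.inl rfl, fun _ => Or.inl (Or.inl rfl)⟩
    · exact fun z _ => ⟨fun _ => Or.inr rfl, fun _ => Or.inl (Or.inr (Or.inl rfl))⟩
    · rintro z (rfl | rfl | hz)
      · exact ⟨Or.inl, fun _ => Or.inr (Or.inl rfl)⟩
      · exact ⟨Or.inr, fun _ => Or.inr (Or.inr (Or.inl rfl))⟩
      · exact ⟨fun e => absurd ⟨y, hy, z, hz, Or.inl e⟩ hn,
          fun e => absurd ⟨y, hy, z, hz, Or.inr e⟩ hn⟩

/-- `A` is a single vertex that sees `u`, `w` and some vertex of `B`. It is the apex over the cycle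
`E ∪ B`. -/
theorem isPyramid (h : Parallel G v x E A B u w p q p' q') (hp : p ≠ p') (hpq : p = q)
    (ht : Touch G A B) : IsPyramid (G.induce (E ∪ (A ∪ B))) := by
  subst hpq
  have hA := h.hA.eq_singleton
  have hpB : p ∉ B := h.flip.not_mem_of_ne hp.symm
  obtain ⟨a, ha, b, hb, hab⟩ := ht
  obtain rfl : a = p := by rw [hA] at ha; exact ha
  have hab' : G.Adj a b := hab.resolve_left fun e => hpB (e ▸ hb)
  have key := isPyramid_of_hole (w := a) (h.hE.hole h.hB h.huw h.dB h.flip.adj_iff)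
    (fun hm => hm.elim (h.dA a ha) hpB) (Or.inl h.hE.left_mem) (Or.inl h.hE.right_mem) (Or.inr hb)
    h.huw (fun e => h.dB b hb (e ▸ h.hE.left_mem)) (fun e => h.dB b hb (e ▸ h.hE.right_mem))
    ((h.uA a ha).2 rfl).symm ((h.wA a ha).2 rfl).symm hab'
  have hset : E ∪ (A ∪ B) = insert a (E ∪ B) := by
    rw [hA]
    ext z
    simp only [mem_union, mem_insert_iff, mem_singleton_iff]
    tauto
  rwa [hset]

/-- If the trimmed paths touched, `Q ∪ Q'` without `p'` and without `q` would be connected sets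
containing `Q` and `Q'` respectively, and their overlap would contain a connector. -/
theorem not_touch [Finite V] (h : Parallel G v x E A B u w p q p' q') {Q Q' : Set V}
    (hQ : Q = E \ {v, x} ∪ A) (hQ' : Q' = E \ {v, x} ∪ B) (hc : IsConnector G v x Q)
    (hc' : IsConnector G v x Q') (hl : ¬ Linked G v x (Q ∪ Q') Q Q') (hp : p ≠ p') (hq : q ≠ q')
    (hpq : p ≠ q) (hpq' : p' ≠ q') : ¬ Touch G (A \ {q}) (B \ {p'}) := by
  intro ht
  have hp'A : p' ∉ A := h.not_mem_of_ne hp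
  have hqB : q ∉ B := h.flip.swap.not_mem_of_ne hq.symm
  have hAq : IndPath G q p A := h.hA.symm
  obtain ⟨-, c, -, hPA, -⟩ := hAq.head.resolve_left fun e => hpq e.1.symm
  obtain ⟨-, c', -, hPB, -⟩ := h.hB.head.resolve_left fun e => hpq' e.1
  have hpA := hPA.right_mem
  have hqB' := hPB.right_mem
  have hup : G.Adj u p := (h.uA p h.hA.left_mem).2 rfl
  have hwq : G.Adj w q := (h.wA q h.hA.right_mem).2 rfl
  have hup' : G.Adj u p' := (h.uB p' h.hB.left_mem).2 rfl
  have hwq' : G.Adj w q' := (h.wB q' h.hB.right_mem).2 rfl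
  have hdA : ∀ z ∈ A \ {q}, z ∉ E := fun z hz => h.dA z hz.1
  have hdB : ∀ z ∈ B \ {p'}, z ∉ E := fun z hz => h.dB z hz.1
  have e₁ := h.ext (A ∪ B \ {p'}) (h.hA.conn.union hPB.conn (ht.mono sdiff_subset subset_rfl))
    (by rintro z (hz | hz); exacts [h.dA z hz, hdB z hz]) ⟨p, Or.inl h.hA.left_mem, hup⟩
    ⟨q, Or.inl h.hA.right_mem, hwq⟩
  have e₂ := h.ext (A \ {q} ∪ B) (hPA.conn.union h.hB.conn (ht.mono subset_rfl sdiff_subset))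
    (by rintro z (hz | hz); exacts [hdA z hz, h.dB z hz]) ⟨p, Or.inl hpA, hup⟩
    ⟨q', Or.inr h.hB.right_mem, hwq'⟩
  have e₃ := h.ext (A \ {q} ∪ B \ {p'}) (hPA.conn.union hPB.conn ht)
    (by rintro z (hz | hz); exacts [hdA z hz, hdB z hz]) ⟨p, Or.inl hpA, hup⟩
    ⟨q', Or.inr hqB', hwq'⟩
  have hp'E := h.dB p' h.hB.left_mem
  have hqE := h.dA q h.hA.right_mem
  have hp'B := h.hB.left_mem
  have hqA := h.hA.right_mem
  refine hl (linked_of_inter hc hc' (fun hm => hm.elim hc.2.1 hc'.2.1)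
    (fun hm => hm.elim hc.2.2 hc'.2.2) ?_ ?_ e₁.1 e₂.1 e₃.1 ?_ ?_ ?_ ?_ e₃.2.1 e₃.2.2)
  · rw [hQ, hQ', ssubset_iff_exists]
    refine ⟨?_, p', Or.inr (Or.inr hp'B), ?_⟩
    · rintro z (hz | hz | hz)
      exacts [Or.inl (Or.inl hz), Or.inl (Or.inr hz), Or.inr (Or.inr hz.1)]
    · rintro (hz | hz | hz)
      exacts [hp'E hz.1, hp'A hz, hz.2 rfl]
  · rw [hQ, hQ', ssubset_iff_exists]
    refine ⟨?_, q, Or.inl (Or.inr hqA), ?_⟩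
    · rintro z (hz | hz | hz)
      exacts [Or.inl (Or.inl hz), Or.inl (Or.inr hz.1), Or.inr (Or.inr hz)]
    · rintro (hz | hz | hz)
      exacts [hqE hz.1, hz.2 rfl, hqB hz]
  · rw [hQ]
    exact union_subset_union_right _ subset_union_left
  · rw [hQ']
    exact union_subset_union_right _ subset_union_right
  · exact union_subset_union_right _ (union_subset_union_left _ sdiff_subset)
  · exact union_subset_union_right _ (union_subset_union_right _ sdiff_subset)

theorem path_insert (h : Parallel G v x E A B u w p q p' q') : IndPath G p w (insert w A) :=
  (IndPath.cons ((h.wA q h.hA.right_mem).2 rfl) h.hA.symm (fun hw => h.dA w hw h.hE.right_mem)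
      fun z hz => (h.wA z hz).1).symm

/-- The triangle is `u p p'`; its three paths `E`, `A` and `B`, the last two extended by `w`, end at
`w`. -/
theorem isStamp (h : Parallel G v x E A B u w p q p' q') (hpp : G.Adj p p')
    (hdis : ∀ z ∈ A, z ∉ B) (hadj : ∀ y ∈ A, ∀ z ∈ B, G.Adj y z → y = p ∧ z = p') :
    IsStamp (G.induce (E ∪ (A ∪ B))) := by
  have hEw := h.hE.right_mem
  have key := isStamp_of_three h.hE h.path_insert h.flip.path_insert h.huw
    (fun e => h.dA p h.hA.left_mem (e ▸ hEw)) (fun e => h.dB p' h.hB.left_mem (e ▸ hEw))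
    ((h.uA p h.hA.left_mem).2 rfl) ((h.uB p' h.hB.left_mem).2 rfl) hpp ?_ ?_ ?_
  · have hset : E ∪ (A ∪ B) = E ∪ (insert w A ∪ insert w B) := by
      ext z
      simp only [mem_union, mem_insert_iff]
      grind
    rwa [hset]
  · rintro y hy z (rfl | hz)
    · exact ⟨id, fun _ => Or.inl (Or.inr hEw)⟩
    · refine ⟨fun e => absurd (e ▸ hy) (h.dA z hz), fun hyz => ?_⟩
      rcases (h.adj_iff y hy z hz).1 hyz with h' | h'
      · exact Or.inr h'
      · exact Or.inl (Or.inl (Or.inl h'.1))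
  · rintro y hy z (rfl | hz)
    · exact ⟨id, fun _ => Or.inl (Or.inr hEw)⟩
    · refine ⟨fun e => absurd (e ▸ hy) (h.dB z hz), fun hyz => ?_⟩
      rcases (h.flip.adj_iff y hy z hz).1 hyz with h' | h'
      · exact Or.inr h'
      · exact Or.inl (Or.inl (Or.inl h'.1))
  · rintro y (rfl | hy) z hz
    · exact ⟨fun _ => rfl, fun _ => Or.inl (Or.inl (Or.inl rfl))⟩
    · rcases hz with rfl | hz
      · exact ⟨id, fun _ => Or.inl (Or.inr (Or.inl rfl))⟩
      · exact ⟨fun e => absurd (e ▸ hz) (hdis y hy), fun e => Or.inr (hadj y hy z hz e)⟩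

/-- The triangles are `u p p'` and `w q q'`, joined by `E`, `A` and `B`. -/
theorem isPrism (h : Parallel G v x E A B u w p q p' q') (hpp : G.Adj p p') (hqq : G.Adj q q')
    (hpq : p ≠ q) (hpq' : p' ≠ q') (hdis : ∀ z ∈ A, z ∉ B)
    (hadj : ∀ y ∈ A, ∀ z ∈ B, G.Adj y z → (y = p ∧ z = p') ∨ (y = q ∧ z = q')) :
    IsPrism (G.induce (E ∪ (A ∪ B))) :=
  isPrism_of_three h.hE h.hA h.hB h.huw hpq hpq' ((h.uA p h.hA.left_mem).2 rfl)
    ((h.uB p' h.hB.left_mem).2 rfl) hpp ((h.wA q h.hA.right_mem).2 rfl)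
    ((h.wB q' h.hB.right_mem).2 rfl) hqq
    (fun y hy z hz => ⟨fun e => h.dA z hz (e ▸ hy), (h.adj_iff y hy z hz).1⟩)
    (fun y hy z hz => ⟨fun e => h.dB z hz (e ▸ hy), (h.flip.adj_iff y hy z hz).1⟩)
    (fun y hy z hz => ⟨fun e => hdis y hy (e ▸ hz), hadj y hy z hz⟩)

/-- A common first vertex of `A` and `B` can be moved to `E`. -/
theorem shift (h : Parallel G v x E A B u w p q p q') :
    ∃ c c', Parallel G v x (insert p E) (A \ {p}) (B \ {p}) p w c q c' q' := by
  have hpq := h.ne_of_left_eq rfl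
  have hpq' := h.flip.ne_of_left_eq rfl
  obtain ⟨-, c, hpc, hPA, hcA⟩ := h.hA.head.resolve_left fun e => hpq e.1
  obtain ⟨-, c', hpc', hPB, hcB⟩ := h.hB.head.resolve_left fun e => hpq' e.1
  have hpA := h.hA.left_mem
  have hpB := h.hB.left_mem
  have hpE : p ∉ E := h.dA p hpA
  have hup : G.Adj u p := (h.uA p hpA).2 rfl
  have hpw : ¬ G.Adj p w := fun e => hpq ((h.wA p hpA).1 e.symm)
  have hpu : ∀ z ∈ E, G.Adj p z → z = u := fun z hz hpz =>
    (h.aA z hz p hpA hpz.symm).resolve_right fun e => hpw (e ▸ hpz)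
  refine ⟨c, c', ?_⟩
  refine { hE := .cons hup.symm h.hE hpE hpu, huw := fun e => hpE (e ▸ h.hE.right_mem),
           hv := Or.inr h.hv, hx := Or.inr h.hx, hA := hPA, hB := hPB, uA := ?_, wA := ?_,
           uB := ?_, wB := ?_, dA := ?_, dB := ?_, aA := ?_, aB := ?_, ne := ?_, ext := ?_,
           touch := Or.inr hpw }
  · exact fun z hz => ⟨hcA z hz.1, fun e => e ▸ hpc⟩
  · exact fun z hz => h.wA z hz.1
  · exact fun z hz => ⟨hcB z hz.1, fun e => e ▸ hpc'⟩
  · exact fun z hz => h.wB z hz.1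
  · rintro z hz (hzp | hzE)
    exacts [hz.2 hzp, h.dA z hz.1 hzE]
  · rintro z hz (hzp | hzE)
    exacts [hz.2 hzp, h.dB z hz.1 hzE]
  · rintro y (rfl | hy) z hz hyz
    · exact Or.inl rfl
    · refine Or.inr ((h.aA y hy z hz.1 hyz).resolve_left ?_)
      rintro rfl
      exact hz.2 ((h.uA z hz.1).1 hyz)
  · rintro y (rfl | hy) z hz hyz
    · exact Or.inl rfl
    · refine Or.inr ((h.aB y hy z hz.1 hyz).resolve_left ?_)
      rintro rfl
      exact hz.2 ((h.uB z hz.1).1 hyz)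
  · intro e
    apply h.ne
    rw [← insert_eq_of_mem hpA, ← insert_eq_of_mem hpB, ← insert_sdiff_singleton, e,
      insert_sdiff_singleton]
  · rintro Y hY hYE ⟨y, hy, hpy⟩ ⟨z, hz, hwz⟩
    have := h.ext (insert p Y) (hY.insert_adj hy hpy) ?_ ⟨p, Or.inl rfl, hup⟩ ⟨z, Or.inr hz, hwz⟩
    · have heq : E \ {v, x} ∪ insert p Y = insert p E \ {v, x} ∪ Y := by
        have hpv : p ≠ v := fun e => hpE (e ▸ h.hv)
        have hpx : p ≠ x := fun e => hpE (e ▸ h.hx)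
        ext z
        simp only [mem_union, mem_sdiff, mem_insert_iff, mem_singleton_iff]
        grind
      rwa [heq] at this
    · rintro t (rfl | ht)
      · exact hpE
      · exact fun htE => hYE t ht (Or.inr htE)

theorem isSolidGraph [Finite V] {n : ℕ} (h : Parallel G v x E A B u w p q p' q')
    (hn : A.ncard = n) {Q Q' : Set V} (hQ : Q = E \ {v, x} ∪ A) (hQ' : Q' = E \ {v, x} ∪ B)
    (hc : IsConnector G v x Q) (hc' : IsConnector G v x Q')
    (hl : ¬ Linked G v x (Q ∪ Q') Q Q') : IsSolidGraph (G.induce (E ∪ (A ∪ B))) := by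
  induction n generalizing E A B u w p q p' q' with
  | zero =>
    rw [ncard_eq_zero] at hn
    exact absurd h.hA.left_mem (hn ▸ notMem_empty p)
  | succ n ih =>
    -- Moving a common end into `E` shortens `A` and leaves `Q` and `Q'` unchanged, so the induction
    -- on the size of `A` applies.
    have hstep : ∀ {u w p q p' q'}, Parallel G v x E A B u w p q p' q' → p = p' →
        IsSolidGraph (G.induce (E ∪ (A ∪ B))) := by
      intro u w p q p' q' h hpp
      subst hpp
      obtain ⟨c, c', h'⟩ := h.shift
      have hpA := h.hA.left_mem
      have hpB := h.hB.left_mem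
      have hpE : p ∉ E := h.dA p hpA
      have hpv : p ≠ v := fun e => hpE (e ▸ h.hv)
      have hpx : p ≠ x := fun e => hpE (e ▸ h.hx)
      have := ih h' ?_ ?_ ?_
      · have hset : E ∪ (A ∪ B) = insert p E ∪ (A \ {p} ∪ B \ {p}) := by
          ext z
          simp only [mem_union, mem_sdiff, mem_insert_iff, mem_singleton_iff]
          grind
        rwa [hset]
      · rw [ncard_sdiff_singleton_of_mem hpA, hn]
        rfl
      · rw [hQ]
        ext z
        simp only [mem_union, mem_sdiff, mem_insert_iff, mem_singleton_iff]
        grind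
      · rw [hQ']
        ext z
        simp only [mem_union, mem_sdiff, mem_insert_iff, mem_singleton_iff]
        grind
    by_cases hp : p = p'
    · exact hstep h hp
    by_cases hq : q = q'
    · exact hstep h.swap hq
    by_cases ht : Touch G A B
    swap
    · exact Or.inr (Or.inl (h.isTrihedron ht))
    by_cases hpq : p = q
    · exact Or.inl (h.isPyramid hp hpq ht)
    by_cases hpq' : p' = q'
    · rw [union_comm A B]
      exact Or.inl (h.flip.isPyramid (Ne.symm hp) hpq' ht.symm)
    have hn1 := h.not_touch hQ hQ' hc hc' hl hp hq hpq hpq'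
    have hn2 := h.swap.not_touch hQ hQ' hc hc' hl hq hp (Ne.symm hpq) (Ne.symm hpq')
    -- Trimming from either side shows that `A` and `B` are in contact only at corresponding ends.
    -- Both contacts give a prism, one gives a stamp.
    have hcontact : ∀ y ∈ A, ∀ z ∈ B, (y = z ∨ G.Adj y z) →
        (y = p ∧ z = p') ∨ (y = q ∧ z = q') := by
      intro y hy z hz hyz
      have h1 : y = q ∨ z = p' := by
        by_contra hcon
        push Not at hcon
        exact hn1 ⟨y, ⟨hy, hcon.1⟩, z, ⟨hz, hcon.2⟩, hyz⟩
      have h2 : y = p ∨ z = q' := by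
        by_contra hcon
        push Not at hcon
        exact hn2 ⟨y, ⟨hy, hcon.1⟩, z, ⟨hz, hcon.2⟩, hyz⟩
      grind
    have hdis : ∀ z ∈ A, z ∉ B := by
      intro z hz hz'
      have := hcontact z hz z hz' (Or.inl rfl)
      grind
    have hadj : ∀ y ∈ A, ∀ z ∈ B, G.Adj y z → (y = p ∧ z = p') ∨ (y = q ∧ z = q') :=
      fun y hy z hz hyz => hcontact y hy z hz (Or.inr hyz)
    by_cases hpp : G.Adj p p'
    · by_cases hqq : G.Adj q q'
      · exact Or.inr (Or.inr (Or.inr (h.isPrism hpp hqq hpq hpq' hdis hadj)))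
      · refine Or.inr (Or.inr (Or.inl (h.isStamp hpp hdis fun y hy z hz hyz => ?_)))
        refine (hadj y hy z hz hyz).resolve_right ?_
        rintro ⟨rfl, rfl⟩
        exact hqq hyz
    · have hqq : G.Adj q q' := by
        obtain ⟨y, hy, z, hz, hyz⟩ := ht
        have hyz' : G.Adj y z := hyz.resolve_left fun e => hdis y hy (e ▸ hz)
        rcases hadj y hy z hz hyz' with ⟨rfl, rfl⟩ | ⟨rfl, rfl⟩
        exacts [absurd hyz' hpp, hyz']
      refine Or.inr (Or.inr (Or.inl (h.swap.isStamp hqq hdis fun y hy z hz hyz => ?_)))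
      refine (hadj y hy z hz hyz).resolve_left ?_
      rintro ⟨rfl, rfl⟩
      exact hpp hyz

end Parallel

/-- Connectors that touch but are not linked in their union form a solid with the edge `vx`. -/
theorem isSolidGraph_of_touch [Finite V] (hvx : G.Adj v x) {Q Q' : Set V} (hQ : IsConnector G v x Q)
    (hQ' : IsConnector G v x Q') (ht : Touch G Q Q') (hl : ¬ Linked G v x (Q ∪ Q') Q Q') :
    IsSolidGraph (G.induce (insert v (insert x (Q ∪ Q')))) := by
  obtain ⟨p, q, hA, hp, hq⟩ := hQ.exists_indPath
  obtain ⟨p', q', hB, hp', hq'⟩ := hQ'.exists_indPath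
  have hE : IndPath G v x {v, x} := .cons hvx (.single x) hvx.ne fun z hz _ => hz
  have hpar : Parallel G v x {v, x} Q Q' v x p q p' q' := by
    refine ⟨hE, hvx.ne, Or.inl rfl, Or.inr rfl, hA, hB, hp, hq, hp', hq', ?_, ?_,
      fun y hy _ _ _ => hy, fun y hy _ _ _ => hy, ?_, ?_, Or.inl ht⟩
    · rintro z hz (rfl | rfl)
      exacts [hQ.2.1 hz, hQ.2.2 hz]
    · rintro z hz (rfl | rfl)
      exacts [hQ'.2.1 hz, hQ'.2.2 hz]
    · rintro rfl
      exact hl (Relation.EqvGen.refl _)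
    · rintro Y hY - ⟨y, hy, hvy⟩ ⟨z, hz, hxz⟩
      rw [sdiff_self, empty_union]
      exact ⟨hY, ⟨y, hy, hvy⟩, ⟨z, hz, hxz⟩⟩
  have := hpar.isSolidGraph rfl (by rw [sdiff_self, empty_union]) (by rw [sdiff_self, empty_union])
    hQ hQ' hl
  rwa [insert_union, singleton_union] at this

end Parallel
end GraphSolids

/-! ### Unlinked connectors that do not touch -/

namespace GraphSolids
open Set
section Bridge
variable {V : Type*} {G : SimpleGraph V} {v x : V}

/-- Two connectors `A` and `B` that are joined by an induced path `R`. -/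
structure Bridge (G : SimpleGraph V) (v x : V) (A R B : Set V) (p q r s p' q' : V) : Prop where
  vx : G.Adj v x
  cA : IsConnector G v x A
  cB : IsConnector G v x B
  pA : IndPath G p q A
  pB : IndPath G p' q' B
  pR : IndPath G r s R
  vA : ∀ z ∈ A, G.Adj v z ↔ z = p
  xA : ∀ z ∈ A, G.Adj x z ↔ z = q
  vB : ∀ z ∈ B, G.Adj v z ↔ z = p'
  xB : ∀ z ∈ B, G.Adj x z ↔ z = q'
  vR : v ∉ R
  xR : x ∉ R
  nAB : ¬ Touch G A B
  dAR : ∀ z ∈ A, z ∉ R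
  dBR : ∀ z ∈ B, z ∉ R
  aA : ∀ y ∈ R, ∀ z ∈ A, G.Adj y z → y = r
  aB : ∀ y ∈ R, ∀ z ∈ B, G.Adj y z → y = s
  eA : ∃ z ∈ A, G.Adj r z
  eB : ∃ z ∈ B, G.Adj s z
  nl : ¬ Linked G v x (A ∪ (R ∪ B)) A B

namespace Bridge
variable {A R B : Set V} {p q r s p' q' : V}

theorem swap (h : Bridge G v x A R B p q r s p' q') : Bridge G x v A R B q p r s q' p' where
  vx := h.vx.symm
  cA := h.cA.swap
  cB := h.cB.swap
  pA := h.pA.symm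
  pB := h.pB.symm
  pR := h.pR
  vA := h.xA
  xA := h.vA
  vB := h.xB
  xB := h.vB
  vR := h.xR
  xR := h.vR
  nAB := h.nAB
  dAR := h.dAR
  dBR := h.dBR
  aA := h.aA
  aB := h.aB
  eA := h.eA
  eB := h.eB
  nl := fun hl => h.nl hl.swap

theorem union_flip : A ∪ (R ∪ B) = B ∪ (R ∪ A) := by
  rw [union_comm, union_assoc, union_left_comm, union_comm R, union_left_comm, union_comm A]

theorem flip (h : Bridge G v x A R B p q r s p' q') : Bridge G v x B R A p' q' s r p q where
  vx := h.vx
  cA := h.cB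
  cB := h.cA
  pA := h.pB
  pB := h.pA
  pR := h.pR.symm
  vA := h.vB
  xA := h.xB
  vB := h.vA
  xB := h.xA
  vR := h.vR
  xR := h.xR
  nAB := fun ht => h.nAB ht.symm
  dAR := h.dBR
  dBR := h.dAR
  aA := h.aB
  aB := h.aA
  eA := h.eB
  eB := h.eA
  nl := fun hl => h.nl (by rw [union_flip]; exact hl.symm)

theorem ne_of_mem (h : Bridge G v x A R B p q r s p' q') {y z : V} (hy : y ∈ A) (hz : z ∈ B) :
    y ≠ z := fun e => h.nAB ⟨y, hy, z, hz, Or.inl e⟩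

theorem not_adj (h : Bridge G v x A R B p q r s p' q') {y z : V} (hy : y ∈ A) (hz : z ∈ B) :
    ¬ G.Adj y z := fun e => h.nAB ⟨y, hy, z, hz, Or.inr e⟩

/-- This is `linked_of_inter` against `nl`; the omitted vertices `d₁` and `d₂` certify that `E₁` and
`E₂` are proper. -/
theorem false_of_inter [Finite V] (h : Bridge G v x A R B p q r s p' q') {E₁ E₂ E₃ : Set V}
    (h₁ : E₁ ⊆ A ∪ (R ∪ B)) (h₂ : E₂ ⊆ A ∪ (R ∪ B)) {d₁ d₂ : V} (m₁ : d₁ ∈ A ∪ (R ∪ B))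
    (n₁ : d₁ ∉ E₁) (m₂ : d₂ ∈ A ∪ (R ∪ B)) (n₂ : d₂ ∉ E₂)
    (c₁ : Conn G E₁) (c₂ : Conn G E₂) (c₃ : Conn G E₃) (s₁ : A ⊆ E₁) (s₂ : B ⊆ E₂)
    (s₃ : E₃ ⊆ E₁) (s₄ : E₃ ⊆ E₂) {a b : V} (ha : a ∈ E₃) (hva : G.Adj v a) (hb : b ∈ E₃)
    (hxb : G.Adj x b) : False := by
  refine h.nl (linked_of_inter h.cA h.cB ?_ ?_ (ssubset_iff_exists.2 ⟨h₁, d₁, m₁, n₁⟩)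
    (ssubset_iff_exists.2 ⟨h₂, d₂, m₂, n₂⟩) c₁ c₂ c₃ s₁ s₂ s₃ s₄ ⟨a, ha, hva⟩ ⟨b, hb, hxb⟩)
  · rintro (hm | hm | hm)
    exacts [h.cA.2.1 hm, h.vR hm, h.cB.2.1 hm]
  · rintro (hm | hm | hm)
    exacts [h.cA.2.2 hm, h.xR hm, h.cB.2.2 hm]

theorem conn_left (h : Bridge G v x A R B p q r s p' q') : Conn G (A ∪ R) := by
  obtain ⟨z, hz, hrz⟩ := h.eA
  exact h.pA.conn.union h.pR.conn ⟨z, hz, r, h.pR.left_mem, Or.inr hrz.symm⟩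

theorem conn_right (h : Bridge G v x A R B p q r s p' q') : Conn G (R ∪ B) :=
  union_comm B R ▸ h.flip.conn_left

theorem left_not_mem (h : Bridge G v x A R B p q r s p' q') {z : V} (hz : z ∈ A) : z ∉ R ∪ B :=
  fun hm => hm.elim (h.dAR z hz) fun hB => h.ne_of_mem hz hB rfl

theorem right_not_mem (h : Bridge G v x A R B p q r s p' q') {z : V} (hz : z ∈ B) : z ∉ A ∪ R :=
  fun hm => hm.elim (fun hA => h.ne_of_mem hA hz rfl) (h.dBR z hz)

/-- Otherwise `R` contains a connector, and it shares `A ∪ R` with `A` and `R ∪ B` with `B`. -/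
theorem not_both [Finite V] (h : Bridge G v x A R B p q r s p' q') {a b : V} (ha : a ∈ R)
    (hva : G.Adj v a) (hb : b ∈ R) (hxb : G.Adj x b) : False :=
  h.false_of_inter (E₁ := A ∪ R) (E₂ := R ∪ B) (E₃ := R)
    (union_subset_union_right _ subset_union_left) subset_union_right
    (Or.inr (Or.inr h.pB.left_mem)) (h.right_not_mem h.pB.left_mem)
    (Or.inl h.pA.left_mem) (h.left_not_mem h.pA.left_mem) h.conn_left h.conn_right h.pR.conn
    subset_union_left subset_union_right subset_union_right subset_union_left ha hva hb hxb

/-- With another neighbour of `r` on `A`, the set `R ∪ A \ {p}` would be connected and attached to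
`v` at `a` and to `x` at `q`, so that neither `p` nor `B` is needed. -/
theorem eq_left_of_attached [Finite V] (h : Bridge G v x A R B p q r s p' q') {a : V} (ha : a ∈ R)
    (hva : G.Adj v a) {y : V} (hy : y ∈ A) (hry : G.Adj r y) : y = p := by
  by_contra hyp
  rcases h.pA.head with ⟨-, hA⟩ | ⟨hpq, c, -, hP, -⟩
  · rw [hA] at hy
    exact hyp hy
  have hr := h.pR.left_mem
  have hc : Conn G (R ∪ A \ {p}) := h.pR.conn.union hP.conn ⟨r, hr, y, ⟨hy, hyp⟩, Or.inr hry⟩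
  have hqA : q ∈ A \ {p} := ⟨h.pA.right_mem, fun e => hpq e.symm⟩
  have hc' : Conn G ((R ∪ B) ∪ A \ {p}) :=
    h.conn_right.union hP.conn ⟨r, Or.inl hr, y, ⟨hy, hyp⟩, Or.inr hry⟩
  refine h.false_of_inter (E₁ := A ∪ R) (E₂ := (R ∪ B) ∪ A \ {p}) (E₃ := R ∪ A \ {p})
    (union_subset_union_right _ subset_union_left) (union_subset subset_union_right
      (sdiff_subset.trans subset_union_left)) (Or.inr (Or.inr h.pB.left_mem))
    (h.right_not_mem h.pB.left_mem) (Or.inl h.pA.left_mem)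
    (fun hm => hm.elim (h.left_not_mem h.pA.left_mem) fun hm => hm.2 rfl) h.conn_left hc' hc
    subset_union_left (subset_union_right.trans subset_union_left)
    (union_subset subset_union_right (sdiff_subset.trans subset_union_left))
    (union_subset_union_left _ subset_union_left) (Or.inl ha) hva (Or.inr hqA)
    ((h.xA q h.pA.right_mem).2 rfl)

/-- Otherwise the bridge without `q` and `p'` is still connected, and it is attached to `v` at `p`
and to `x` at `q'`. -/
theorem not_inner [Finite V] (h : Bridge G v x A R B p q r s p' q') {y z : V} (hy : y ∈ A)
    (hyq : y ≠ q) (hry : G.Adj r y) (hz : z ∈ B) (hzp : z ≠ p') (hsz : G.Adj s z) : False := by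
  rcases h.pA.symm.head with ⟨-, hA⟩ | ⟨hpq, c, -, hP, -⟩
  · rw [hA] at hy
    exact hyq hy
  rcases h.pB.head with ⟨-, hB⟩ | ⟨hpq', c', -, hP', -⟩
  · rw [hB] at hz
    exact hzp hz
  have hr := h.pR.left_mem
  have hs := h.pR.right_mem
  have hc₀ : Conn G (R ∪ B \ {p'}) := h.pR.conn.union hP'.conn ⟨s, hs, z, ⟨hz, hzp⟩, Or.inr hsz⟩
  have hc₁ : Conn G (A ∪ (R ∪ B \ {p'})) :=
    h.pA.conn.union hc₀ ⟨y, hy, r, Or.inl hr, Or.inr hry.symm⟩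
  have hc₂ : Conn G (A \ {q} ∪ (R ∪ B)) :=
    hP.conn.union h.conn_right ⟨y, ⟨hy, hyq⟩, r, Or.inl hr, Or.inr hry.symm⟩
  have hc₃ : Conn G (A \ {q} ∪ (R ∪ B \ {p'})) :=
    hP.conn.union hc₀ ⟨y, ⟨hy, hyq⟩, r, Or.inl hr, Or.inr hry.symm⟩
  refine h.false_of_inter
    (union_subset_union_right _ (union_subset_union_right _ sdiff_subset))
    (union_subset_union_left _ sdiff_subset) (Or.inr (Or.inr h.pB.left_mem)) ?_
    (Or.inl h.pA.right_mem) ?_ hc₁ hc₂ hc₃ subset_union_left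
    (subset_union_right.trans subset_union_right) (union_subset_union_left _ sdiff_subset)
    (union_subset_union_right _ (union_subset_union_right _ sdiff_subset))
    (Or.inl hP.right_mem) ((h.vA p h.pA.left_mem).2 rfl)
    (Or.inr (Or.inr hP'.right_mem)) ((h.xB q' h.pB.right_mem).2 rfl)
  · rintro (hm | hm | hm)
    exacts [h.right_not_mem h.pB.left_mem (Or.inl hm), h.right_not_mem h.pB.left_mem (Or.inr hm),
      hm.2 rfl]
  · rintro (hm | hm)
    exacts [hm.2 rfl, h.left_not_mem h.pA.right_mem hm]

/-- The base cycle runs through `x`, along `A` from `q` to `p`, along `R`, and along `B` from `p'`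
to `q'`. The apex `v` sees `x`, `p` and `p'`. -/
theorem isPyramid (h : Bridge G v x A R B p q r s p' q') (hA : ∀ y ∈ A, G.Adj r y → y = p)
    (hB : ∀ z ∈ B, G.Adj s z → z = p') (hx : ∀ t ∈ R, ¬ G.Adj x t) :
    IsPyramid (G.induce (insert v (insert x (A ∪ (R ∪ B))))) := by
  have hrp : G.Adj r p := by
    obtain ⟨z, hz, hrz⟩ := h.eA
    exact hA z hz hrz ▸ hrz
  have hsp : G.Adj s p' := by
    obtain ⟨z, hz, hsz⟩ := h.eB
    exact hB z hz hsz ▸ hsz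
  have h1 : IndPath G q s (A ∪ R) := by
    refine h.pA.symm.append h.pR hrp.symm h.dAR fun y hy z hz hyz => ?_
    have := h.aA z hz y hy hyz.symm
    subst this
    exact ⟨hA y hy hyz.symm, rfl⟩
  have h2 : IndPath G q q' ((A ∪ R) ∪ B) := by
    refine h1.append h.pB hsp (fun z hz hzB => h.right_not_mem hzB hz) ?_
    rintro y (hy | hy) z hz hyz
    · exact absurd hyz (h.not_adj hy hz)
    · have := h.aB y hy z hz hyz
      subst this
      exact ⟨rfl, hB z hz hyz⟩
  rw [union_assoc] at h2
  have hpA := h.pA.left_mem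
  have hpB := h.pB.left_mem
  have hvx := h.vx
  refine isPyramid_of_hole (a := x) (b := p) (c := p')
    (h2.isCycleGraph (v := x) (h.ne_of_mem h.pA.right_mem h.pB.right_mem) ?_ ?_) ?_
    (Or.inl rfl) (Or.inr (Or.inl hpA)) (Or.inr (Or.inr (Or.inr hpB)))
    (fun e => h.cA.2.2 (e ▸ hpA)) (fun e => h.cB.2.2 (e ▸ hpB)) (h.ne_of_mem hpA hpB) h.vx
    ((h.vA p hpA).2 rfl) ((h.vB p' hpB).2 rfl)
  · rintro (hm | hm | hm)
    exacts [h.cA.2.2 hm, h.xR hm, h.cB.2.2 hm]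
  · rintro z (hz | hz | hz)
    · rw [h.xA z hz, or_iff_left]
      exact h.ne_of_mem hz h.pB.right_mem
    · refine iff_of_false (hx z hz) ?_
      rintro (rfl | rfl)
      exacts [h.dAR _ h.pA.right_mem hz, h.dBR _ h.pB.right_mem hz]
    · rw [h.xB z hz, or_iff_right]
      exact fun e => h.ne_of_mem h.pA.right_mem hz e.symm
  · rintro (hm | hm | hm | hm)
    exacts [h.vx.ne hm, h.cA.2.1 hm, h.vR hm, h.cB.2.1 hm]

/-- Now `A` is one vertex, forming a triangle with `v` and `x`. A single neighbour of `s` on `B`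
gives a stamp, two consecutive ones give a prism, and a wider spread contradicts unlinkedness. -/
theorem isSolidGraph_of_eq [Finite V] (h : Bridge G v x A R B p q r s p' q') (hpq : p = q)
    (hv : ∀ t ∈ R, ¬ G.Adj v t) (hx : ∀ t ∈ R, ¬ G.Adj x t) :
    IsSolidGraph (G.induce (insert v (insert x (A ∪ (R ∪ B))))) := by
  subst hpq
  have hA := h.pA.eq_singleton
  have hpA := h.pA.left_mem
  have hvp : G.Adj v p := (h.vA p hpA).2 rfl
  have hxp : G.Adj x p := (h.xA p hpA).2 rfl
  have hrp : G.Adj r p := by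
    obtain ⟨z, hz, hrz⟩ := h.eA
    rw [hA] at hz
    exact hz ▸ hrz
  have hvx := h.vx
  have hpR : p ∉ R := h.dAR p hpA
  have haR : ∀ y ∈ R, G.Adj p y → y = r := fun y hy e => h.aA y hy p hpA e.symm
  have hpath : IndPath G p s (insert p R) := .cons hrp.symm h.pR hpR haR
  have hvB := h.cB.2.1
  have hxB := h.cB.2.2
  have hpB : p ∉ B := fun hm => h.ne_of_mem hpA hm rfl
  have hpB' : ∀ z ∈ B, ¬ G.Adj p z := fun z hz => h.not_adj hpA hz
  obtain ⟨a, Qa, Qs, ha, hs, hun, hN, hint, hadj⟩ := h.pB.exists_split (S := G.neighborSet s) h.eB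
  have hQa : Qa ⊆ B := hun ▸ subset_union_left
  have hQs : Qs ⊆ B := hun ▸ subset_union_right
  have hsa : G.Adj s a := (hN.symm ▸ rfl : a ∈ Qa ∩ G.neighborSet s).2
  have hNa : ∀ z ∈ Qa, G.Adj s z → z = a := fun z hz e =>
    (hN ▸ ⟨hz, e⟩ : z ∈ ({a} : Set V))
  have haB := hQa ha.right_mem
  have hRB := h.dBR
  have haB' := h.aB
  have hvB' := h.vB
  have hxB' := h.xB
  have hvR := h.vR
  have hxR := h.xR
  have hpva : IndPath G v a (insert v Qa) := .cons ((h.vB p' h.pB.left_mem).2 rfl) ha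
    (fun hm => hvB (hQa hm)) fun z hz => (h.vB z (hQa hz)).1
  by_cases hcase : ∀ z ∈ Qs, G.Adj s z → z = a
  · refine Or.inr (Or.inr (Or.inl ?_))
    have hP₀ : IndPath G p a (insert p R ∪ {a}) := by
      refine hpath.append (.single a) hsa ?_ ?_
      · rintro z (rfl | hz) (rfl : z = a)
        exacts [hpB haB, h.dBR z haB hz]
      · rintro y (rfl | hy) z (rfl : z = a) hyz
        exacts [absurd hyz (hpB' z haB), ⟨h.aB y hy z haB hyz, rfl⟩]
    have hP₂ : IndPath G x a (insert x Qs) := .cons ((h.xB q' h.pB.right_mem).2 rfl) hs.symm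
      (fun hm => hxB (hQs hm)) fun z hz => (h.xB z (hQs hz)).1
    have key := isStamp_of_three hP₀ hpva hP₂ (fun e => hpB (e ▸ haB)) (fun e => hvB (e ▸ haB))
      (fun e => hxB (e ▸ haB)) hvp.symm hxp.symm hvx ?_ ?_ ?_
    · have hset : insert v (insert x (A ∪ (R ∪ B))) =
          (insert p R ∪ {a}) ∪ (insert v Qa ∪ insert x Qs) := by
        rw [hA, ← hun]
        have := ha.right_mem
        ext z
        simp only [mem_union, mem_insert_iff, mem_singleton_iff]
        grind
      rwa [hset]
    · rintro y ((rfl | hy) | rfl) z (rfl | hz)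
      · exact ⟨fun e => absurd e.symm hvp.ne, fun _ => Or.inr ⟨rfl, rfl⟩⟩
      · exact ⟨fun e => absurd (e ▸ hQa hz) hpB, fun e => absurd e (hpB' z (hQa hz))⟩
      · exact ⟨fun e => absurd (e ▸ hy) hvR, fun e => absurd e.symm (hv y hy)⟩
      · refine ⟨fun e => absurd (e ▸ hy) (h.dBR z (hQa hz)), fun e => ?_⟩
        obtain rfl := h.aB y hy z (hQa hz) e
        exact Or.inl (Or.inr (Or.inr (hNa z hz e)))
      · exact ⟨fun _ => rfl, fun _ => Or.inl (Or.inl (Or.inr ha.right_mem))⟩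
      · exact ⟨fun _ => rfl, fun _ => Or.inl (Or.inl (Or.inr ha.right_mem))⟩
    · rintro y ((rfl | hy) | rfl) z (rfl | hz)
      · exact ⟨fun e => absurd e.symm hxp.ne, fun _ => Or.inr ⟨rfl, rfl⟩⟩
      · exact ⟨fun e => absurd (e ▸ hQs hz) hpB, fun e => absurd e (hpB' z (hQs hz))⟩
      · exact ⟨fun e => absurd (e ▸ hy) hxR, fun e => absurd e.symm (hx y hy)⟩
      · refine ⟨fun e => absurd (e ▸ hy) (h.dBR z (hQs hz)), fun e => ?_⟩
        obtain rfl := h.aB y hy z (hQs hz) e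
        exact Or.inl (Or.inr (Or.inr (hcase z hz e)))
      · exact ⟨fun _ => rfl, fun _ => Or.inl (Or.inl (Or.inr hs.left_mem))⟩
      · exact ⟨fun _ => rfl, fun _ => Or.inl (Or.inl (Or.inr hs.left_mem))⟩
    · rintro y (rfl | hy) z (rfl | hz)
      · exact ⟨fun e => absurd e hvx.ne, fun _ => Or.inr ⟨rfl, rfl⟩⟩
      · refine ⟨fun e => absurd (e ▸ hQs hz) hvB, fun e => Or.inl (Or.inr (Or.inr ?_))⟩
        have := (hvB' z (hQs hz)).1 e
        subst this
        exact hint _ ha.left_mem hz ▸ ha.right_mem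
      · refine ⟨fun e => absurd (e ▸ hQa hy) hxB, fun e => Or.inl (Or.inl (Or.inr ?_))⟩
        have := (hxB' y (hQa hy)).1 e.symm
        subst this
        exact hs.right_mem
      · refine ⟨fun e => hint y hy (e ▸ hz), fun e => Or.inl ?_⟩
        rcases hadj y hy z hz e with rfl | rfl
        exacts [Or.inl (Or.inr hs.left_mem), Or.inr (Or.inr ha.right_mem)]
  · push Not at hcase
    obtain ⟨z₀, hz₀, hsz₀, hza₀⟩ := hcase
    obtain ⟨haq, c, hac, hP, hc⟩ := hs.head.resolve_left fun e => hza₀ (by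
      have := e.2 ▸ hz₀
      exact this)
    have hcs := hP.left_mem
    -- Here `c` follows the first neighbour `a` of `s` on `B`, and `b` below is the last neighbour
    -- of `s`, found from the other end.
    have hcB := hQs hcs.1
    obtain ⟨b, Qb, Qc, hb, hbc, hun', hN', hint', -⟩ := hP.symm.exists_split
      (S := G.neighborSet s) ⟨z₀, ⟨hz₀, hza₀⟩, hsz₀⟩
    have hQb : Qb ⊆ Qs \ {a} := hun' ▸ subset_union_left
    have hsb : G.Adj s b := (hN'.symm ▸ rfl : b ∈ Qb ∩ G.neighborSet s).2
    have hcQa : c ∉ Qa := fun hm => hcs.2 (hint c hm hcs.1)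
    by_cases hbc' : b = c
    · subst hbc'
      have hQbs : Qb = Qs \ {a} := by
        rw [← hun', hbc.eq_singleton, union_singleton, insert_eq_of_mem hb.right_mem]
      have hNs : ∀ z ∈ Qs \ {a}, G.Adj s z → z = b := fun z hz e => by
        have : z ∈ Qb ∩ G.neighborSet s := ⟨hQbs ▸ hz, e⟩
        rwa [hN'] at this
      have hP₂ : IndPath G x b (insert x (Qs \ {a})) :=
        .cons ((h.xB q' h.pB.right_mem).2 rfl) hP.symm (fun hm => hxB (hQs hm.1))
          fun z hz => (h.xB z (hQs hz.1)).1
      have key := isPrism_of_three hpath hpva hP₂ (fun e => hpR (e ▸ h.pR.right_mem))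
        (fun e => hvB (e ▸ haB)) (fun e => hxB (e ▸ hcB)) hvp.symm hxp.symm hvx hsa hsb hac ?_ ?_ ?_
      · have hset : insert v (insert x (A ∪ (R ∪ B))) =
            insert p R ∪ (insert v Qa ∪ insert x (Qs \ {a})) := by
          rw [hA, ← hun]
          have := ha.right_mem
          ext z
          simp only [mem_union, mem_insert_iff, mem_singleton_iff, mem_sdiff]
          grind
        rw [hset]
        exact Or.inr (Or.inr (Or.inr key))
      · rintro y (rfl | hy) z (rfl | hz)
        · exact ⟨hvp.ne', fun _ => Or.inl ⟨rfl, rfl⟩⟩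
        · exact ⟨fun e => absurd (e ▸ hQa hz) hpB, fun e => absurd e (hpB' z (hQa hz))⟩
        · exact ⟨fun e => absurd (e ▸ hy) hvR, fun e => absurd e.symm (hv y hy)⟩
        · refine ⟨fun e => absurd (e ▸ hy) (h.dBR z (hQa hz)), fun e => ?_⟩
          obtain rfl := h.aB y hy z (hQa hz) e
          exact Or.inr ⟨rfl, hNa z hz e⟩
      · rintro y (rfl | hy) z (rfl | hz)
        · exact ⟨hxp.ne', fun _ => Or.inl ⟨rfl, rfl⟩⟩
        · exact ⟨fun e => absurd (e ▸ hQs hz.1) hpB, fun e => absurd e (hpB' z (hQs hz.1))⟩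
        · exact ⟨fun e => absurd (e ▸ hy) hxR, fun e => absurd e.symm (hx y hy)⟩
        · refine ⟨fun e => absurd (e ▸ hy) (h.dBR z (hQs hz.1)), fun e => ?_⟩
          obtain rfl := h.aB y hy z (hQs hz.1) e
          exact Or.inr ⟨rfl, hNs z hz e⟩
      · rintro y (rfl | hy) z (rfl | hz)
        · exact ⟨hvx.ne, fun _ => Or.inl ⟨rfl, rfl⟩⟩
        · refine ⟨fun e => absurd (e ▸ hQs hz.1) hvB, fun e => ?_⟩
          have := (hvB' z (hQs hz.1)).1 e
          subst this
          exact absurd (hint _ ha.left_mem hz.1) hz.2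
        · refine ⟨fun e => absurd (e ▸ hQa hy) hxB, fun e => ?_⟩
          have := (hxB' y (hQa hy)).1 e.symm
          subst this
          exact absurd (hint _ hy hs.right_mem).symm haq
        · refine ⟨fun e => hz.2 (hint z (e ▸ hy) hz.1), fun e => Or.inr ?_⟩
          rcases hadj y hy z hz.1 e with rfl | rfl
          exacts [⟨rfl, hc z hz.1 e⟩, absurd rfl hz.2]
    -- The neighbours `a` and `b` of `s` are not consecutive. A detour through `s` avoids `c`, while
    -- `p` is not needed on the side of `B`; so the two connectors would be linked.
    · exfalso
      have hcb : c ∉ Qb := fun hm => hbc' (hint' c hm hbc.right_mem).symm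
      have hsR := h.pR.right_mem
      have c₃ : Conn G (insert s Qa ∪ insert s Qb) :=
        (ha.conn.insert_adj ha.right_mem hsa).union (hb.conn.insert_adj hb.right_mem hsb)
          ⟨s, Or.inl rfl, s, Or.inl rfl, Or.inl rfl⟩
      have c₁ : Conn G ((A ∪ R) ∪ (insert s Qa ∪ insert s Qb)) :=
        h.conn_left.union c₃ ⟨s, Or.inr hsR, s, Or.inl (Or.inl rfl), Or.inl rfl⟩
      have hsub : insert s Qa ∪ insert s Qb ⊆ R ∪ B := by
        rintro z ((rfl | hz) | (rfl | hz))
        exacts [Or.inl hsR, Or.inr (hQa hz), Or.inl hsR, Or.inr (hQs (hQb hz).1)]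
      refine h.false_of_inter (d₁ := c) (d₂ := p) ?_ subset_union_right (Or.inr (Or.inr hcB)) ?_
        (Or.inl hpA) (h.left_not_mem hpA) c₁ h.conn_right c₃
        (subset_union_left.trans subset_union_left) subset_union_right subset_union_right hsub
        (Or.inl (Or.inr ha.left_mem)) ((hvB' p' h.pB.left_mem).2 rfl)
        (Or.inr (Or.inr hb.left_mem)) ((hxB' q' h.pB.right_mem).2 rfl)
      · exact union_subset (union_subset_union_right _ subset_union_left)
          (hsub.trans subset_union_right)
      · rintro ((hm | hm) | (rfl | hm) | (rfl | hm))
        exacts [h.ne_of_mem hm hcB rfl, h.dBR c hcB hm, h.dBR c hcB hsR, hcQa hm,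
          h.dBR c hcB hsR, hcb hm]

theorem isSolidGraph [Finite V] (h : Bridge G v x A R B p q r s p' q') :
    IsSolidGraph (G.induce (insert v (insert x (A ∪ (R ∪ B))))) := by
  have hswap : IsSolidGraph (G.induce (insert x (insert v (A ∪ (R ∪ B))))) →
      IsSolidGraph (G.induce (insert v (insert x (A ∪ (R ∪ B))))) := by
    rw [insert_comm]
    exact id
  have hattached : ∀ {v x p q p' q'}, Bridge G v x A R B p q r s p' q' →
      (∃ t ∈ R, G.Adj v t) → IsSolidGraph (G.induce (insert v (insert x (A ∪ (R ∪ B))))) := by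
    rintro v x p q p' q' h ⟨t, ht, hvt⟩
    exact Or.inl (h.isPyramid (fun y hy => h.eq_left_of_attached ht hvt hy)
      (fun z hz => h.flip.eq_left_of_attached ht hvt hz) fun t' ht' hx => h.not_both ht hvt ht' hx)
  by_cases hv : ∃ t ∈ R, G.Adj v t
  · exact hattached h hv
  by_cases hx : ∃ t ∈ R, G.Adj x t
  · exact hswap (hattached h.swap hx)
  push Not at hv hx
  -- The two dichotomies have four combinations: two give pyramids with apex `v` or `x`, and in the
  -- other two `A` or `B` is a single vertex.
  have h1 : (∀ y ∈ A, G.Adj r y → y = q) ∨ ∀ z ∈ B, G.Adj s z → z = p' := by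
    by_contra hcon
    push Not at hcon
    obtain ⟨⟨y, hy, hry, hyq⟩, z, hz, hsz, hzp⟩ := hcon
    exact h.not_inner hy hyq hry hz hzp hsz
  have h2 : (∀ y ∈ A, G.Adj r y → y = p) ∨ ∀ z ∈ B, G.Adj s z → z = q' := by
    by_contra hcon
    push Not at hcon
    obtain ⟨⟨y, hy, hry, hyq⟩, z, hz, hsz, hzp⟩ := hcon
    exact h.swap.not_inner hy hyq hry hz hzp hsz
  rcases h1 with ha | hb <;> rcases h2 with hc | hd
  · obtain ⟨y, hy, hry⟩ := h.eA
    exact h.isSolidGraph_of_eq ((hc y hy hry).symm.trans (ha y hy hry)) hv hx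
  · exact hswap (Or.inl (h.swap.isPyramid ha hd hv))
  · exact Or.inl (h.isPyramid hc hb hx)
  · obtain ⟨y, hy, hsy⟩ := h.eB
    rw [union_flip]
    exact h.flip.isSolidGraph_of_eq ((hb y hy hsy).symm.trans (hd y hy hsy)) hv hx

end Bridge

/-- Two connected subsets of a connected set that do not touch are joined by an induced path with
neighbours of each set at one end only. -/
theorem Conn.exists_bridge [Finite V] {D A B : Set V} (hD : Conn G D) (hA : Conn G A)
    (hB : Conn G B)
    (hAD : A ⊆ D) (hBD : B ⊆ D) (ht : ¬ Touch G A B) :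
    ∃ R ⊆ D, ∃ r s, IndPath G r s R ∧ (∀ z ∈ A, z ∉ R) ∧ (∀ z ∈ B, z ∉ R) ∧
      (∀ y ∈ R, ∀ z ∈ A, G.Adj y z → y = r) ∧ (∀ y ∈ R, ∀ z ∈ B, G.Adj y z → y = s) ∧
      (∃ z ∈ A, G.Adj r z) ∧ ∃ z ∈ B, G.Adj s z := by
  obtain ⟨R', hR'D, hR'⟩ := hD.exists_minConn (P := A) (P' := B)
    (by rw [inter_eq_right.2 hAD]; exact hA.1) (by rw [inter_eq_right.2 hBD]; exact hB.1)
  obtain ⟨a, b, hP, hRA, hRB⟩ := hR'.exists_indPath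
  have haA : a ∈ A := (hRA.symm ▸ rfl : a ∈ R' ∩ A).2
  have hbB : b ∈ B := (hRB.symm ▸ rfl : b ∈ R' ∩ B).2
  have hRA' : ∀ z ∈ R', z ∈ A → z = a := fun z hz hzA => (hRA ▸ ⟨hz, hzA⟩ : z ∈ ({a} : Set V))
  have hRB' : ∀ z ∈ R', z ∈ B → z = b := fun z hz hzB => (hRB ▸ ⟨hz, hzB⟩ : z ∈ ({b} : Set V))
  obtain ⟨hab, c, hac, hP₁, -⟩ := hP.head.resolve_left fun e => ht ⟨a, haA, b, hbB, Or.inl e.1⟩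
  obtain ⟨hcb, d, hbd, hP₂, -⟩ := hP₁.symm.head.resolve_left fun e =>
    ht ⟨a, haA, b, hbB, Or.inr (e.1 ▸ hac)⟩
  -- The path without its ends in `A` and `B` is minimised once more, now with respect to having
  -- neighbours in `A` and in `B`, so that only its ends have such neighbours.
  obtain ⟨R, hR, hmin⟩ := hP₂.conn.exists_minConn (P := {z | ∃ y ∈ A, G.Adj z y})
    (P' := {z | ∃ y ∈ B, G.Adj z y}) ⟨c, hP₂.right_mem, a, haA, hac.symm⟩
    ⟨d, hP₂.left_mem, b, hbB, hbd.symm⟩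
  obtain ⟨r, s, hrs, hr, hs⟩ := hmin.exists_indPath
  have hsub : R ⊆ R' := fun z hz => (hR hz).1.1
  refine ⟨R, hsub.trans hR'D, r, s, hrs, ?_, ?_, ?_, ?_, ?_, ?_⟩
  · exact fun z hz hzR => (hR hzR).1.2 (hRA' z (hsub hzR) hz)
  · exact fun z hz hzR => (hR hzR).2 (hRB' z (hsub hzR) hz)
  · exact fun y hy z hz hyz => (hr ▸ ⟨hy, z, hz, hyz⟩ : y ∈ ({r} : Set V))
  · exact fun y hy z hz hyz => (hs ▸ ⟨hy, z, hz, hyz⟩ : y ∈ ({s} : Set V))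
  · exact (hr.symm ▸ rfl : r ∈ R ∩ {z | ∃ y ∈ A, G.Adj z y}).2
  · exact (hs.symm ▸ rfl : s ∈ R ∩ {z | ∃ y ∈ B, G.Adj z y}).2

/-- Connectors in a connected set `D` that are not linked in `D` make `D` together with the edge
`vx` a solid. -/
theorem isSolidGraph_of_not_linked [Finite V] {D Q Q' : Set V} (hD : Conn G D) (hv : v ∉ D)
    (hx : x ∉ D) (hvx : G.Adj v x) (hQ : IsConnector G v x Q) (hQ' : IsConnector G v x Q')
    (hQD : Q ⊆ D) (hQD' : Q' ⊆ D) (hl : ¬ Linked G v x D Q Q') :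
    IsSolidGraph (G.induce (insert v (insert x D))) := by
  -- Unlinked connectors lie in no common proper connected subset, so the two with a path joining
  -- them fill `D`.
  have hfull : ∀ E ⊆ D, Conn G E → Q ⊆ E → Q' ⊆ E → E = D := fun E hED hE h h' => by
    by_contra hne
    exact hl (linked_of_subset hQ hQ' (hED.ssubset_of_ne hne) hE h h')
  by_cases ht : Touch G Q Q'
  · have := hfull (Q ∪ Q') (union_subset hQD hQD') (hQ.1.1.union hQ'.1.1 ht) subset_union_left
      subset_union_right
    subst this
    exact isSolidGraph_of_touch hvx hQ hQ' ht hl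
  · obtain ⟨p, q, hpA, hvA, hxA⟩ := hQ.exists_indPath
    obtain ⟨p', q', hpB, hvB, hxB⟩ := hQ'.exists_indPath
    obtain ⟨R, hRD, r, s, hR, dA, dB, aA, aB, ⟨a, ha, hra⟩, ⟨b, hb, hsb⟩⟩ :=
      hD.exists_bridge hQ.1.1 hQ'.1.1 hQD hQD' ht
    have := hfull (Q ∪ (R ∪ Q')) (union_subset hQD (union_subset hRD hQD'))
      (hQ.1.1.union (hR.conn.union hQ'.1.1 ⟨s, hR.right_mem, b, hb, Or.inr hsb⟩)
        ⟨a, ha, r, Or.inl hR.left_mem, Or.inr hra.symm⟩) subset_union_left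
      (subset_union_right.trans subset_union_right)
    subst this
    exact Bridge.isSolidGraph ⟨hvx, hQ, hQ', hpA, hpB, hR, hvA, hxA, hvB, hxB,
      fun h => hv (hRD h), fun h => hx (hRD h), ht, dA, dB, aA, aB, ⟨a, ha, hra⟩, ⟨b, hb, hsb⟩, hl⟩

end Bridge
end GraphSolids

/-! ### Counting connectors by linear algebra -/

namespace GraphSolids
open Set
section Counting
variable {V : Type*} {G : SimpleGraph V} {v x : V}

/-- The components of the graph induced on `W` that contain neighbours of both `v` and `x`. -/
def commonComps (G : SimpleGraph V) (W : Set V) (v x : V) : Set (Set V) :=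
  {K ∈ comps G W | (K ∩ G.neighborSet v).Nonempty ∧ (K ∩ G.neighborSet x).Nonempty}

theorem Linked.apply_eq {D Q Q' : Set V} {φ : Set V → ℚ} (h : Linked G v x D Q Q')
    (hφ : ∀ E, E ⊂ D → Conn G E → ∀ Q Q', IsConnector G v x Q → IsConnector G v x Q' → Q ⊆ E →
      Q' ⊆ E → φ Q = φ Q') : φ Q = φ Q' := by
  induction h with
  | rel _ _ h =>
    obtain ⟨hQ, hQ', E, hED, hE, h1, h2⟩ := h
    exact hφ E hED hE _ _ hQ hQ' h1 h2
  | refl => rfl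
  | symm _ _ _ ih => exact ih.symm
  | trans _ _ _ _ _ ih ih' => exact ih.trans ih'

/-- A function on connectors that agrees on some unlinked pair in each set with an unlinked pair
is constant on the connectors in a connected set. -/
theorem apply_eq_of_conn [Finite V] {W : Set V} (hvW : v ∉ W) (hxW : x ∉ W) {φ : Set V → ℚ}
    (hφ : ∀ D ⊆ W, Conn G D → ∀ Q Q', IsConnector G v x Q → IsConnector G v x Q' → Q ⊆ D →
      Q' ⊆ D → ¬ Linked G v x D Q Q' → ∃ R R', IsConnector G v x R ∧ IsConnector G v x R' ∧
        R ⊆ D ∧ R' ⊆ D ∧ ¬ Linked G v x D R R' ∧ φ R = φ R') {n : ℕ} :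
    ∀ D ⊆ W, D.ncard = n → Conn G D → ∀ Q Q', IsConnector G v x Q → IsConnector G v x Q' →
      Q ⊆ D → Q' ⊆ D → φ Q = φ Q' := by
  induction n using Nat.strong_induction_on with
  | _ n ih =>
    intro D hDW hn hD Q Q' hQ hQ' hQD hQD'
    -- Consecutive members of a chain share a smaller connected set, where the induction hypothesis
    -- applies.
    have hlink : ∀ {Q Q'}, Linked G v x D Q Q' → φ Q = φ Q' := fun hl =>
      hl.apply_eq fun E hE hEc => ih E.ncard (hn ▸ ncard_lt_ncard hE) E (hE.subset.trans hDW) rfl hEc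
    by_contra hne
    obtain ⟨R, R', hR, hR', hRD, hRD', hRR, heq⟩ := hφ D hDW hD Q Q' hQ hQ' hQD hQD'
      fun hl => hne (hlink hl)
    -- Two of `P`, `R`, `R'` are linked, and not `R` with `R'`. As `φ` agrees on these two, it takes
    -- the same value on `P`.
    have hall : ∀ P, IsConnector G v x P → P ⊆ D → φ P = φ R := by
      intro P hP hPD
      obtain ⟨i, j, hij, hl⟩ := exists_linked_of_three hD (fun h => hvW (hDW h))
        (fun h => hxW (hDW h)) ![P, R, R'] (fun i => by fin_cases i <;> assumption)
        (fun i => by fin_cases i <;> assumption)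
      have hl' := hlink hl
      fin_cases i <;> fin_cases j <;> simp at hij hl hl'
      · exact hl'
      · exact hl'.trans heq.symm
      · exact hl'.symm
      · exact absurd hl hRR
      · exact hl'.symm.trans heq.symm
      · exact absurd hl.symm hRR
    exact hne ((hall Q hQ hQD).trans (hall Q' hQ' hQD').symm)

/-- The number of connectors is at most the number of solids plus the number of components. -/
theorem ncard_connectors_le [Finite V] {W : Set V} (hvW : v ∉ W) (hxW : x ∉ W)
    (hvx : G.Adj v x) : {Q | Q ⊆ W ∧ IsConnector G v x Q}.ncard ≤
      {D | D ⊆ W ∧ IsSolidGraph (G.induce (insert v (insert x D)))}.ncard +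
        (commonComps G W v x).ncard := by
  classical
  set 𝒞 := {Q | Q ⊆ W ∧ IsConnector G v x Q} with h𝒞
  set 𝒮 := {D | D ⊆ W ∧ IsSolidGraph (G.induce (insert v (insert x D)))} with h𝒮
  set Γ := commonComps G W v x with hΓ
  have := Fintype.ofFinite 𝒞
  have := Fintype.ofFinite 𝒮
  have := Fintype.ofFinite Γ
  -- Each solid supplies the difference of the values at one chosen unlinked pair, or 0 if there is
  -- none.
  have h1 : ∀ D : 𝒮, ∃ l : (𝒞 → ℚ) →ₗ[ℚ] ℚ, ∀ φ, l φ = 0 → ∀ Q Q' : 𝒞, Q.1 ⊆ D.1 → Q'.1 ⊆ D.1 →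
      ¬ Linked G v x D.1 Q.1 Q'.1 → ∃ R R' : 𝒞, R.1 ⊆ D.1 ∧ R'.1 ⊆ D.1 ∧
        ¬ Linked G v x D.1 R.1 R'.1 ∧ φ R = φ R' := by
    intro D
    by_cases h : ∃ R R' : 𝒞, R.1 ⊆ D.1 ∧ R'.1 ⊆ D.1 ∧ ¬ Linked G v x D.1 R.1 R'.1
    · obtain ⟨R, R', h1, h2, h3⟩ := h
      refine ⟨(LinearMap.proj R : (𝒞 → ℚ) →ₗ[ℚ] ℚ) - LinearMap.proj R', fun φ hφ _ _ _ _ _ =>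
        ⟨R, R', h1, h2, h3, ?_⟩⟩
      rw [LinearMap.sub_apply] at hφ
      exact sub_eq_zero.1 hφ
    · exact ⟨0, fun φ _ Q Q' h1 h2 h3 => absurd ⟨Q, Q', h1, h2, h3⟩ h⟩
  -- Each common component supplies the value at one connector inside it; this fixes the constant.
  have h2 : ∀ K : Γ, ∃ l : (𝒞 → ℚ) →ₗ[ℚ] ℚ, ∀ φ, l φ = 0 → ∃ R : 𝒞, R.1 ⊆ K.1 ∧ φ R = 0 := by
    rintro ⟨K, hK, hv, hx⟩
    obtain ⟨Q, hQK, hQ⟩ := exists_connector_subset hK.1 (fun h => hvW (hK.2.1 h))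
      (fun h => hxW (hK.2.1 h)) hv hx
    exact ⟨(LinearMap.proj ⟨Q, hQK.trans hK.2.1, hQ⟩ : (𝒞 → ℚ) →ₗ[ℚ] ℚ), fun φ hφ => ⟨_, hQK, hφ⟩⟩
  choose l₁ hl₁ using h1
  choose l₂ hl₂ using h2
  let Φ : (𝒞 → ℚ) →ₗ[ℚ] (𝒮 ⊕ Γ → ℚ) := LinearMap.pi (Sum.elim l₁ l₂)
  have hinj : Function.Injective Φ := by
    rw [← LinearMap.ker_eq_bot, LinearMap.ker_eq_bot']
    intro φ hφ
    have hφ₁ : ∀ D, l₁ D φ = 0 := fun D => congrFun hφ (Sum.inl D)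
    have hφ₂ : ∀ K, l₂ K φ = 0 := fun K => congrFun hφ (Sum.inr K)
    let ψ : Set V → ℚ := fun Q => if h : Q ∈ 𝒞 then φ ⟨Q, h⟩ else 0
    have hψ : ∀ Q : 𝒞, ψ Q.1 = φ Q := fun Q => dif_pos Q.2
    have hconst := fun D hDW => apply_eq_of_conn (n := D.ncard) hvW hxW (φ := ψ)
        (fun D hDW hD Q Q' hQ hQ' hQD hQD' hl => by
      have hsol : D ∈ 𝒮 := ⟨hDW, isSolidGraph_of_not_linked hD (fun h => hvW (hDW h))
        (fun h => hxW (hDW h)) hvx hQ hQ' hQD hQD' hl⟩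
      obtain ⟨R, R', h1, h2, h3, h4⟩ := hl₁ ⟨D, hsol⟩ φ (hφ₁ _) ⟨Q, hQD.trans hDW, hQ⟩
        ⟨Q', hQD'.trans hDW, hQ'⟩ hQD hQD' hl
      exact ⟨R.1, R'.1, R.2.2, R'.2.2, h1, h2, h3, by rw [hψ, hψ, h4]⟩) D hDW rfl
    funext Q
    obtain ⟨⟨q, hq⟩, ⟨a, ha, hva⟩, ⟨b, hb, hxb⟩⟩ :=
      And.intro Q.2.2.1.1.1 (And.intro Q.2.2.1.2.1 Q.2.2.1.2.2.1)
    obtain ⟨K, hK, hqK⟩ := exists_mem_comps (G := G) (Q.2.1 hq)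
    have hQK := Q.2.2.1.1.subset_comps Q.2.1 hK hq hqK
    obtain ⟨R, hRK, hR⟩ := hl₂ ⟨K, hK, ⟨a, hQK ha, hva⟩, ⟨b, hQK hb, hxb⟩⟩ φ (hφ₂ _)
    have := hconst K hK.2.1 hK.1 Q.1 R.1 Q.2.2 R.2.2 hQK hRK
    rw [hψ, hψ, hR] at this
    exact this
  have := LinearMap.finrank_le_finrank_of_injective hinj
  rw [Module.finrank_fintype_fun_eq_card, Module.finrank_fintype_fun_eq_card, Fintype.card_sum]
    at this
  simpa only [← Nat.card_eq_fintype_card, Nat.card_coe_set_eq] using this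

end Counting
end GraphSolids

/-! ### Components, differences and the excess -/

namespace GraphSolids
open Set
section Components
variable {V : Type*} {G : SimpleGraph V} {v x : V} {W : Set V}

/-- The components of the graph induced on `W` that contain a neighbour of `v`. -/
def nearComps (G : SimpleGraph V) (W : Set V) (v : V) : Set (Set V) :=
  {K ∈ comps G W | (K ∩ G.neighborSet v).Nonempty}

theorem exists_comps_insert (hx : x ∉ W) : ∃ L, x ∈ L ∧
    comps G (insert x W) = insert L {K ∈ comps G W | ¬ (K ∩ G.neighborSet x).Nonempty} := by
  obtain ⟨L, hL, hxL⟩ := exists_mem_comps (G := G) (mem_insert x W)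
  refine ⟨L, hxL, ext fun K => ⟨fun hK => ?_, ?_⟩⟩
  · by_cases hxK : x ∈ K
    · exact Or.inl (comps_eq_of_mem hK hL hxK hxL)
    · refine Or.inr ⟨⟨hK.1, fun z hz => (hK.2.1 hz).resolve_left fun h => hxK (h ▸ hz), ?_⟩, ?_⟩
      · exact fun a ha b hb => hK.2.2 a ha b (Or.inr hb)
      · rintro ⟨a, ha, hxa⟩
        exact hxK (hK.2.2 a ha x (Or.inl rfl) hxa.symm)
  · rintro (rfl | ⟨hK, hn⟩)
    · exact hL
    · refine ⟨hK.1, hK.2.1.trans (subset_insert _ _), ?_⟩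
      rintro a ha b (rfl | hb) hab
      · exact absurd ⟨a, ha, hab.symm⟩ hn
      · exact hK.2.2 a ha b hb hab

/-- Adding `x` merges the components near it into one and leaves the others alone. -/
theorem ncard_comps_insert [Finite V] (hx : x ∉ W) :
    (comps G (insert x W)).ncard + (nearComps G W x).ncard = (comps G W).ncard + 1 := by
  obtain ⟨L, hxL, hL⟩ := exists_comps_insert (G := G) hx
  rw [hL, ncard_insert_of_notMem fun h => hx (h.1.2.1 hxL)]
  have : {K ∈ comps G W | ¬ (K ∩ G.neighborSet x).Nonempty} = comps G W \ nearComps G W x := by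
    ext K
    simp only [nearComps, mem_sdiff, mem_sep_iff]
    tauto
  have := ncard_sdiff_add_ncard_of_subset (s := nearComps G W x) (t := comps G W) (sep_subset _ _)
  grind

/-- The components near both vertices are absorbed by that of `x`, which is near `v` because of the
edge `vx`. -/
theorem ncard_nearComps_insert [Finite V] (hx : x ∉ W) (hvx : G.Adj v x) :
    (nearComps G (insert x W) v).ncard + (commonComps G W v x).ncard =
      (nearComps G W v).ncard + 1 := by
  obtain ⟨L, hxL, hL⟩ := exists_comps_insert (G := G) hx
  have : nearComps G (insert x W) v = insert L (nearComps G W v \ commonComps G W v x) := by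
    ext K
    simp only [nearComps, commonComps, hL, mem_sdiff, mem_insert_iff, mem_ofPred_eq]
    constructor
    · tauto
    · rintro (rfl | h)
      · exact ⟨Or.inl rfl, x, hxL, hvx⟩
      · tauto
  rw [this, ncard_insert_of_notMem fun h => hx (h.1.1.2.1 hxL)]
  have := ncard_sdiff_add_ncard_of_subset (s := commonComps G W v x) (t := nearComps G W v)
    fun K hK => ⟨hK.1, hK.2.1⟩
  omega

end Components

section Difference
variable {V : Type*} {G : SimpleGraph V} {v x : V}

/-- The difference of a function of vertex sets with respect to a vertex. -/
def vdiff (v : V) (h : Set V → ℤ) : Set V → ℤ := fun U => h U - h (U \ {v})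

theorem vdiff_add (g h : Set V → ℤ) : vdiff v (g + h) = vdiff v g + vdiff v h := by
  funext U
  simp only [vdiff, Pi.add_apply]
  ring

theorem vdiff_sub (g h : Set V → ℤ) : vdiff v (g - h) = vdiff v g - vdiff v h := by
  funext U
  simp only [vdiff, Pi.sub_apply]
  ring

/-- The number of subsets with a given property. -/
noncomputable def count (P : Set V → Prop) : Set V → ℤ := fun U => ({A | A ⊆ U ∧ P A}.ncard : ℤ)

/-- The sets lost on deleting `v` are those that contain `v`; so differences of counts are again
counts. -/
theorem vdiff_count [Finite V] (P : Set V → Prop) :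
    vdiff v (count P) = count fun A => v ∈ A ∧ P A := by
  funext U
  have h1 : {A | A ⊆ U \ {v} ∧ P A} ⊆ {A | A ⊆ U ∧ P A} := fun A hA =>
    ⟨hA.1.trans sdiff_subset, hA.2⟩
  have h2 : {A | A ⊆ U ∧ v ∈ A ∧ P A} = {A | A ⊆ U ∧ P A} \ {A | A ⊆ U \ {v} ∧ P A} := by
    ext A
    have : A ⊆ U \ {v} ↔ A ⊆ U ∧ v ∉ A := by
      rw [subset_sdiff, disjoint_singleton_right]
    simp only [mem_sdiff, mem_ofPred_eq, this]
    tauto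
  have := ncard_sdiff_add_ncard_of_subset h1
  simp only [vdiff, count]
  rw [h2]
  omega

theorem count_nonneg (P : Set V → Prop) (U : Set V) : 0 ≤ count P U := Int.natCast_nonneg _

theorem count_eq_zero {P : Set V → Prop} {U : Set V} (h : ∀ A ⊆ U, ¬ P A) : count P U = 0 := by
  have : {A | A ⊆ U ∧ P A} = ∅ := eq_empty_of_forall_notMem fun A hA => h A hA.1 hA.2
  simp [count, this]

theorem foldr_vdiff_add (l : List V) (g h : Set V → ℤ) :
    l.foldr vdiff (g + h) = l.foldr vdiff g + l.foldr vdiff h := by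
  induction l with
  | nil => rfl
  | cons a l ih => rw [List.foldr_cons, ih, vdiff_add]; rfl

theorem foldr_vdiff_sub (l : List V) (g h : Set V → ℤ) :
    l.foldr vdiff (g - h) = l.foldr vdiff g - l.foldr vdiff h := by
  induction l with
  | nil => rfl
  | cons a l ih => rw [List.foldr_cons, ih, vdiff_sub]; rfl

theorem foldr_vdiff_count [Finite V] (l : List V) (P : Set V → Prop) :
    l.foldr vdiff (count P) = count fun A => (∀ a ∈ l, a ∈ A) ∧ P A := by
  induction l with
  | nil => simp
  | cons a l ih =>
    rw [List.foldr_cons, ih, vdiff_count]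
    simp only [List.mem_cons, forall_eq_or_imp, and_assoc]

theorem foldr_vdiff_zero (l : List V) : l.foldr vdiff (0 : Set V → ℤ) = 0 := by
  induction l with
  | nil => rfl
  | cons a l ih => rw [List.foldr_cons, ih]; funext U; simp [vdiff]

/-- An iterated difference is a signed sum of the values at `B ∪ J` over the subsets `J` of the
list. -/
theorem foldr_vdiff_eq_zero {h : Set V → ℤ} (l : List V) (hl : l.Nodup) (B : Set V)
    (hB : ∀ a ∈ l, a ∉ B) (hh : ∀ J ⊆ {a | a ∈ l}, h (B ∪ J) = 0) :
    l.foldr vdiff h (B ∪ {a | a ∈ l}) = 0 := by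
  induction l generalizing B with
  | nil => exact hh _ subset_rfl
  | cons a l ih =>
    rw [List.nodup_cons] at hl
    have h1 : (B ∪ {b | b ∈ a :: l}) = insert a B ∪ {b | b ∈ l} := by
      ext z
      simp only [mem_union, mem_ofPred_eq, List.mem_cons, mem_insert_iff]
      tauto
    have h2 : (B ∪ {b | b ∈ a :: l}) \ {a} = B ∪ {b | b ∈ l} := by
      have := hB a List.mem_cons_self
      ext z
      simp only [mem_union, mem_ofPred_eq, List.mem_cons, mem_sdiff, mem_singleton_iff]
      grind
    rw [List.foldr_cons, vdiff, h2, h1, ih hl.2, ih hl.2, sub_zero]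
    · exact fun b hb => hB b (List.mem_cons_of_mem _ hb)
    · exact fun J hJ => hh J fun z hz => List.mem_cons_of_mem _ (hJ hz)
    · rintro b hb (rfl | hbB)
      exacts [hl.1 hb, hB b (List.mem_cons_of_mem _ hb) hbB]
    · intro J hJ
      have := hh (insert a J) (insert_subset List.mem_cons_self
        fun z hz => List.mem_cons_of_mem _ (hJ hz))
      rwa [union_insert, ← insert_union] at this

/-- In the inclusion-exclusion sum only the empty `J` survives. -/
theorem foldr_vdiff_eq_pow {h : Set V → ℤ} (l : List V) (hl : l.Nodup) (B : Set V)
    (hB : ∀ a ∈ l, a ∉ B) (hh : ∀ J ⊆ {a | a ∈ l}, J.Nonempty → h (B ∪ J) = 0) :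
    l.foldr vdiff h (B ∪ {a | a ∈ l}) = (-1) ^ l.length * h B := by
  induction l with
  | nil => simp
  | cons a l ih =>
    rw [List.nodup_cons] at hl
    have h1 : (B ∪ {b | b ∈ a :: l}) = insert a B ∪ {b | b ∈ l} := by
      ext z
      simp only [mem_union, mem_ofPred_eq, List.mem_cons, mem_insert_iff]
      tauto
    have h2 : (B ∪ {b | b ∈ a :: l}) \ {a} = B ∪ {b | b ∈ l} := by
      have := hB a List.mem_cons_self
      ext z
      simp only [mem_union, mem_ofPred_eq, List.mem_cons, mem_sdiff, mem_singleton_iff]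
      grind
    rw [List.foldr_cons, vdiff, h2, h1, ih hl.2, foldr_vdiff_eq_zero l hl.2, List.length_cons]
    · ring
    · rintro b hb (rfl | hbB)
      exacts [hl.1 hb, hB b (List.mem_cons_of_mem _ hb) hbB]
    · intro J hJ
      have := hh (insert a J) (insert_subset List.mem_cons_self
        fun z hz => List.mem_cons_of_mem _ (hJ hz)) (insert_nonempty _ _)
      rwa [union_insert, ← insert_union] at this
    · exact fun b hb => hB b (List.mem_cons_of_mem _ hb)
    · exact fun J hJ => hh J fun z hz => List.mem_cons_of_mem _ (hJ hz)

end Difference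

section Excess
variable {V : Type*} {G : SimpleGraph V} {v x : V}

/-- The number of components of an induced subgraph. -/
noncomputable def compCount (G : SimpleGraph V) : Set V → ℤ := fun U => ((comps G U).ncard : ℤ)

/-- Solids minus induced cycles plus edges minus vertices plus components. -/
noncomputable def excess (G : SimpleGraph V) : Set V → ℤ :=
  count (fun A => IsSolidGraph (G.induce A)) - count (fun A => IsCycleGraph (G.induce A)) +
    count (fun A => ∃ a b, G.Adj a b ∧ A = {a, b}) - count (fun A => ∃ a, A = {a}) + compCount G

theorem vdiff_compCount [Finite V] {W : Set V} (hv : v ∉ W) :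
    vdiff v (compCount G) (insert v W) = 1 - (nearComps G W v).ncard := by
  have := ncard_comps_insert (G := G) hv
  rw [vdiff, insert_sdiff_of_mem _ (mem_singleton v), sdiff_singleton_eq_self hv]
  simp only [compCount]
  omega

theorem vdiff_vdiff_compCount [Finite V] {W : Set V} (hv : v ∉ W) (hx : x ∉ W) (hvx : G.Adj v x) :
    vdiff x (vdiff v (compCount G)) (insert v (insert x W)) = (commonComps G W v x).ncard - 1 := by
  have h1 : insert v (insert x W) \ {x} = insert v W := by
    rw [insert_comm, insert_sdiff_of_mem _ (mem_singleton x), sdiff_singleton_eq_self]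
    rintro (h | h)
    exacts [hvx.ne h.symm, hx h]
  have := ncard_nearComps_insert hx hvx
  rw [vdiff, h1, vdiff_compCount hv, vdiff_compCount]
  · omega
  · rintro (h | h)
    exacts [hvx.ne h, hv h]

theorem count_cycles_le [Finite V] {W : Set V} (hvx : G.Adj v x) :
    count (fun A => x ∈ A ∧ v ∈ A ∧ IsCycleGraph (G.induce A)) (insert v (insert x W)) ≤
      ({Q | Q ⊆ W ∧ IsConnector G v x Q}.ncard : ℤ) := by
  simp only [count, Nat.cast_le]
  refine ncard_le_ncard_of_injOn (fun A => A \ {v, x}) ?_ ?_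
  · rintro A ⟨hA, hx, hv, hC⟩
    refine ⟨fun z hz => ?_, hC.isConnector hv hx hvx⟩
    rcases hA hz.1 with h | h | h
    exacts [absurd (Or.inl h) hz.2, absurd (Or.inr h) hz.2, h]
  · rintro A ⟨-, hx, hv, -⟩ B ⟨-, hx', hv', -⟩ (h : A \ {v, x} = B \ {v, x})
    rw [← sdiff_union_of_subset (insert_subset hv (singleton_subset_iff.2 hx)), h,
      sdiff_union_of_subset (insert_subset hv' (singleton_subset_iff.2 hx'))]

theorem le_count_solids [Finite V] {W : Set V} (hv : v ∉ W) (hx : x ∉ W) :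
    ({D | D ⊆ W ∧ IsSolidGraph (G.induce (insert v (insert x D)))}.ncard : ℤ) ≤
      count (fun A => x ∈ A ∧ v ∈ A ∧ IsSolidGraph (G.induce A)) (insert v (insert x W)) := by
  simp only [count, Nat.cast_le]
  refine ncard_le_ncard_of_injOn (fun D => insert v (insert x D)) ?_ ?_
  · rintro D ⟨hD, hs⟩
    exact ⟨insert_subset_insert (insert_subset_insert hD), Or.inr (Or.inl rfl), Or.inl rfl, hs⟩
  · rintro A ⟨hA, -⟩ B ⟨hB, -⟩ (h : insert v (insert x A) = insert v (insert x B))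
    have key : ∀ {A B : Set V}, A ⊆ W → insert v (insert x A) = insert v (insert x B) → A ⊆ B := by
      intro A B hA h z hz
      rcases (h ▸ Or.inr (Or.inr hz) : z ∈ insert v (insert x B)) with h | h | h
      exacts [absurd (h ▸ hA hz) hv, absurd (h ▸ hA hz) hx, h]
    exact (key hA h).antisymm (key hB h.symm)

/-- The mixed difference counts the solids through `vx`, minus the cycles through it, plus 1 for the
edge itself, plus the common components minus 1. The bound on connectors makes this nonnegative. -/
theorem vdiff_vdiff_excess_nonneg [Finite V] {U : Set V} (hv : v ∈ U) (hx : x ∈ U)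
    (hvx : G.Adj v x) : 0 ≤ vdiff x (vdiff v (excess G)) U := by
  obtain ⟨W, hvW, hxW, rfl⟩ : ∃ W, v ∉ W ∧ x ∉ W ∧ U = insert v (insert x W) := by
    refine ⟨U \ {v, x}, fun h => h.2 (Or.inl rfl), fun h => h.2 (Or.inr rfl), ?_⟩
    ext z
    simp only [mem_insert_iff, mem_sdiff, mem_singleton_iff]
    grind
  have h1 : count (fun A => x ∈ A ∧ v ∈ A ∧ ∃ a b, G.Adj a b ∧ A = {a, b})
      (insert v (insert x W)) = 1 := by
    have : {A | A ⊆ insert v (insert x W) ∧ x ∈ A ∧ v ∈ A ∧ ∃ a b, G.Adj a b ∧ A = {a, b}} =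
        {{v, x}} := by
      ext A
      constructor
      · rintro ⟨-, hx, hv, a, b, hab, rfl⟩
        have := hvx.ne
        show _ = _
        rcases hx with rfl | rfl <;> rcases hv with rfl | rfl
        exacts [absurd rfl this, pair_comm _ _, rfl, absurd rfl this]
      · rintro rfl
        exact ⟨by grind, by grind, by grind, v, x, hvx, rfl⟩
    simp [count, this]
  have h2 : count (fun A => x ∈ A ∧ v ∈ A ∧ ∃ a : V, A = {a}) (insert v (insert x W)) = 0 := by
    refine count_eq_zero ?_
    rintro A - ⟨hx, hv, a, rfl⟩
    exact hvx.ne ((show v = a from hv).trans (show x = a from hx).symm)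
  have h3 := count_cycles_le (W := W) hvx
  have h4 := le_count_solids (G := G) hvW hxW
  have h5 := vdiff_vdiff_compCount hvW hxW hvx
  have h6 := ncard_connectors_le hvW hxW hvx
  simp only [excess, vdiff_add, vdiff_sub, vdiff_count, Pi.add_apply, Pi.sub_apply] at *
  omega

/-- Deleting a neighbour `x` of `v` lowers the difference at `v` by a mixed difference, which is
nonnegative. For an isolated `v` the vertex and its component cancel, and no cycle is involved. -/
theorem vdiff_excess_nonneg [Finite V] {n : ℕ} {U : Set V} (hv : v ∈ U)
    (hn : (U ∩ G.neighborSet v).ncard = n) : 0 ≤ vdiff v (excess G) U := by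
  induction n generalizing U with
  | zero =>
    rw [ncard_eq_zero] at hn
    have hnb : ∀ z ∈ U, ¬ G.Adj v z := fun z hz h =>
      notMem_empty z (hn ▸ ⟨hz, h⟩)
    obtain ⟨W, hvW, rfl⟩ : ∃ W : Set V, v ∉ W ∧ U = insert v W := by
      refine ⟨U \ {v}, fun h => h.2 rfl, ?_⟩
      rw [insert_sdiff_singleton, insert_eq_of_mem hv]
    have h1 : count (fun A => v ∈ A ∧ IsCycleGraph (G.induce A)) (insert v W) = 0 := by
      refine count_eq_zero ?_
      rintro A hA ⟨hv, hC⟩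
      obtain ⟨b, hb, c, -, -, h⟩ := hC.two_neighbors hv
      exact hnb b (hA hb) ((h b hb).2 (Or.inl rfl))
    have h2 : count (fun A => v ∈ A ∧ ∃ a, A = {a}) (insert v W) = 1 := by
      have : {A | A ⊆ insert v W ∧ v ∈ A ∧ ∃ a, A = {a}} = {{v}} := by
        ext A
        constructor
        · rintro ⟨-, hv, a, rfl⟩
          obtain rfl : v = a := hv
          rfl
        · rintro rfl
          exact ⟨by grind, rfl, v, rfl⟩
      simp [count, this]
    have h3 : (nearComps G W v).ncard = 0 := by
      rw [ncard_eq_zero]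
      refine eq_empty_of_forall_notMem ?_
      rintro K ⟨hK, a, ha, hva⟩
      exact hnb a (Or.inr (hK.2.1 ha)) hva
    have h4 := vdiff_compCount (G := G) hvW
    have h5 := count_nonneg (fun A => v ∈ A ∧ IsSolidGraph (G.induce A)) (insert v W)
    have h6 := count_nonneg (fun A => v ∈ A ∧ ∃ a b, G.Adj a b ∧ A = {a, b}) (insert v W)
    simp only [excess, vdiff_add, vdiff_sub, vdiff_count, Pi.add_apply, Pi.sub_apply] at *
    omega
  | succ n ih =>
    obtain ⟨x, hx, hvx⟩ : (U ∩ G.neighborSet v).Nonempty := by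
      rw [← ncard_pos, hn]
      exact n.succ_pos
    have h1 := vdiff_vdiff_excess_nonneg hv hx hvx
    have h2 : 0 ≤ vdiff v (excess G) (U \ {x}) := by
      refine ih ⟨hv, hvx.ne⟩ ?_
      have : U \ {x} ∩ G.neighborSet v = (U ∩ G.neighborSet v) \ {x} := by
        ext z
        simp only [mem_inter_iff, mem_sdiff]
        tauto
      have hm : x ∈ U ∩ G.neighborSet v := ⟨hx, hvx⟩
      rw [this, ncard_sdiff_singleton_of_mem hm, hn]
      rfl
    rw [vdiff] at h1
    omega

theorem excess_mono [Finite V] {U U' : Set V} (h : U' ⊆ U) : excess G U' ≤ excess G U := by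
  obtain ⟨n, hn⟩ : ∃ n, (U \ U').ncard = n := ⟨_, rfl⟩
  induction n generalizing U with
  | zero =>
    rw [ncard_eq_zero, sdiff_eq_empty] at hn
    rw [h.antisymm hn]
  | succ n ih =>
    obtain ⟨v, hv⟩ : (U \ U').Nonempty := by
      rw [← ncard_pos, hn]
      exact n.succ_pos
    have h1 := vdiff_excess_nonneg (G := G) hv.1 rfl
    have h2 : excess G U' ≤ excess G (U \ {v}) := by
      refine ih (fun z hz => ⟨h hz, fun e => hv.2 (e ▸ hz)⟩) ?_
      rw [sdiff_sdiff_comm, ncard_sdiff_singleton_of_mem hv, hn]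
      rfl
    rw [vdiff] at h1
    omega

theorem excess_empty_nonneg [Finite V] : 0 ≤ excess G ∅ := by
  have h1 : count (fun A => IsCycleGraph (G.induce A)) ∅ = 0 := by
    refine count_eq_zero fun A hA hC => ?_
    obtain ⟨a, ha⟩ := hC.conn.1
    exact hA ha
  have h2 : count (fun A => ∃ a : V, A = {a}) ∅ = 0 := by
    refine count_eq_zero ?_
    rintro A hA ⟨a, rfl⟩
    exact hA rfl
  have h3 := count_nonneg (fun A => IsSolidGraph (G.induce A)) ∅
  have h4 := count_nonneg (fun A => ∃ a b, G.Adj a b ∧ A = {a, b}) ∅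
  have h5 : 0 ≤ compCount G ∅ := Int.natCast_nonneg _
  simp only [excess, Pi.add_apply, Pi.sub_apply] at *
  omega

theorem excess_nonneg [Finite V] (U : Set V) : 0 ≤ excess G U :=
  excess_empty_nonneg.trans (excess_mono (empty_subset U))

theorem excess_eq_zero [Finite V] (h : excess G univ = 0) : excess G = 0 :=
  funext fun U => ((excess_mono (subset_univ U)).trans_eq h).antisymm (excess_nonneg U)

end Excess
end GraphSolids

/-! ### Zero excess forces vertices of small degree -/

namespace GraphSolids
open Set
section Degenerate
variable {V : Type*} {G : SimpleGraph V} {v x : V}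

/-- Any two vertices of `J` are adjacent or joined through `C`, so exactly one component is near
`v`, and adding `v` does not change the number of components. -/
theorem vdiff_compCount_eq_zero [Finite V] {C J : Set V} (hC : C = ∅ ∨ Conn G C) (hv : v ∉ C ∪ J)
    (hvC : ∀ z ∈ C, ¬ G.Adj v z) (hvJ : ∀ z ∈ J, G.Adj v z) (hJ : J.Nonempty)
    (hcl : ∀ a ∈ J, ∀ b ∈ J, a ≠ b → ¬ G.Adj a b → (∃ z ∈ C, G.Adj a z) ∧ ∃ z ∈ C, G.Adj b z) :
    vdiff v (compCount G) (insert v (C ∪ J)) = 0 := by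
  obtain ⟨a, ha⟩ := hJ
  obtain ⟨K, hK, haK⟩ := exists_mem_comps (G := G) (U := C ∪ J) (Or.inr ha)
  have : nearComps G (C ∪ J) v = {K} := by
    ext K'
    constructor
    · rintro ⟨hK', b, hbK, hvb⟩
      have hb : b ∈ J := (hK'.2.1 hbK).resolve_left fun h => hvC b h hvb
      have key : ∀ S ⊆ C ∪ J, Conn G S → a ∈ S → b ∈ S → K' = K := fun S hS hSc haS hbS =>
        comps_eq_of_mem hK' hK hbK (hSc.subset_comps hS hK haS haK hbS)
      have hab' : ({a, b} : Set V) ⊆ C ∪ J :=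
        insert_subset (Or.inr ha) (singleton_subset_iff.2 (Or.inr hb))
      by_cases hab : a = b
      · exact key {a} (singleton_subset_iff.2 (Or.inr ha)) (conn_singleton a) rfl hab.symm
      by_cases hadj : G.Adj a b
      · exact key {a, b} hab' ((conn_singleton b).insert_adj rfl hadj) (Or.inl rfl) (Or.inr rfl)
      · obtain ⟨⟨z, hz, haz⟩, y, hy, hby⟩ := hcl a ha b hb hab hadj
        have hCc := hC.resolve_left fun h => notMem_empty z (h ▸ hz)
        exact key (insert a (insert b C))
          (insert_subset (Or.inr ha) (insert_subset (Or.inr hb) subset_union_left))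
          ((hCc.insert_adj hy hby).insert_adj (Or.inr hz) haz) (Or.inl rfl) (Or.inr (Or.inl rfl))
    · rintro rfl
      exact ⟨hK, a, haK, hvJ a ha⟩
  rw [vdiff_compCount hv, this, ncard_singleton]
  rfl

/-- In a graph without excess, four neighbours of `v` cannot be pairwise adjacent or attached to
a connected set off `v`. -/
theorem excess_ne_zero [Finite V] {C : Set V} (hC : C = ∅ ∨ Conn G C) (hv : v ∉ C)
    (hvC : ∀ z ∈ C, ¬ G.Adj v z) {l : List V} (hl : l.Nodup) (hlen : l.length = 4)
    (hlC : ∀ a ∈ l, a ∉ C) (hvl : ∀ a ∈ l, G.Adj v a)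
    (hcl : ∀ a ∈ l, ∀ b ∈ l, a ≠ b → ¬ G.Adj a b → (∃ z ∈ C, G.Adj a z) ∧ ∃ z ∈ C, G.Adj b z) :
    excess G ≠ 0 := by
  intro h0
  have hvl' : v ∉ l := fun h => (hvl v h).ne rfl
  -- Adding `v` creates a component only if no vertex of the list is present. So the iterated
  -- difference is (-1)^4 · 1.
  have h1 : l.foldr vdiff (vdiff v (compCount G)) (insert v C ∪ {a | a ∈ l}) = 1 := by
    rw [foldr_vdiff_eq_pow l hl, hlen, vdiff_compCount hv]
    · have : (nearComps G C v).ncard = 0 := by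
        rw [ncard_eq_zero]
        refine eq_empty_of_forall_notMem ?_
        rintro K ⟨hK, a, ha, hva⟩
        exact hvC a (hK.2.1 ha) hva
      simp [this]
    · rintro a ha (rfl | h)
      exacts [hvl' ha, hlC a ha h]
    · intro J hJ hne
      rw [insert_union]
      refine vdiff_compCount_eq_zero hC ?_ hvC (fun z hz => hvl z (hJ hz)) hne
        fun a ha b hb => hcl a (hJ ha) b (hJ hb)
      rintro (h | h)
      exacts [hv h, hvl' (hJ h)]
  obtain ⟨a, b, c, l', rfl⟩ : ∃ a b c l', l = a :: b :: c :: l' := by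
    match l, hlen with
    | [a, b, c, d], _ => exact ⟨a, b, c, [d], rfl⟩
  have hab : a ≠ b := by grind
  have hac : a ≠ c := by grind
  have hbc : b ≠ c := by grind
  set l := a :: b :: c :: l' with hl'
  have ha : a ∈ l := by grind
  have hb : b ∈ l := by grind
  have hc : c ∈ l := by grind
  set U := insert v C ∪ {a | a ∈ l}
  -- An induced cycle contains only two neighbours of `v`. Edges and single vertices are too small
  -- as well, and the solids contribute at least 0, so the iterated difference of the excess is at
  -- least 1.
  have h2 : count (fun A => (∀ a ∈ l, a ∈ A) ∧ v ∈ A ∧ IsCycleGraph (G.induce A)) U = 0 := by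
    refine count_eq_zero ?_
    rintro A - ⟨hA, hvA, hcyc⟩
    obtain ⟨y, -, z, -, -, h⟩ := hcyc.two_neighbors hvA
    have h₁ := (h a (hA a ha)).1 (hvl a ha)
    have h₂ := (h b (hA b hb)).1 (hvl b hb)
    have h₃ := (h c (hA c hc)).1 (hvl c hc)
    grind
  have h3 : count (fun A => (∀ a ∈ l, a ∈ A) ∧ v ∈ A ∧ ∃ a b, G.Adj a b ∧ A = {a, b}) U = 0 := by
    refine count_eq_zero ?_
    rintro A - ⟨hA, hvA, y, z, -, rfl⟩
    have h₁ := hA a ha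
    have h₂ := hA b hb
    have h₃ := hA c hc
    grind
  have h4 := count_nonneg (fun A => (∀ a ∈ l, a ∈ A) ∧ v ∈ A ∧ IsSolidGraph (G.induce A)) U
  have h5 : count (fun A => (∀ a ∈ l, a ∈ A) ∧ v ∈ A ∧ ∃ a : V, A = {a}) U = 0 := by
    refine count_eq_zero ?_
    rintro A - ⟨hA, -, y, rfl⟩
    exact hab ((hA a ha).trans (hA b hb).symm)
  have h6 : l.foldr vdiff (vdiff v (excess G)) U = 0 := by
    have : vdiff v (0 : Set V → ℤ) = 0 := by
      funext U
      simp [vdiff]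
    rw [h0, this, foldr_vdiff_zero]
    rfl
  simp only [excess, vdiff_add, vdiff_sub, vdiff_count, foldr_vdiff_add, foldr_vdiff_sub,
    foldr_vdiff_count, Pi.add_apply, Pi.sub_apply] at h6
  omega

/-- The vertices of `W` see nothing of `C`, everything of `K`, and within `U` only `W ∪ K`; those of
`K` are attached to `C`. If `W` is a clique, four `U`-neighbours of one of its vertices contradict
`excess_ne_zero`. Otherwise a connected part of `W` takes over the role of `C`, and `W` shrinks. -/
theorem exists_degree_le_of_config [Finite V] (h0 : excess G = 0) (U : Set V) {n : ℕ}
    {C K W : Set V} (hn : W.ncard = n) (hC : C = ∅ ∨ Conn G C) (hW : W.Nonempty)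
    (hCK : ∀ k ∈ K, k ∉ C) (hCW : ∀ w ∈ W, w ∉ C) (hK : ∀ k ∈ K, ∃ z ∈ C, G.Adj k z)
    (hWK : ∀ w ∈ W, ∀ k ∈ K, G.Adj w k) (hWC : ∀ w ∈ W, ∀ z ∈ C, ¬ G.Adj w z)
    (hN : ∀ w ∈ W, ∀ z ∈ U, G.Adj w z → z ∈ W ∪ K) :
    ∃ w ∈ W, (U ∩ G.neighborSet w).ncard ≤ 3 := by
  induction n using Nat.strong_induction_on generalizing C K W with
  | _ n ih =>
    by_cases hcl : ∀ a ∈ W, ∀ b ∈ W, a ≠ b → G.Adj a b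
    · obtain ⟨v, hv⟩ := hW
      refine ⟨v, hv, ?_⟩
      by_contra hcon
      obtain ⟨F, hF, hF4⟩ := exists_subset_card_eq (s := U ∩ G.neighborSet v) (n := 4) (by omega)
      obtain ⟨F, rfl⟩ : ∃ F' : Finset V, F = F' := ⟨F.toFinite.toFinset, by simp⟩
      rw [ncard_coe_finset] at hF4
      have hmem : ∀ a ∈ F.toList, a ∈ W ∪ K := fun a ha =>
        hN v hv a (hF (Finset.mem_coe.2 (Finset.mem_toList.1 ha))).1
          (hF (Finset.mem_coe.2 (Finset.mem_toList.1 ha))).2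
      refine excess_ne_zero hC (hCW v hv) (hWC v hv) F.nodup_toList (by simpa using hF4) ?_ ?_ ?_ h0
      · exact fun a ha => (hmem a ha).elim (hCW a) (hCK a)
      · exact fun a ha => (hF (Finset.mem_coe.2 (Finset.mem_toList.1 ha))).2
      · intro a ha b hb hab hadj
        rcases hmem a ha with ha | ha <;> rcases hmem b hb with hb | hb
        · exact absurd (hcl a ha b hb hab) hadj
        · exact absurd (hWK a ha b hb) hadj
        · exact absurd (hWK b hb a ha).symm hadj
        · exact ⟨hK a ha, hK b hb⟩
    · push Not at hcl
      obtain ⟨a, ha, b, hb, hab, hadj⟩ := hcl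
      -- `C'` is maximal among the connected subsets of `W` that leave some vertex of `W` outside
      -- and unattached; the attached vertices of `W` join `K`.
      obtain ⟨C', hbC', hmax⟩ := (Set.toFinite {C' : Set V | C' ⊆ W ∧ Conn G C' ∧
        ∃ v ∈ W, v ∉ C' ∧ ∀ z ∈ C', ¬ G.Adj v z}).exists_le_maximal (a := {b})
        ⟨singleton_subset_iff.2 hb, conn_singleton b, a, ha, hab, by rintro z rfl; exact hadj⟩
      obtain ⟨⟨hC'W, hC', v, hv, hvC', hvadj⟩, hmax⟩ := hmax
      set K' := {w ∈ W | w ∉ C' ∧ ∃ z ∈ C', G.Adj w z} with hK'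
      set W' := {w ∈ W | w ∉ C' ∧ ∀ z ∈ C', ¬ G.Adj w z} with hW'
      have hKW : ∀ k ∈ K, k ∉ W := fun k hk hkW => (hWK k hkW k hk).ne rfl
      obtain ⟨c, hc⟩ := hC'.1
      have hlt : W'.ncard < n := by
        rw [← hn]
        exact ncard_lt_ncard (ssubset_iff_exists.2 ⟨sep_subset _ _, c, hC'W hc, fun h => h.2.1 hc⟩)
      suffices ∃ w ∈ W', (U ∩ G.neighborSet w).ncard ≤ 3 from
        this.imp fun w hw => ⟨hw.1.1, hw.2⟩
      refine ih _ hlt (C := C') (K := K ∪ K') rfl (Or.inr hC') ⟨v, hv, hvC', hvadj⟩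
        ?_ (fun w hw => hw.2.1) ?_ ?_ (fun w hw => hw.2.2) ?_
      · rintro k (hk | hk)
        exacts [fun h => hKW k hk (hC'W h), hk.2.1]
      · rintro k (hk | hk)
        exacts [⟨c, hc, (hWK c (hC'W hc) k hk).symm⟩, hk.2.2]
      · rintro w hw k (hk | hk)
        · exact hWK w hw.1 k hk
        -- If `w` did not see `k`, then `C'` with `k` would still leave `w` unattached, contrary to
        -- maximality.
        · by_contra hwk
          obtain ⟨z, hz, hkz⟩ := hk.2.2
          refine hk.2.1 (hmax ⟨insert_subset hk.1 hC'W, hC'.insert_adj hz hkz, w, hw.1, ?_, ?_⟩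
            (subset_insert k C') (mem_insert k C'))
          · rintro (rfl | h)
            exacts [hw.2.2 z hz hkz, hw.2.1 h]
          · rintro y (rfl | hy)
            exacts [hwk, hw.2.2 y hy]
      · intro w hw z hz hwz
        rcases hN w hw.1 z hz hwz with h | h
        · by_cases hzC : z ∈ C'
          · exact absurd hwz (hw.2.2 z hzC)
          by_cases hzK : ∃ y ∈ C', G.Adj z y
          · exact Or.inr (Or.inr ⟨h, hzC, hzK⟩)
          · push Not at hzK
            exact Or.inl ⟨h, hzC, hzK⟩
        · exact Or.inr (Or.inl h)

theorem exists_degree_le [Finite V] (h0 : excess G = 0) {U : Set V} (hU : U.Nonempty) :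
    ∃ w ∈ U, (U ∩ G.neighborSet w).ncard ≤ 3 :=
  exists_degree_le_of_config h0 U (C := ∅) (K := ∅) rfl (Or.inl rfl) hU (by simp) (by simp)
    (by simp) (by simp) (by simp) fun w _ z hz _ => Or.inl hz

/-- A graph in which every nonempty induced subgraph has a vertex of degree at most three is
4-colourable. -/
theorem colorable_four_of_degenerate [Finite V]
    (h : ∀ U : Set V, U.Nonempty → ∃ w ∈ U, (U ∩ G.neighborSet w).ncard ≤ 3) : G.Colorable 4 := by
  classical
  have key : ∀ n, ∀ U : Set V, U.ncard = n → ∃ c : V → Fin 4, ∀ a ∈ U, ∀ b ∈ U, G.Adj a b →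
      c a ≠ c b := by
    intro n
    induction n with
    | zero =>
      intro U hU
      rw [ncard_eq_zero] at hU
      exact ⟨fun _ => 0, fun a ha => absurd ha (hU ▸ notMem_empty a)⟩
    | succ n ih =>
      intro U hU
      obtain ⟨w, hw, hd⟩ := h U ((ncard_pos).1 (hU ▸ n.succ_pos))
      obtain ⟨c, hc⟩ := ih (U \ {w}) (by rw [ncard_sdiff_singleton_of_mem hw, hU]; rfl)
      obtain ⟨k, hk⟩ : ∃ k, k ∉ c '' (U ∩ G.neighborSet w) := by
        by_contra hcon
        push Not at hcon
        have h1 := ncard_image_le (f := c) (U ∩ G.neighborSet w).toFinite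
        rw [eq_univ_of_forall hcon, ncard_univ, Nat.card_eq_fintype_card, Fintype.card_fin] at h1
        omega
      have hk' : ∀ b ∈ U, G.Adj w b → k ≠ c b := fun b hb hwb e => hk ⟨b, ⟨hb, hwb⟩, e.symm⟩
      refine ⟨Function.update c w k, fun a ha b hb hab => ?_⟩
      by_cases haw : a = w
      · subst haw
        rw [Function.update_self, Function.update_of_ne hab.ne']
        exact hk' b hb hab
      by_cases hbw : b = w
      · subst hbw
        rw [Function.update_self, Function.update_of_ne haw]
        exact (hk' a ha hab.symm).symm
      rw [Function.update_of_ne haw, Function.update_of_ne hbw]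
      exact hc a ⟨ha, haw⟩ b ⟨hb, hbw⟩ hab
  obtain ⟨c, hc⟩ := key _ univ rfl
  exact ⟨SimpleGraph.Coloring.mk c fun {a b} hab => hc a (mem_univ a) b (mem_univ b) hab⟩

end Degenerate

/-! ### From vertex sets to induced subgraphs, and the theorem -/

section Subgraphs
variable {V : Type*} {G : SimpleGraph V}

theorem coe_eq_induce {H : G.Subgraph} (hH : H.IsInduced) : H.coe = G.induce H.verts := by
  ext a b
  exact ⟨fun h => h.adj_sub, fun h => hH a.2 b.2 h⟩

/-- An induced subgraph is determined by its vertex set, so solids and induced cycles can be counted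
as vertex sets. -/
theorem ncard_induced (P : ∀ A : Set V, SimpleGraph A → Prop) :
    {H : G.Subgraph | H.IsInduced ∧ P H.verts H.coe}.ncard = {A | P A (G.induce A)}.ncard := by
  refine ncard_congr (fun H _ => H.verts) ?_ ?_ ?_
  · rintro H ⟨hH, hP⟩
    rw [coe_eq_induce hH] at hP
    exact hP
  · rintro H H' ⟨hH, -⟩ ⟨hH', -⟩ (h : H.verts = H'.verts)
    refine SimpleGraph.Subgraph.ext h (funext fun a => funext fun b => propext ?_)
    exact ⟨fun e => hH' (h ▸ e.fst_mem) (h ▸ e.snd_mem) e.adj_sub,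
      fun e => hH (h ▸ e.fst_mem) (h ▸ e.snd_mem) e.adj_sub⟩
  · intro A hA
    have hind : ((⊤ : G.Subgraph).induce A).IsInduced := fun a ha b hb hab => ⟨ha, hb, hab⟩
    refine ⟨(⊤ : G.Subgraph).induce A, ⟨hind, ?_⟩, rfl⟩
    rw [coe_eq_induce hind]
    exact hA

theorem excess_univ [Finite V] (hG : G.Connected) : excess G univ =
    ((solids G).ncard : ℤ) - (inducedCycles G).ncard + G.edgeSet.ncard - Nat.card V + 1 := by
  have h1 : (solids G).ncard = {A : Set V | IsSolidGraph (G.induce A)}.ncard :=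
    ncard_induced fun _ => IsSolidGraph
  have h2 : (inducedCycles G).ncard = {A : Set V | IsCycleGraph (G.induce A)}.ncard :=
    ncard_induced fun _ => IsCycleGraph
  have h3 : {A : Set V | ∃ a b, G.Adj a b ∧ A = {a, b}}.ncard = G.edgeSet.ncard := by
    refine (ncard_congr (fun e _ => {a | a ∈ e}) ?_ ?_ ?_).symm
    · intro e he
      induction e with
      | h a b => exact ⟨a, b, he, by ext z; simp⟩
    · intro e e' _ _ h
      exact Sym2.ext fun z => Set.ext_iff.1 h z
    · rintro _ ⟨a, b, hab, rfl⟩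
      exact ⟨s(a, b), hab, by ext z; simp⟩
  have h4 : {A : Set V | ∃ a, A = {a}}.ncard = Nat.card V := by
    rw [← ncard_univ, ← ncard_image_of_injective univ singleton_injective, image_univ]
    congr 1
    ext A
    simp [eq_comm]
  have h5 : comps G univ = {univ} := by
    have hU : univ ∈ comps G univ := ⟨conn_univ hG, subset_rfl, fun _ _ b _ _ => mem_univ b⟩
    obtain ⟨a⟩ := hG.nonempty
    ext K
    refine ⟨fun hK => ?_, fun h => (show K = univ from h) ▸ hU⟩
    obtain ⟨k, hk⟩ := hK.1.1
    exact comps_eq_of_mem hK hU hk (mem_univ k)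
  simp only [excess, count, compCount, Pi.add_apply, Pi.sub_apply, subset_univ, true_and, h1, h2,
    h3, h4, h5, ncard_singleton]
  rfl

end Subgraphs
end GraphSolids

theorem corollary4p3p3 {V : Type*} [Finite V] (G : SimpleGraph V) (hG : G.Connected)
    (D : GraphSolids.PlaneDrawing G) :
    D.regions.Finite ∧
    ((GraphSolids.solids G).ncard : ℤ) - ((GraphSolids.inducedCycles G).ncard : ℤ)
        + (D.regions.ncard : ℤ) ≥ 1 ∧
    (((GraphSolids.solids G).ncard : ℤ) - ((GraphSolids.inducedCycles G).ncard : ℤ)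
        + (D.regions.ncard : ℤ) = 1 → G.chromaticNumber ≤ 4) := by
  have hfin := D.finite_regions
  have h1 := D.card_edges_add_two_le hG hfin
  have h2 := GraphSolids.excess_univ hG
  have h3 := GraphSolids.excess_nonneg (G := G) Set.univ
  -- By Euler's inequality S - C + F is at least excess + 1. Thus the bound follows from
  -- nonnegativity, and the value 1 forces the excess to be 0.
  refine ⟨hfin, by omega, fun h => ?_⟩
  have h4 : GraphSolids.excess G = 0 := GraphSolids.excess_eq_zero (by omega)
  exact (GraphSolids.colorable_four_of_degenerate
    fun U hU => GraphSolids.exists_degree_le h4 hU).chromaticNumber_le
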